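/- Let $p\ge 1$ be an integer, $\theta>0$, and let $a_1,\dots,a_p$, $b_1,\dots,b_{p-1}$ be real numbers, none of which is a non-positive integer. Write $\Delta=\{z\in\mathbb{C}:|z|<\sqrt\theta\}$, $(x)_k=x(x+1)\cdots(x+k-1)$, $\Gamma\!\left[{(a_p)\atop (b_{p-1})}\right]=\prod_i\Gamma(a_i)/\prod_i\Gamma(b_i)$, let $[x]$ be the largest integer not exceeding $x$, $d\sigma$ the planar Lebesgue measure, and $f_k$ the Taylor coefficients of $f$ at $0$. Let $d_1,\dots,d_m$ be the negative ones among $a_1,\dots,a_p,b_1,\dots,b_{p-1}$, counted with multiplicity and ordered by increasing absolute value; put $[d_0]=0$ and $\nu=\sum_{k=1}^m[d_k]$. A Krein space is a complex vector space with a Hermitian form $[\cdot,\cdot]$ that is an orthogonal direct sum of a Hilbert space for $[\cdot,\cdot]$ and a Hilbert space for $-[\cdot,\cdot]$; it is a positive (negative) Pontryagin space with negative (positive) index $\kappa$ if the second (first) summand has finite dimension $\kappa$, and a Pontryagin space if it is one or the other. A space of functions on $\Delta$ has reproducing kernel $K$ if $K(\cdot,\overline{u})$ belongs to it and $f(u)=[f,K(\cdot,\overline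 u)]$ for all its elements $f$ and all $u\in\Delta$. For $x\in(0,1)$ and real parameters, as many $\alpha_i$ as $\beta_i$, $$\mathrm{G}^{q,0}_{q,q}\left(x\left|{\alpha_1,\dots,\alpha_q\atop \beta_1,\dots,\beta_q}\right.\right)=\frac1{2\pi i}\int_{L}\frac{\Gamma(\beta_1+s)\cdots\Gamma(\beta_q+s)}{\Gamma(\alpha_1+s)\cdots\Gamma(\alpha_q+s)}x^{-s}\,ds,$$ where $L$ is a loop that begins and ends at $-\infty$ and encircles all points $-\beta_i-k$, $k\in\mathbb{N}_0$, once in the positive direction. Then there is a unique Pontryagin space $\mathcal B$ of functions on $\Delta$ with reproducing kernel $$K(z,\overline u)={}_pF_{p-1}\left(\left.{a_1,\dots,a_p\atop b_1,\dots,b_{p-1}}\right|\frac{z\overline u}{\theta}\right)=\sum_{k=0}^\infty\frac{(a_1)_k\cdots(a_p)_k}{(b_1)_k\cdots(b_{p-1})_k}\frac{(z\overline u)^k}{\theta^k\,k!}.$$ With $c_k=\dfrac{(b_1)_k\cdots(b_{p-1})_k\,k!\,\theta^k}{(a_1)_k\cdots(a_p)_k}$, it consists of the functions $f$ holomorphic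 in $\Delta$ with $\sum_k|c_k||f_k|^2<\infty$, and its inner product is $$[f,g]=\sum_{k=0}^\infty c_kf_k\overline{g_k}.$$ $\mathcal B$ is a positive Pontryagin space if and only if $\nu$ is even, and then its negative index is $$\sum_{i=0}^{m-1}\ \sum_{k=|[d_i]|+1}^{|[d_{i+1}]|}\Big(\Big(\sum_{j=1}^i[d_j]+k(m-i)\Big)\bmod 2\Big);$$ it is a negative Pontryagin space if and only if $\nu$ is odd, and then its positive index is $$\sum_{i=0}^{m-1}\ \sum_{k=|[d_i]|+1}^{|[d_{i+1}]|}\Big(1-\Big(\sum_{j=1}^i[d_j]+k(m-i)\Big)\bmod 2\Big)+1.$$ Let $l_1=-\min\{0,[\min b_i]\}$, where the inner minimum is over those $b_i$ for which $-b_i$ is a pole of $\prod_j\Gamma(b_j+s)/\prod_j\Gamma(a_j+s)$, i.e. for which the number of $j$ with $b_i-b_j\in\mathbb{N}_0$ exceeds the number of $j$ with $b_i-a_j\in\mathbb{N}_0$ ($l_1=0$ if there are none). Let $$l_2=\min\Big\{k\in\mathbb{N}_0:\ \sum_{i=1}^{p-1}b_i+1<\sum_{i=1}^pa_i+2k\Big\},\qquad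 l=\max(l_1,l_2).$$ Then for all $f,g\in\mathcal B$, all integrals below being absolutely convergent, $$[f,g]=\frac{\theta^{l-1}}{\pi}\Gamma\!\left[{(a_p)\atop (b_{p-1})}\right]\int_\Delta f^{(l)}(z)\overline{g^{(l)}(z)}\,\mathrm{G}^{p+1,0}_{p+1,p+1}\left(\frac{|z|^2}{\theta}\left|{a_1+l-1,\dots,a_p+l-1,\,l\atop b_1+l-1,\dots,b_{p-1}+l-1,\,0,0}\right.\right)d\sigma+\sum_{k=0}^{l-1}\frac{(b_1)_k\cdots(b_{p-1})_k\theta^k}{(a_1)_k\cdots(a_p)_k\,k!}f^{(k)}(0)\overline{g^{(k)}(0)}.$$ If $l_1=0$, then also, with $(Dz)f(z)=\frac{d}{dz}\big(zf(z)\big)$ and with $2$ repeated $2l$ times and $1$ repeated $2l+1$ times, $$[f,g]=\frac1\pi\Gamma\!\left[{(a_p)\atop (b_{p-1})}\right]\int_\Delta\big((Dz)^lf(z)\big)\overline{\big((Dz)^lg(z)\big)}\,\frac1{|z|^2}\,\mathrm{G}^{p+2l,0}_{p+2l,p+2l}\left(\frac{|z|^2}{\theta}\left|{a_1,\dots,a_p,2,\dots,2\atop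 b_1,\dots,b_{p-1},1,\dots,1}\right.\right)d\sigma.$$ In particular, if $l_1=l_2=0$, $$[f,g]=\frac1{\theta\pi}\Gamma\!\left[{(a_p)\atop (b_{p-1})}\right]\int_\Delta f(z)\overline{g(z)}\,\mathrm{G}^{p,0}_{p,p}\left(\frac{|z|^2}{\theta}\left|{a_1-1,\dots,a_p-1\atop 0,b_1-1,\dots,b_{p-1}-1}\right.\right)d\sigma.$$ -/

import Mathlib

open MeasureTheory Filter Topology ComplexConjugate

noncomputable section

namespace HypergeometricKernel

/-! ### Spaces of functions with an indefinite inner product -/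

/-- A vector space of complex-valued functions on `D ⊆ ℂ` together with a sesquilinear form,
linear in the first and conjugate-linear in the second argument. -/
structure FormSpace (D : Set ℂ) where
  carrier : Submodule ℂ (D → ℂ)
  form : carrier →ₗ[ℂ] carrier →ₗ⋆[ℂ] ℂ

variable {D : Set ℂ}

/-- `P` is a Hilbert space for `ε * form`: the form `ε * form` is positive definite on `P`, and
every sequence in `P` that is Cauchy for the norm `(ε * form f f) ^ (1/2)` converges in `P`.
It is used for `ε = 1` and `ε = -1`. -/
def FormSpace.IsHilbertOn (S : FormSpace D) (ε : ℝ) (P : Submodule ℂ S.carrier) : Prop :=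
  (∀ f ∈ P, f ≠ 0 → 0 < ε * (S.form f f).re) ∧
  ∀ u : ℕ → S.carrier, (∀ n, u n ∈ P) →
    (∀ δ : ℝ, 0 < δ → ∃ n₀ : ℕ, ∀ i ≥ n₀, ∀ j ≥ n₀,
      ε * (S.form (u i - u j) (u i - u j)).re < δ) →
    ∃ f ∈ P, Tendsto (fun n => ε * (S.form (u n - f) (u n - f)).re) atTop (𝓝 0)

/-- A fundamental decomposition: the form is Hermitian and the space is the direct sum of two
mutually orthogonal subspaces, `P` being a Hilbert space for the form and `N` a Hilbert space for
minus the form. A space that admits one is a Krein space. -/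
def FormSpace.IsFundamentalDecomposition (S : FormSpace D) (P N : Submodule ℂ S.carrier) : Prop :=
  (∀ f g, S.form f g = conj (S.form g f)) ∧
  IsCompl P N ∧
  (∀ f ∈ P, ∀ g ∈ N, S.form f g = 0) ∧
  S.IsHilbertOn 1 P ∧
  S.IsHilbertOn (-1) N

/-- A positive Pontryagin space with negative index `κ`. -/
def FormSpace.IsPositivePontryagin (S : FormSpace D) (κ : ℕ) : Prop :=
  ∃ P N : Submodule ℂ S.carrier, S.IsFundamentalDecomposition P N ∧
    FiniteDimensional ℂ N ∧ Module.finrank ℂ N = κ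

/-- A negative Pontryagin space with positive index `κ`. -/
def FormSpace.IsNegativePontryagin (S : FormSpace D) (κ : ℕ) : Prop :=
  ∃ P N : Submodule ℂ S.carrier, S.IsFundamentalDecomposition P N ∧
    FiniteDimensional ℂ P ∧ Module.finrank ℂ P = κ

/-- A Pontryagin space: a Krein space one of whose two definite parts is finite-dimensional. -/
def FormSpace.IsPontryagin (S : FormSpace D) : Prop :=
  ∃ κ : ℕ, S.IsPositivePontryagin κ ∨ S.IsNegativePontryagin κ

/-- `K` is a reproducing kernel of `S`: for every `u ∈ D` the function `z ↦ K z u` belongs to the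
space and `f u = [f, K(·, u)]`. -/
def FormSpace.HasReproducingKernel (S : FormSpace D) (K : ℂ → ℂ → ℂ) : Prop :=
  ∀ u : D, ∃ h : (fun z : D => K z u) ∈ S.carrier,
    ∀ f : S.carrier, (f : D → ℂ) u = S.form f ⟨fun z : D => K z u, h⟩

/-- The extension of a function on `D` by zero (used for an open `D`, and only inside `D`, to
speak of derivatives). -/
def ext (f : D → ℂ) : ℂ → ℂ := Function.extend Subtype.val f 0

/-- The Taylor coefficient `f_k` at the origin. -/
def taylorCoeff (f : ℂ → ℂ) (k : ℕ) : ℂ := iteratedDeriv k f 0 / (k.factorial : ℂ)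

/-- The operator `f ↦ (z f(z))'`. -/
def Dz (f : ℂ → ℂ) : ℂ → ℂ := fun z => deriv (fun w => w * f w) z

/-! ### Hypergeometric functions, Gamma quotients and the Meijer `G`-function -/

variable {p q : ℕ}

/-- The Pochhammer symbol `(x)_k = x (x + 1) ⋯ (x + k - 1)`. -/
def poch (x : ℝ) (k : ℕ) : ℝ := (ascPochhammer ℝ k).eval x

/-- The generalized hypergeometric series `pFq`. -/
def pFq (a : Fin p → ℝ) (b : Fin q → ℝ) (z : ℂ) : ℂ :=
  ∑' k : ℕ, (((∏ i, poch (a i) k) / (∏ i, poch (b i) k) : ℝ) : ℂ) * z ^ k / (k.factorial : ℂ)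

/-- The weights `(b_1)_k ⋯ (b_q)_k k! θ^k / ((a_1)_k ⋯ (a_p)_k)`. -/
def coeffWeight (a : Fin p → ℝ) (b : Fin q → ℝ) (θ : ℝ) (k : ℕ) : ℝ :=
  (∏ i, poch (b i) k) * k.factorial * θ ^ k / ∏ i, poch (a i) k

/-- `Γ[(a); (b)] = Γ(a_1) ⋯ Γ(a_p) / (Γ(b_1) ⋯ Γ(b_q))`. -/
def gammaQuot (a : Fin p → ℝ) (b : Fin q → ℝ) : ℝ :=
  (∏ i, Real.Gamma (a i)) / ∏ i, Real.Gamma (b i)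

/-- `Γ(b_1 + s) ⋯ Γ(b_q + s) x^{-s} / (Γ(a_1 + s) ⋯ Γ(a_p + s))`. -/
def meijerIntegrand (as bs : List ℝ) (x : ℝ) (s : ℂ) : ℂ :=
  (bs.map fun β => Complex.Gamma ((β : ℂ) + s)).prod /
    (as.map fun α => Complex.Gamma ((α : ℂ) + s)).prod * (x : ℂ) ^ (-s)

/-- A real number to the right of all the poles `-β - k` of the integrand. -/
def loopVertex (bs : List ℝ) : ℝ := 1 + (bs.map fun β => |β|).sum

/-- The Meijer function `G^{q,0}_{p,q}(x | as; bs)` with real parameters, `p` and `q` being the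
lengths of `as` and `bs`: the integral, divided by `2πi`, of `meijerIntegrand` over the loop
`-∞ - i → c - i → c + i → -∞ + i`, which encircles all the poles once in the positive direction.
The integral converges for `0 < x` if `p < q` and for `0 < x < 1` if `p = q`. -/
def meijerG (as bs : List ℝ) (x : ℝ) : ℂ :=
  1 / (2 * Real.pi * Complex.I) *
    ((∫ t in Set.Iic (loopVertex bs), meijerIntegrand as bs x ((t : ℂ) - Complex.I))
      + Complex.I * (∫ t in (-1 : ℝ)..1,
          meijerIntegrand as bs x ((loopVertex bs : ℂ) + (t : ℂ) * Complex.I))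
      - ∫ t in Set.Iic (loopVertex bs), meijerIntegrand as bs x ((t : ℂ) + Complex.I))

/-! ### The sign and index rules -/

/-- The negative elements of `(a_1, …, a_p, b_1, …, b_q)`, with multiplicity, in the order of
increasing absolute value. -/
def negParams (a : Fin p → ℝ) (b : Fin q → ℝ) : List ℝ :=
  (Multiset.filter (fun x : ℝ => x < 0)
    (Finset.univ.val.map a + Finset.univ.val.map b)).sort (fun x y => y ≤ x)

/-- The number `m` of negative parameters. -/
def numNegParams (a : Fin p → ℝ) (b : Fin q → ℝ) : ℕ := (negParams a b).length

/-- `[d_i]` for `1 ≤ i ≤ m`, where `d_i` is the negative parameter with `i`-th smallest absolute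
value, and `[d_0] = 0`. -/
def dFloor (a : Fin p → ℝ) (b : Fin q → ℝ) : ℕ → ℤ
  | 0 => 0
  | i + 1 => ⌊(negParams a b).getD i 0⌋

/-- `ν = [d_1] + ⋯ + [d_m]`. -/
def nu (a : Fin p → ℝ) (b : Fin q → ℝ) : ℤ :=
  ∑ k ∈ Finset.Icc 1 (numNegParams a b), dFloor a b k

/-- The residue `([d_1] + ⋯ + [d_i] + k (m - i)) mod 2`. -/
def parityTerm (a : Fin p → ℝ) (b : Fin q → ℝ) (i k : ℕ) : ℤ :=
  ((∑ j ∈ Finset.Icc 1 i, dFloor a b j) + (k : ℤ) * ((numNegParams a b : ℤ) - (i : ℤ))) % 2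

/-- The negative index when `ν` is even. -/
def negIndex (a : Fin p → ℝ) (b : Fin q → ℝ) : ℤ :=
  ∑ i ∈ Finset.range (numNegParams a b),
    ∑ k ∈ Finset.Icc ((dFloor a b i).natAbs + 1) (dFloor a b (i + 1)).natAbs, parityTerm a b i k

/-- The positive index when `ν` is odd. -/
def posIndex (a : Fin p → ℝ) (b : Fin q → ℝ) : ℤ :=
  (∑ i ∈ Finset.range (numNegParams a b),
    ∑ k ∈ Finset.Icc ((dFloor a b i).natAbs + 1) (dFloor a b (i + 1)).natAbs,
      (1 - parityTerm a b i k)) + 1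

/-! ### The orders of differentiation -/

open Classical in
/-- The indices `i` such that the poles of the numerator at `s = -b_i` are not cancelled in
`Γ(b_1 + s) ⋯ Γ(b_q + s) / (Γ(a_1 + s) ⋯ Γ(a_p + s))`: the pole orders at `s = -b_i` of the
numerator and of the denominator are the numbers of `j` with `b_i - b_j ∈ ℕ₀` and
with `b_i - a_j ∈ ℕ₀`. -/
def uncancelled (a : Fin p → ℝ) (b : Fin q → ℝ) : Finset (Fin q) :=
  Finset.univ.filter fun i =>
    (Finset.univ.filter fun j : Fin p => ∃ n : ℕ, b i = a j + n).card <
      (Finset.univ.filter fun j : Fin q => ∃ n : ℕ, b i = b j + n).card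

/-- `l₁ = -min {0, [min b_i]}`, the inner minimum over the uncancelled `b_i`, written as the
maximum of `0` and of the numbers `-[b_i]`. -/
def l₁ (a : Fin p → ℝ) (b : Fin q → ℝ) : ℕ :=
  (uncancelled a b).sup fun i => (-⌊b i⌋).toNat

/-- `l₂ = min {k ∈ ℕ₀ : ∑ b_i + 1 < ∑ a_i + 2 k}`. The set is not empty. -/
def l₂ (a : Fin p → ℝ) (b : Fin q → ℝ) : ℕ :=
  sInf {k : ℕ | (∑ i, b i) + 1 < (∑ i, a i) + 2 * (k : ℝ)}

/-- `l = max (l₁, l₂)`. -/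
def lMax (a : Fin p → ℝ) (b : Fin q → ℝ) : ℕ := max (l₁ a b) (l₂ a b)

end HypergeometricKernel

end

noncomputable section

namespace HypergeometricKernel

/-! ### Growth of Gamma quotients -/

-- The kernel is `∑ (z ū)^k / c_k`, so the candidate for the space is `weightedSpace`: the power
-- series with `∑ |c_k| |f_k|² < ∞` and the form `∑ c_k f_k conj g_k`. Euler's limit formula for `Γ`
-- gives `|c_k| ≍ θ^k (k + 1)^(∑ b + 1 - ∑ a)` (`isPowerLike_coeffWeight`). This makes the series
-- converge for `|z| < √θ` and puts the kernel functions into the space. The coefficients with `c_k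
-- > 0` and those with `c_k < 0` split the space into two weighted `ℓ²` spaces, one positive and one
-- negative, so an index is the number of `k` for which `c_k` has a given sign. Since `(x)_k`
-- changes sign once for every negative factor `x + j`, the sign of `c_k` is `(-1)^(∑ min(k,
-- |[d_j]|))`. From `k = |[d_m]|` on it is constant, with the parity of `ν`, and counting parities
-- between consecutive `|[d_i]|` gives the index rules.
--
-- Uniqueness compares two spaces on the span of the kernel functions, where the form is dictated by
-- `K` and which is dense for the norm `([Pf, Pf] - [Nf, Nf])^(1/2)`. If the negative part is
-- finite-dimensional, this norm is controlled by `[f, f]` and finitely many `[f, m_i]` with `m_i`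
-- in the span (`exists_norm_sq_le`). All of these are computable in the other space, so Cauchy
-- sequences carry over and one space is contained in the other with its form
-- (`exists_form_eq_of_kernel`). The negative part of the smaller space is then finite-dimensional
-- too, and the roles may be exchanged. Negative Pontryagin spaces are reached by changing the sign
-- of the form.
--
-- For the area formulas, polar coordinates and Parseval's identity on circles turn the integral of
-- `F conj H W(|z|²/θ)` into `π θ ∑ u_k conj v_k θ^k ∫₀¹ x^k W(x) dx` (`area_integral`). The moments
-- of a Meijer function are the Gamma quotient itself (`meijerG_moments`): with `x = e^(-y)` the
-- function is an inverse Laplace integral over a loop, Fubini produces the loop integral of `R(s) /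
-- (w - s)`, and a Cauchy formula evaluates it as `2πi R(w)`. At `w + k` the Gamma quotients with
-- the listed parameters are `c_k` up to elementary factors, which cancel the factors created by the
-- differentiations.
--
-- Absolute convergence comes from `R(s) = O(|s|^(-γ))`, where `γ` is the sum of the upper minus the
-- sum of the lower parameters, `γ = ∑ a - ∑ b + 2l - 1`. The definition of `l₂` makes it positive.
-- Rescaling the loop with `1/y` gives `G = O(y^(γ-1))` near `x = 1`, hence absolute moments
-- `O((k+1)^(-γ))`, which is exactly the growth that `∑ |c_k| |f_k|² < ∞` can absorb. The role of
-- `l₁` is to move the uncancelled poles to the left of the exponent of the first moment.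

lemma abs_log_norm_one_add_sub_re_le {u : ℂ} (hu : ‖u‖ ≤ 1 / 2) :
    |Real.log ‖1 + u‖ - u.re| ≤ ‖u‖ ^ 2 := by
  have h1 : ‖u‖ < 1 := by linarith
  have h := Complex.norm_log_one_add_sub_self_le h1
  have h2 : |(Complex.log (1 + u) - u).re| ≤ ‖Complex.log (1 + u) - u‖ := Complex.abs_re_le_norm _
  rw [Complex.sub_re, Complex.log_re] at h2
  refine h2.trans (h.trans ?_)
  have h3 : (1 - ‖u‖)⁻¹ ≤ 2 := by
    rw [inv_le_comm₀ (by linarith) (by norm_num)]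
    linarith
  nlinarith [sq_nonneg ‖u‖]

/-- The terms of first order, `δ Re(1/z)`, cancel. For `‖z‖ ≥ R` both arguments are at most `1/2`
and the quadratic remainders are left. For `m ≤ ‖z‖ < R` both logarithms are bounded and `‖z‖⁻²` is
bounded below. -/
lemma exists_abs_log_norm_le (δ : ℝ) {m : ℝ} (hm : 0 < m) :
    ∃ C : ℝ, 0 ≤ C ∧ ∀ z : ℂ, m ≤ ‖z‖ → m ≤ ‖z + δ‖ → m ≤ ‖z + 1‖ →
      |Real.log ‖1 + δ / z‖ - δ * Real.log ‖1 + 1 / z‖| ≤ C / ‖z‖ ^ 2 := by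
  set R : ℝ := 2 * (|δ| + 1) with hR
  have hRpos : 0 < R := by positivity
  set L : ℝ := |Real.log (m / R)| + |Real.log ((R + |δ| + 1) / m)| with hL
  have hL0 : 0 ≤ L := by positivity
  refine ⟨(δ ^ 2 + |δ|) + (L + |δ| * L) * R ^ 2, by positivity, fun z hz hzd hz1 => ?_⟩
  have hz0 : 0 < ‖z‖ := hm.trans_le hz
  have hzne : z ≠ 0 := norm_pos_iff.mp hz0
  rcases le_or_gt R ‖z‖ with hbig | hsmall
  · have hu1 : ‖(δ : ℂ) / z‖ ≤ 1 / 2 := by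
      rw [norm_div, Complex.norm_real, Real.norm_eq_abs, div_le_iff₀ hz0]
      nlinarith [abs_nonneg δ]
    have hu2 : ‖(1 : ℂ) / z‖ ≤ 1 / 2 := by
      rw [norm_div, norm_one, div_le_iff₀ hz0]
      nlinarith [abs_nonneg δ]
    have h1 := abs_log_norm_one_add_sub_re_le hu1
    have h2 := abs_log_norm_one_add_sub_re_le hu2
    have e1 : ((δ : ℂ) / z).re = δ * ((1 : ℂ) / z).re := by
      rw [← Complex.re_ofReal_mul]; congr 1; ring
    have e2 : ‖(δ : ℂ) / z‖ ^ 2 = δ ^ 2 / ‖z‖ ^ 2 := by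
      rw [norm_div, Complex.norm_real, Real.norm_eq_abs, div_pow, sq_abs]
    have e3 : ‖(1 : ℂ) / z‖ ^ 2 = 1 / ‖z‖ ^ 2 := by
      rw [norm_div, norm_one, div_pow, one_pow]
    rw [e1, e2] at h1
    rw [e3] at h2
    have h3 : |δ * Real.log ‖1 + 1 / z‖ - δ * ((1 : ℂ) / z).re| ≤ |δ| * (1 / ‖z‖ ^ 2) := by
      rw [← mul_sub, abs_mul]
      exact mul_le_mul_of_nonneg_left h2 (abs_nonneg _)
    have h4 : |Real.log ‖1 + δ / z‖ - δ * Real.log ‖1 + 1 / z‖|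
        ≤ δ ^ 2 / ‖z‖ ^ 2 + |δ| * (1 / ‖z‖ ^ 2) := by
      rw [abs_le] at *
      constructor <;> linarith [h1.1, h1.2, h3.1, h3.2]
    refine h4.trans ?_
    rw [mul_one_div, ← add_div]
    have : 0 ≤ (L + |δ| * L) * R ^ 2 := by positivity
    exact div_le_div_of_nonneg_right (by linarith) (by positivity)
  · have key : ∀ d : ℝ, |d| ≤ |δ| + 1 → m ≤ ‖z + d‖ → |Real.log ‖1 + (d : ℂ) / z‖| ≤ L := by
      intro d hd hzd'
      have e : ‖1 + (d : ℂ) / z‖ = ‖z + d‖ / ‖z‖ := by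
        rw [← norm_div]; congr 1; field_simp
      rw [e]
      have lo : m / R ≤ ‖z + d‖ / ‖z‖ := by gcongr
      have hi : ‖z + d‖ / ‖z‖ ≤ (R + |δ| + 1) / m := by
        have : ‖z + d‖ ≤ R + |δ| + 1 := by
          refine (norm_add_le _ _).trans ?_
          rw [Complex.norm_real, Real.norm_eq_abs]
          linarith
        gcongr
      have p1 : 0 < m / R := by positivity
      have l1 := Real.log_le_log p1 lo
      have l2 := Real.log_le_log (p1.trans_le lo) hi
      rw [abs_le]
      constructor
      · linarith [neg_abs_le (Real.log (m / R)), abs_nonneg (Real.log ((R + |δ| + 1) / m))]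
      · linarith [le_abs_self (Real.log ((R + |δ| + 1) / m)), abs_nonneg (Real.log (m / R))]
    have k1 := key δ (by linarith) hzd
    have k2 := key 1 (by simp) (by simpa using hz1)
    rw [Complex.ofReal_one] at k2
    have h4 : |Real.log ‖1 + δ / z‖ - δ * Real.log ‖1 + 1 / z‖| ≤ L + |δ| * L := by
      refine (abs_sub _ _).trans ?_
      rw [abs_mul]
      gcongr
    refine h4.trans ?_
    rw [le_div_iff₀ (by positivity)]
    have : ‖z‖ ^ 2 ≤ R ^ 2 := by gcongr
    have h5 : (L + |δ| * L) * ‖z‖ ^ 2 ≤ (L + |δ| * L) * R ^ 2 := by gcongr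
    have : 0 ≤ δ ^ 2 + |δ| := by positivity
    linarith

lemma summable_one_div_one_add_int_sq : Summable fun k : ℤ => 1 / (1 + (k : ℝ) ^ 2) := by
  have h : Summable fun k : ℤ => 1 / (k : ℝ) ^ 2 :=
    Real.summable_one_div_int_pow.mpr (by norm_num)
  refine Summable.of_norm_bounded_eventually h ?_
  have : ({0}ᶜ : Set ℤ) ∈ (cofinite : Filter ℤ) := (Set.finite_singleton 0).compl_mem_cofinite
  filter_upwards [this] with k hk
  have hk' : (k : ℝ) ≠ 0 := by exact_mod_cast hk
  have : 0 < (k : ℝ) ^ 2 := by positivity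
  rw [Real.norm_of_nonneg (by positivity)]
  gcongr
  linarith

/-- The points that stay away from the poles of `Γ(s)` and `Γ(s + δ)` on the whole real line. -/
def AwayFromPoles (δ m : ℝ) (s : ℂ) : Prop :=
  1 ≤ |s.im| ∨ (m ≤ s.re ∧ m ≤ s.re + δ)

lemma AwayFromPoles.norm_le {δ m : ℝ} (hm1 : m ≤ 1) {s : ℂ} (hs : AwayFromPoles δ m s) (j : ℕ) :
    m ≤ ‖s + j‖ ∧ m ≤ ‖s + j + δ‖ ∧ m ≤ ‖s + j + 1‖ := by
  have hj : (0 : ℝ) ≤ j := j.cast_nonneg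
  rcases hs with h | ⟨h1, h2⟩
  · refine ⟨?_, ?_, ?_⟩
    · refine hm1.trans (h.trans ?_)
      simpa using Complex.abs_im_le_norm (s + j)
    · refine hm1.trans (h.trans ?_)
      simpa using Complex.abs_im_le_norm (s + j + δ)
    · refine hm1.trans (h.trans ?_)
      simpa using Complex.abs_im_le_norm (s + j + 1)
  · refine ⟨?_, ?_, ?_⟩
    · refine le_trans ?_ (Complex.re_le_norm _)
      simp; linarith
    · refine le_trans ?_ (Complex.re_le_norm _)
      simp; linarith
    · refine le_trans ?_ (Complex.re_le_norm _)
      simp; linarith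

/-- Rounding `Re s` down attaches distinct integers to the points `s + j`. Sums of `1/‖s + j‖²` are
thereby dominated by one sum over `ℤ` that does not depend on `s`. -/
lemma AwayFromPoles.le_norm_sq {δ m : ℝ} (hm : 0 < m) (hm1 : m ≤ 1) {s : ℂ}
    (hs : AwayFromPoles δ m s) (j : ℕ) :
    m ^ 2 / 6 * (1 + ((⌊s.re⌋ + j : ℤ) : ℝ) ^ 2) ≤ ‖s + j‖ ^ 2 := by
  have hj : (0 : ℝ) ≤ j := j.cast_nonneg
  set x : ℝ := s.re + j with hx
  have e : ‖s + j‖ ^ 2 = x ^ 2 + s.im ^ 2 := by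
    rw [← Complex.normSq_eq_norm_sq, Complex.normSq_apply]; simp [hx]; ring
  have h1 : m ^ 2 / 2 * (1 + x ^ 2) ≤ ‖s + j‖ ^ 2 := by
    rw [e]
    have hm2 : m ^ 2 ≤ 1 := by nlinarith
    rcases hs with h | ⟨h1, h2⟩
    · have : 1 ≤ s.im ^ 2 := by rw [← sq_abs]; nlinarith
      nlinarith [sq_nonneg x]
    · have : m ≤ x := by linarith
      have : m ^ 2 ≤ x ^ 2 := by gcongr
      nlinarith [sq_nonneg x, sq_nonneg s.im]
  refine le_trans ?_ h1
  have f0 := Int.fract_nonneg s.re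
  have f1 := (Int.fract_lt_one s.re).le
  have hk : ((⌊s.re⌋ + j : ℤ) : ℝ) = x - Int.fract s.re := by
    push_cast
    rw [hx, Int.fract]; ring
  rw [hk]
  have : (x - Int.fract s.re) ^ 2 ≤ 2 * x ^ 2 + 2 := by
    nlinarith [sq_nonneg (x + Int.fract s.re)]
  nlinarith [sq_nonneg m, sq_nonneg x, mul_nonneg (sq_nonneg m) (sq_nonneg x),
    mul_le_mul_of_nonneg_left this (sq_nonneg m)]

lemma exists_sum_one_div_norm_sq_le {δ m : ℝ} (hm : 0 < m) (hm1 : m ≤ 1) :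
    ∃ B : ℝ, 0 ≤ B ∧ ∀ s : ℂ, AwayFromPoles δ m s → ∀ n : ℕ,
      ∑ j ∈ Finset.range n, 1 / ‖s + j‖ ^ 2 ≤ B := by
  have hsum := summable_one_div_one_add_int_sq
  refine ⟨6 / m ^ 2 * ∑' k : ℤ, 1 / (1 + (k : ℝ) ^ 2),
    mul_nonneg (by positivity) (tsum_nonneg fun k => by positivity), fun s hs n => ?_⟩
  have hinj : Function.Injective fun j : ℕ => ⌊s.re⌋ + (j : ℤ) := by
    intro i j hij; simpa using hij
  calc ∑ j ∈ Finset.range n, 1 / ‖s + j‖ ^ 2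
      ≤ ∑ j ∈ Finset.range n, 6 / m ^ 2 * (1 / (1 + ((⌊s.re⌋ + j : ℤ) : ℝ) ^ 2)) := by
        refine Finset.sum_le_sum fun j _ => ?_
        have h := hs.le_norm_sq hm hm1 j
        have hp : 0 < m ^ 2 / 6 * (1 + ((⌊s.re⌋ + j : ℤ) : ℝ) ^ 2) := by positivity
        calc 1 / ‖s + j‖ ^ 2 ≤ 1 / (m ^ 2 / 6 * (1 + ((⌊s.re⌋ + j : ℤ) : ℝ) ^ 2)) := by
              gcongr
          _ = _ := by field_simp
    _ = 6 / m ^ 2 * ∑ k ∈ (Finset.range n).map ⟨_, hinj⟩, 1 / (1 + (k : ℝ) ^ 2) := by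
        rw [Finset.sum_map, Finset.mul_sum]; rfl
    _ ≤ _ := by
        gcongr
        exact hsum.sum_le_tsum _ fun k _ => by positivity

lemma prod_one_add_one_div_norm {s : ℂ} (hs : ∀ j : ℕ, s + j ≠ 0) (n : ℕ) :
    ∏ j ∈ Finset.range n, ‖1 + 1 / (s + j)‖ = ‖s + n‖ / ‖s‖ := by
  induction n with
  | zero =>
    have := hs 0
    simp only [Nat.cast_zero, add_zero] at this
    simp [this]
  | succ n ih =>
    rw [Finset.prod_range_succ, ih]
    have h0 : ‖s + n‖ ≠ 0 := norm_ne_zero_iff.mpr (hs n)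
    have e : 1 + 1 / (s + n) = (s + (n + 1 : ℕ)) / (s + n) := by
      have := hs n
      field_simp; push_cast; ring
    rw [e, norm_div]
    field_simp

/-- In Euler's sequence the ratio of the terms at `s + δ` and `s` is `n^δ / ∏ ‖1 + δ/(s+j)‖`.
Replacing each factor by `‖1 + 1/(s+j)‖^δ` costs a summable amount in the logarithm, at most `C * B`
in total, and the new product telescopes to `(‖s+n+1‖ / ‖s‖)^δ`. As `n → ∞` the factor `‖s‖^δ`
remains. -/
lemma exists_norm_Gamma_add_le (δ : ℝ) {m : ℝ} (hm : 0 < m) (hm1 : m ≤ 1) :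
    ∃ C : ℝ, 0 ≤ C ∧ ∀ s : ℂ, AwayFromPoles δ m s →
      ‖Complex.Gamma (s + δ)‖ ≤ C * ‖s‖ ^ δ * ‖Complex.Gamma s‖ := by
  obtain ⟨C, hC0, hC⟩ := exists_abs_log_norm_le δ hm
  obtain ⟨B, hB0, hB⟩ := exists_sum_one_div_norm_sq_le (δ := δ) hm hm1
  refine ⟨Real.exp (C * B), (Real.exp_pos _).le, fun s hs => ?_⟩
  have hne : ∀ j : ℕ, s + j ≠ 0 := fun j =>
    norm_pos_iff.mp (hm.trans_le (hs.norm_le hm1 j).1)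
  have hned : ∀ j : ℕ, s + j + δ ≠ 0 := fun j =>
    norm_pos_iff.mp (hm.trans_le (hs.norm_le hm1 j).2.1)
  have hs0 : 0 < ‖s‖ := by simpa using norm_pos_iff.mpr (hne 0)
  have step : ∀ n : ℕ, 1 ≤ n → ‖Complex.GammaSeq (s + δ) n‖ ≤
      Real.exp (C * B) * ‖s‖ ^ δ * ((n : ℝ) / ‖s + (n + 1 : ℕ)‖) ^ δ *
        ‖Complex.GammaSeq s n‖ := by
    intro n hn
    have hn0 : (0 : ℝ) < n := by exact_mod_cast hn
    have hN : 0 < ‖s + (n + 1 : ℕ)‖ := norm_pos_iff.mpr (hne _)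
    set P := ∏ j ∈ Finset.range (n + 1), ‖1 + (δ : ℂ) / (s + j)‖ with hP
    have hfac : ∀ j : ℕ, ‖1 + (δ : ℂ) / (s + j)‖ = ‖s + j + δ‖ / ‖s + j‖ := by
      intro j
      rw [← norm_div]; congr 1
      have := hne j
      field_simp
    have hfacpos : ∀ j : ℕ, 0 < ‖1 + (δ : ℂ) / (s + j)‖ := fun j => by
      rw [hfac]
      exact div_pos (norm_pos_iff.mpr (hned j)) (norm_pos_iff.mpr (hne j))
    have hfac1pos : ∀ j : ℕ, 0 < ‖1 + 1 / (s + j)‖ := fun j => by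
      have e : 1 + 1 / (s + j) = (s + (j + 1 : ℕ)) / (s + j) := by
        have := hne j
        field_simp; push_cast; ring
      rw [e, norm_div]
      exact div_pos (norm_pos_iff.mpr (hne _)) (norm_pos_iff.mpr (hne j))
    have hPpos : 0 < P := Finset.prod_pos fun j _ => hfacpos j
    have hquot : ‖Complex.GammaSeq (s + δ) n‖ * P = (n : ℝ) ^ δ * ‖Complex.GammaSeq s n‖ := by
      have e1 : P = (∏ j ∈ Finset.range (n + 1), ‖s + δ + j‖) /
          ∏ j ∈ Finset.range (n + 1), ‖s + j‖ := by
        rw [hP, ← Finset.prod_div_distrib]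
        refine Finset.prod_congr rfl fun j _ => ?_
        rw [hfac]; congr 2; ring
      have d1 : ∏ j ∈ Finset.range (n + 1), ‖s + δ + j‖ ≠ 0 :=
        Finset.prod_ne_zero_iff.mpr fun j _ => norm_ne_zero_iff.mpr (by
          have := hned j
          rwa [add_right_comm] at this)
      have d2 : ∏ j ∈ Finset.range (n + 1), ‖s + j‖ ≠ 0 :=
        Finset.prod_ne_zero_iff.mpr fun j _ => norm_ne_zero_iff.mpr (hne j)
      have e2 : ‖(n : ℂ) ^ (s + δ)‖ = (n : ℝ) ^ δ * ‖(n : ℂ) ^ s‖ := by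
        have hn' : ((n : ℝ) : ℂ) = (n : ℂ) := by simp
        rw [← hn', Complex.norm_cpow_eq_rpow_re_of_pos hn0,
          Complex.norm_cpow_eq_rpow_re_of_pos hn0, ← Real.rpow_add hn0]
        congr 1; simp [add_comm]
      simp only [Complex.GammaSeq, norm_div, norm_mul, norm_prod]
      rw [e1, e2]
      field_simp
    have hlog : Real.log P ≥ δ * Real.log (‖s + (n + 1 : ℕ)‖ / ‖s‖) - C * B := by
      rw [← prod_one_add_one_div_norm hne, hP, Real.log_prod fun j _ => (hfacpos j).ne',
        Real.log_prod fun j _ => (hfac1pos j).ne', Finset.mul_sum]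
      have h1 : ∑ j ∈ Finset.range (n + 1), (δ * Real.log ‖1 + 1 / (s + j)‖
          - Real.log ‖1 + (δ : ℂ) / (s + j)‖)
          ≤ ∑ j ∈ Finset.range (n + 1), C * (1 / ‖s + j‖ ^ 2) := by
        refine Finset.sum_le_sum fun j _ => ?_
        have h := hC (s + j) (hs.norm_le hm1 j).1 (hs.norm_le hm1 j).2.1 (hs.norm_le hm1 j).2.2
        rw [mul_one_div]
        linarith [(abs_le.mp h).1]
      rw [← Finset.mul_sum, Finset.sum_sub_distrib] at h1
      have h2 := mul_le_mul_of_nonneg_left (hB s hs (n + 1)) hC0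
      linarith
    have hP2 : (‖s + (n + 1 : ℕ)‖ / ‖s‖) ^ δ ≤ Real.exp (C * B) * P := by
      rw [← Real.exp_log hPpos, ← Real.exp_add, Real.rpow_def_of_pos (div_pos hN hs0)]
      apply Real.exp_le_exp.mpr
      linarith
    have hq : (‖s + (n + 1 : ℕ)‖ / ‖s‖) ^ δ * ‖Complex.GammaSeq (s + δ) n‖ ≤
        Real.exp (C * B) * ((n : ℝ) ^ δ * ‖Complex.GammaSeq s n‖) := by
      calc _ ≤ Real.exp (C * B) * P * ‖Complex.GammaSeq (s + δ) n‖ := by gcongr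
        _ = _ := by rw [← hquot]; ring
    rw [Real.div_rpow hN.le hs0.le] at hq
    rw [Real.div_rpow hn0.le hN.le]
    have i1 : 0 < ‖s + (n + 1 : ℕ)‖ ^ δ := Real.rpow_pos_of_pos hN _
    have i2 : 0 < ‖s‖ ^ δ := Real.rpow_pos_of_pos hs0 _
    rw [div_mul_eq_mul_div, div_le_iff₀ i2] at hq
    rw [mul_div_assoc', div_mul_eq_mul_div, le_div_iff₀ i1]
    linarith
  have hlim : Tendsto (fun n : ℕ => (n : ℝ) / ‖s + (n + 1 : ℕ)‖) atTop (𝓝 1) := by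
    have h1 : Tendsto (fun n : ℕ => s * ((n : ℂ))⁻¹ + (1 + ((n : ℂ))⁻¹)) atTop
        (𝓝 (s * 0 + (1 + 0))) := by
      have h0 : Tendsto (fun n : ℕ => ((n : ℂ))⁻¹) atTop (𝓝 0) :=
        tendsto_inv_atTop_nhds_zero_nat
      exact (h0.const_mul s).add (h0.const_add 1)
    have h2 := (h1.norm).inv₀ (by simp)
    simp only [mul_zero, add_zero, zero_add, norm_one, inv_one] at h2
    refine h2.congr' ?_
    filter_upwards [eventually_ge_atTop 1] with n hn
    have hn0 : (n : ℂ) ≠ 0 := by exact_mod_cast (by omega : n ≠ 0)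
    have : s * ((n : ℂ))⁻¹ + (1 + ((n : ℂ))⁻¹) = (s + (n + 1 : ℕ)) / n := by
      field_simp; push_cast; ring
    rw [this, norm_div, inv_div, Complex.norm_natCast]
  have hlim2 : Tendsto (fun n : ℕ => ((n : ℝ) / ‖s + (n + 1 : ℕ)‖) ^ δ) atTop (𝓝 1) := by
    have := hlim.rpow_const (p := δ) (Or.inl one_ne_zero)
    simpa using this
  have L1 := (Complex.GammaSeq_tendsto_Gamma (s + δ)).norm
  have L2 := (hlim2.const_mul (Real.exp (C * B) * ‖s‖ ^ δ)).mul
    (Complex.GammaSeq_tendsto_Gamma s).norm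
  rw [mul_one] at L2
  refine le_of_tendsto_of_tendsto L1 L2 ?_
  filter_upwards [eventually_ge_atTop 1] with n hn using step n hn

lemma rpow_le_of_comparable {x y A : ℝ} (hx : 0 < x) (hy : 0 < y) (h1 : x ≤ A * y)
    (h2 : y ≤ A * x) (δ : ℝ) : x ^ δ ≤ A ^ |δ| * y ^ δ := by
  have hA : 0 < A := by
    by_contra h
    push Not at h
    nlinarith
  rcases le_total 0 δ with hd | hd
  · rw [abs_of_nonneg hd, ← Real.mul_rpow hA.le hy.le]
    exact Real.rpow_le_rpow hx.le h1 hd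
  · have h3 : y / A ≤ x := by rwa [div_le_iff₀' hA]
    have := Real.rpow_le_rpow_of_nonpos (by positivity) h3 hd
    rw [abs_of_nonpos hd]
    refine this.trans_eq ?_
    rw [Real.div_rpow hy.le hA.le, Real.rpow_neg hA.le]
    field_simp

/-- `Γ(β + s) / Γ(α + s)` is `O((1 + |s|)^(β - α))` away from the poles, uniformly on horizontal
lines and to the right. -/
lemma exists_norm_Gamma_mul_inv_le (α β : ℝ) {c : ℝ} (h1 : 0 < α + c) (h2 : 0 < β + c) :
    ∃ C : ℝ, 0 ≤ C ∧ ∀ s : ℂ, (1 ≤ |s.im| ∨ c ≤ s.re) →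
      ‖Complex.Gamma (β + s) * (Complex.Gamma (α + s))⁻¹‖ ≤ C * (1 + ‖s‖) ^ (β - α) := by
  set m : ℝ := min 1 (min (α + c) (β + c)) with hm
  have hm0 : 0 < m := by simp [hm, h1, h2]
  have hm1 : m ≤ 1 := min_le_left _ _
  have hma : m ≤ α + c := (min_le_right _ _).trans (min_le_left _ _)
  have hmb : m ≤ β + c := (min_le_right _ _).trans (min_le_right _ _)
  obtain ⟨C, hC0, hC⟩ := exists_norm_Gamma_add_le (β - α) hm0 hm1
  -- This constant makes `‖α + s‖` and `1 + ‖s‖` comparable, given `‖α + s‖ ≥ m`.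
  set A : ℝ := 1 + |α| + (1 + |α|) / m with hA
  refine ⟨C * A ^ |β - α|, by positivity, fun s hs => ?_⟩
  have haway : AwayFromPoles (β - α) m (α + s) := by
    rcases hs with h | h
    · left; simpa using h
    · right
      simp only [Complex.add_re, Complex.ofReal_re]
      constructor <;> linarith
  have h := hC _ haway
  have e : (α : ℂ) + s + ((β - α : ℝ) : ℂ) = β + s := by push_cast; ring
  rw [e] at h
  have hmn := (haway.norm_le hm1 0).1
  simp only [Nat.cast_zero, add_zero] at hmn
  have hpos : 0 < ‖(α : ℂ) + s‖ := hm0.trans_le hmn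
  have hab : ‖(α : ℂ)‖ = |α| := by rw [Complex.norm_real, Real.norm_eq_abs]
  have hdiv : 0 ≤ (1 + |α|) / m := by positivity
  have c1 : ‖(α : ℂ) + s‖ ≤ A * (1 + ‖s‖) := by
    refine (norm_add_le _ _).trans ?_
    rw [hab, hA]
    nlinarith [abs_nonneg α, norm_nonneg s, mul_nonneg (abs_nonneg α) (norm_nonneg s),
      mul_nonneg hdiv (norm_nonneg s)]
  have c2 : 1 + ‖s‖ ≤ A * ‖(α : ℂ) + s‖ := by
    have t : ‖s‖ ≤ ‖(α : ℂ) + s‖ + |α| := by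
      have := norm_sub_le ((α : ℂ) + s) α
      rwa [add_sub_cancel_left, hab] at this
    have t2 : 1 + |α| ≤ (1 + |α|) / m * ‖(α : ℂ) + s‖ := by
      rw [div_mul_eq_mul_div, le_div_iff₀ hm0]
      gcongr
    rw [hA]
    nlinarith [abs_nonneg α, mul_nonneg (abs_nonneg α) hpos.le]
  have c3 := rpow_le_of_comparable hpos (by positivity) c1 c2 (β - α)
  rw [norm_mul, norm_inv]
  rcases eq_or_ne (Complex.Gamma (α + s)) 0 with h0 | h0
  · rw [h0]; simp; positivity
  · have hG : 0 < ‖Complex.Gamma (α + s)‖ := norm_pos_iff.mpr h0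
    rw [← div_eq_mul_inv, div_le_iff₀ hG]
    refine h.trans (mul_le_mul_of_nonneg_right ?_ hG.le)
    rw [mul_assoc]
    exact mul_le_mul_of_nonneg_left c3 hC0

section

/-! ### Loop integrals -/

/-- The integral over the loop `-∞ - ih → c - ih → c + ih → -∞ + ih`. -/
def loopIntegral (F : ℂ → ℂ) (c h : ℝ) : ℂ :=
  (∫ t in Set.Iic c, F ((t : ℂ) + ((-h : ℝ) : ℂ) * Complex.I))
    + Complex.I * (∫ t in (-h)..h, F ((c : ℂ) + (t : ℂ) * Complex.I))
    - ∫ t in Set.Iic c, F ((t : ℂ) + (h : ℂ) * Complex.I)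

/-- The complex plane without the half-line `(-∞, r]`. -/
def slitRegion (r : ℝ) : Set ℂ := {s | s.im ≠ 0 ∨ r < s.re}

lemma isOpen_slitRegion (r : ℝ) : IsOpen (slitRegion r) :=
  (isOpen_ne_fun Complex.continuous_im continuous_const).union
    (isOpen_lt continuous_const Complex.continuous_re)

/-- A function that is holomorphic off `(-∞, r]` and decays to the left, uniformly in the
height. -/
structure LoopAdmissible (F : ℂ → ℂ) (r : ℝ) (φ : ℝ → ℝ) : Prop where
  differentiableOn : DifferentiableOn ℂ F (slitRegion r)
  integrableOn : ∀ c : ℝ, IntegrableOn φ (Set.Iic c)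
  tendsto : Tendsto φ atBot (𝓝 0)
  norm_le : ∀ s : ℂ, 1 ≤ |s.im| → ‖F s‖ ≤ φ s.re

lemma continuous_line {F : ℂ → ℂ} {r : ℝ} (hF : DifferentiableOn ℂ F (slitRegion r)) {h : ℝ}
    (hh : h ≠ 0) : Continuous fun t : ℝ => F ((t : ℂ) + (h : ℂ) * Complex.I) := by
  refine hF.continuousOn.comp_continuous (by fun_prop) fun t => Or.inl ?_
  simpa using hh

lemma continuous_vertical {F : ℂ → ℂ} {r : ℝ} (hF : DifferentiableOn ℂ F (slitRegion r)) {c : ℝ}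
    (hc : r < c) : Continuous fun t : ℝ => F ((c : ℂ) + (t : ℂ) * Complex.I) := by
  refine hF.continuousOn.comp_continuous (by fun_prop) fun t => Or.inr ?_
  simpa using hc

namespace LoopAdmissible

variable {F : ℂ → ℂ} {r : ℝ} {φ : ℝ → ℝ}

lemma integrableOn_line (hF : LoopAdmissible F r φ) {h : ℝ} (hh : 1 ≤ |h|) (c : ℝ) :
    IntegrableOn (fun t : ℝ => F ((t : ℂ) + (h : ℂ) * Complex.I)) (Set.Iic c) := by
  have h0 : h ≠ 0 := by rintro rfl; norm_num at hh
  refine (hF.integrableOn c).mono'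
    (continuous_line hF.differentiableOn h0).aestronglyMeasurable (ae_of_all _ fun t => ?_)
  simpa using hF.norm_le ((t : ℂ) + (h : ℂ) * Complex.I) (by simpa using hh)

/-- The vertex of the loop may be moved along the real axis. -/
lemma loopIntegral_vertex (hF : LoopAdmissible F r φ) {c c' h : ℝ} (hc : r < c) (hc' : r < c')
    (hh : 1 ≤ h) : loopIntegral F c h = loopIntegral F c' h := by
  have habs : 1 ≤ |h| := hh.trans (le_abs_self h)
  have habs' : 1 ≤ |(-h : ℝ)| := by rwa [abs_neg]
  have hrect := Complex.integral_boundary_rect_eq_zero_of_differentiableOn F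
    ((c : ℂ) + ((-h : ℝ) : ℂ) * Complex.I) ((c' : ℂ) + (h : ℂ) * Complex.I) (by
      refine hF.differentiableOn.mono fun s hs => Or.inr ?_
      have := hs.1
      simp only [Complex.add_re, Complex.ofReal_re, Complex.mul_re, Complex.I_re, mul_zero,
        Complex.ofReal_im, Complex.I_im, mul_one, sub_self, add_zero, Set.mem_preimage] at this
      exact (lt_min hc hc').trans_le this.1)
  simp only [Complex.add_re, Complex.ofReal_re, Complex.mul_re, Complex.I_re, mul_zero,
    Complex.ofReal_im, Complex.I_im, mul_one, sub_self, add_zero, Complex.add_im, Complex.mul_im,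
    zero_add, smul_eq_mul] at hrect
  have e1 := intervalIntegral.integral_Iic_sub_Iic (hF.integrableOn_line habs' c)
    (hF.integrableOn_line habs' c')
  have e2 := intervalIntegral.integral_Iic_sub_Iic (hF.integrableOn_line habs c)
    (hF.integrableOn_line habs c')
  rw [loopIntegral, loopIntegral]
  rw [← e1, ← e2] at hrect
  linear_combination -hrect

lemma tendsto_left_side (hF : LoopAdmissible F r φ) {h h' : ℝ}
    (hh : ∀ t ∈ Set.uIcc h h', 1 ≤ |t|) :
    Tendsto (fun T : ℝ => ∫ t in h..h', F ((T : ℂ) + (t : ℂ) * Complex.I)) atBot (𝓝 0) := by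
  have hlim : Tendsto (fun T : ℝ => φ T * |h' - h|) atBot (𝓝 0) := by
    simpa using hF.tendsto.mul_const |h' - h|
  refine squeeze_zero_norm (fun T => ?_) hlim
  refine intervalIntegral.norm_integral_le_of_norm_le_const fun t ht => ?_
  simpa using hF.norm_le ((T : ℂ) + (t : ℂ) * Complex.I)
    (by simpa using hh t (Set.uIoc_subset_uIcc ht))

/-- Cauchy's theorem on the half-strip between the heights `h` and `h'`: on the rectangle cut off at
real part `T`, the left side vanishes as `T → -∞`. The condition on `Set.uIcc` keeps the strip at
distance at least `1` from the real axis, where the slit lies. -/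
lemma line_sub_line (hF : LoopAdmissible F r φ) {c h h' : ℝ}
    (hh : ∀ t ∈ Set.uIcc h h', 1 ≤ |t|) :
    (∫ t in Set.Iic c, F ((t : ℂ) + (h : ℂ) * Complex.I)) -
      (∫ t in Set.Iic c, F ((t : ℂ) + (h' : ℂ) * Complex.I)) +
      Complex.I * (∫ t in h..h', F ((c : ℂ) + (t : ℂ) * Complex.I)) = 0 := by
  have L1 := intervalIntegral_tendsto_integral_Iic c
    (hF.integrableOn_line (hh h Set.left_mem_uIcc) c) tendsto_id
  have L2 := intervalIntegral_tendsto_integral_Iic c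
    (hF.integrableOn_line (hh h' Set.right_mem_uIcc) c) tendsto_id
  have L3 := ((L1.sub L2).add_const
    (Complex.I * (∫ t in h..h', F ((c : ℂ) + (t : ℂ) * Complex.I)))).sub
      ((hF.tendsto_left_side hh).const_mul Complex.I)
  rw [mul_zero, sub_zero] at L3
  refine tendsto_nhds_unique L3 (tendsto_const_nhds.congr fun T => ?_)
  have hrect := Complex.integral_boundary_rect_eq_zero_of_differentiableOn F
    ((T : ℂ) + (h : ℂ) * Complex.I) ((c : ℂ) + (h' : ℂ) * Complex.I) (by
      refine hF.differentiableOn.mono fun s hs => Or.inl ?_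
      have := hs.2
      simp only [Complex.add_im, Complex.ofReal_re, Complex.mul_im, Complex.I_re, mul_zero,
        Complex.ofReal_im, Complex.I_im, mul_one, zero_add, add_zero, Set.mem_preimage] at this
      intro h0
      have := hh _ this
      rw [h0] at this
      norm_num at this)
  simp only [Complex.add_re, Complex.ofReal_re, Complex.mul_re, Complex.I_re, mul_zero,
    Complex.ofReal_im, Complex.I_im, mul_one, sub_self, add_zero, Complex.add_im, Complex.mul_im,
    zero_add, smul_eq_mul] at hrect
  exact hrect.symm

/-- The loop may be widened. -/
lemma loopIntegral_height (hF : LoopAdmissible F r φ) {c h h' : ℝ} (hc : r < c) (hh : 1 ≤ h)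
    (hhh : h ≤ h') : loopIntegral F c h = loopIntegral F c h' := by
  have e1 := hF.line_sub_line (c := c) (h := h) (h' := h') (by
    intro t ht
    rw [Set.uIcc_of_le hhh] at ht
    exact (hh.trans ht.1).trans (le_abs_self t))
  have e2 := hF.line_sub_line (c := c) (h := -h') (h' := -h) (by
    intro t ht
    rw [Set.uIcc_of_le (by linarith)] at ht
    have := ht.2
    rw [← abs_neg]
    exact (by linarith : 1 ≤ -t).trans (le_abs_self _))
  have hcont := continuous_vertical hF.differentiableOn hc
  have e3 : (∫ t in (-h')..h', F ((c : ℂ) + (t : ℂ) * Complex.I)) =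
      (∫ t in (-h')..(-h), F ((c : ℂ) + (t : ℂ) * Complex.I)) +
      (∫ t in (-h)..h, F ((c : ℂ) + (t : ℂ) * Complex.I)) +
      (∫ t in h..h', F ((c : ℂ) + (t : ℂ) * Complex.I)) := by
    rw [intervalIntegral.integral_add_adjacent_intervals,
      intervalIntegral.integral_add_adjacent_intervals] <;>
    exact hcont.intervalIntegrable _ _
  rw [loopIntegral, loopIntegral, e3]
  linear_combination -e1 - e2

lemma loopIntegral_eq (hF : LoopAdmissible F r φ) {c c' h' : ℝ} (hc : r < c) (hc' : r < c')
    (hh : 1 ≤ h') : loopIntegral F c 1 = loopIntegral F c' h' :=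
  (hF.loopIntegral_vertex hc hc' le_rfl).trans (hF.loopIntegral_height hc' le_rfl hh)

end LoopAdmissible

lemma norm_loopIntegral_le {F : ℂ → ℂ} {c h K : ℝ} {ψ : ℝ → ℝ} (hh : 0 ≤ h)
    (hψ : IntegrableOn ψ (Set.Iic c))
    (h1 : ∀ t ≤ c, ‖F ((t : ℂ) + ((-h : ℝ) : ℂ) * Complex.I)‖ ≤ ψ t)
    (h2 : ∀ t ≤ c, ‖F ((t : ℂ) + (h : ℂ) * Complex.I)‖ ≤ ψ t)
    (h3 : ∀ t ∈ Set.Ioc (-h) h, ‖F ((c : ℂ) + (t : ℂ) * Complex.I)‖ ≤ K) :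
    ‖loopIntegral F c h‖ ≤ 2 * (∫ t in Set.Iic c, ψ t) + 2 * h * K := by
  have b1 : ‖∫ t in Set.Iic c, F ((t : ℂ) + ((-h : ℝ) : ℂ) * Complex.I)‖ ≤ ∫ t in Set.Iic c, ψ t :=
    norm_integral_le_of_norm_le hψ ((ae_restrict_iff' measurableSet_Iic).mpr (ae_of_all _ h1))
  have b2 : ‖∫ t in Set.Iic c, F ((t : ℂ) + (h : ℂ) * Complex.I)‖ ≤ ∫ t in Set.Iic c, ψ t :=
    norm_integral_le_of_norm_le hψ ((ae_restrict_iff' measurableSet_Iic).mpr (ae_of_all _ h2))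
  have b3 : ‖∫ t in (-h)..h, F ((c : ℂ) + (t : ℂ) * Complex.I)‖ ≤ K * |h - -h| := by
    refine intervalIntegral.norm_integral_le_of_norm_le_const fun t ht => h3 t ?_
    rwa [Set.uIoc_of_le (by linarith)] at ht
  rw [sub_neg_eq_add, abs_of_nonneg (by linarith)] at b3
  rw [loopIntegral]
  refine (norm_sub_le _ _).trans ((add_le_add_left (norm_add_le _ _) _).trans ?_)
  rw [norm_mul, Complex.norm_I, one_mul]
  linarith

/-! ### Inverse Mellin transforms over loops -/

/-- A function that is holomorphic off `(-∞, r]` and `O((1 + |s|)^(-γ))` away from this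
half-line. -/
structure MellinSymbol (R : ℂ → ℂ) (r γ : ℝ) : Prop where
  differentiableOn : DifferentiableOn ℂ R (slitRegion r)
  exists_bound : ∀ c, r < c → ∃ C : ℝ, 0 ≤ C ∧ ∀ s : ℂ, (1 ≤ |s.im| ∨ c ≤ s.re) →
    ‖R s‖ ≤ C * (1 + ‖s‖) ^ (-γ)

/-- The inverse Mellin transform of `R` over a loop, in the variable `y = -log x`. -/
def loopKernel (R : ℂ → ℂ) (c y : ℝ) : ℂ :=
  1 / (2 * Real.pi * Complex.I) * loopIntegral (fun s => R s * Complex.exp (s * y)) c 1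

lemma norm_exp_mul_real (s : ℂ) (y : ℝ) : ‖Complex.exp (s * y)‖ = Real.exp (y * s.re) := by
  rw [Complex.norm_exp]; simp [mul_comm]

lemma one_add_norm_rpow_le_one {γ : ℝ} (hγ : 0 < γ) (s : ℂ) : (1 + ‖s‖) ^ (-γ) ≤ 1 :=
  Real.rpow_le_one_of_one_le_of_nonpos (by linarith [norm_nonneg s]) (by linarith)

namespace MellinSymbol

variable {R : ℂ → ℂ} {r γ : ℝ}

lemma exp_admissible (hR : MellinSymbol R r γ) (hγ : 0 < γ) {y : ℝ} (hy : 0 < y) :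
    ∃ φ, LoopAdmissible (fun s => R s * Complex.exp (s * y)) r φ := by
  obtain ⟨C, hC0, hC⟩ := hR.exists_bound (r + 1) (by linarith)
  refine ⟨fun t => C * Real.exp (y * t), ?_, fun c => ?_, ?_, fun s hs => ?_⟩
  · exact hR.differentiableOn.mul (by fun_prop)
  · exact (integrableOn_exp_mul_Iic hy c).const_mul C
  · have : Tendsto (fun t : ℝ => Real.exp (y * t)) atBot (𝓝 0) :=
      Real.tendsto_exp_atBot.comp (tendsto_id.const_mul_atBot hy)
    simpa using this.const_mul C
  · rw [norm_mul, norm_exp_mul_real]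
    gcongr
    refine (hC s (Or.inl hs)).trans ?_
    exact mul_le_of_le_one_right hC0 (one_add_norm_rpow_le_one hγ s)

lemma norm_two_pi_I_inv_le : ‖(1 : ℂ) / (2 * Real.pi * Complex.I)‖ ≤ 1 := by
  rw [norm_div, norm_one, norm_mul, norm_mul, Complex.norm_I, Complex.norm_real,
    Real.norm_of_nonneg Real.pi_pos.le, mul_one, Complex.norm_ofNat]
  rw [div_le_one (by positivity)]
  linarith [Real.pi_gt_three]

/-- The loop is deformed to vertex `c'` and height `h`, and `R` is estimated there by `M`. The two
parameters stay free because the best loop depends on `y`. -/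
lemma norm_loopKernel_le (hR : MellinSymbol R r γ) (hγ : 0 < γ) {c c' h C y M : ℝ} (hc : r < c)
    (hc' : r < c') (hh : 1 ≤ h) (hy : 0 < y)
    (hC : ∀ s : ℂ, (1 ≤ |s.im| ∨ c' ≤ s.re) → ‖R s‖ ≤ C * (1 + ‖s‖) ^ (-γ))
    (hCM : ∀ s : ℂ, (h ≤ |s.im| ∨ c' ≤ s.re) → C * (1 + ‖s‖) ^ (-γ) ≤ M) :
    ‖loopKernel R c y‖ ≤ 2 * M * Real.exp (y * c') * (1 / y + h) := by
  obtain ⟨φ, hφ⟩ := hR.exp_admissible hγ hy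
  rw [loopKernel, hφ.loopIntegral_eq hc hc' hh, norm_mul]
  have key : ∀ s : ℂ, (h ≤ |s.im| ∨ c' ≤ s.re) →
      ‖R s * Complex.exp (s * y)‖ ≤ M * Real.exp (y * s.re) := by
    intro s hs
    rw [norm_mul, norm_exp_mul_real]
    gcongr
    exact (hC s (hs.imp_left hh.trans)).trans (hCM s hs)
  have hint : IntegrableOn (fun t => M * Real.exp (y * t)) (Set.Iic c') :=
    (integrableOn_exp_mul_Iic hy c').const_mul M
  have b := norm_loopIntegral_le (F := fun s => R s * Complex.exp (s * y)) (c := c') (h := h)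
    (K := M * Real.exp (y * c')) (by linarith) hint
    (fun t _ => by
      simpa using key ((t : ℂ) + ((-h : ℝ) : ℂ) * Complex.I)
        (Or.inl (by simp [le_abs_self])))
    (fun t _ => by
      simpa using key ((t : ℂ) + (h : ℂ) * Complex.I) (Or.inl (by simp [le_abs_self])))
    (fun t _ => by
      simpa using key ((c' : ℂ) + (t : ℂ) * Complex.I) (Or.inr (by simp)))
  rw [integral_const_mul, integral_exp_mul_Iic hy] at b
  refine (mul_le_of_le_one_left (norm_nonneg _) norm_two_pi_I_inv_le).trans (b.trans_eq ?_)
  field_simp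

/-- The inverse Mellin transform is `O(y^(γ-1))` at `y = 0` and `O(e^(ρy))` at infinity for
every `ρ > r`. -/
lemma exists_norm_loopKernel_le (hR : MellinSymbol R r γ) (hγ : 0 < γ) {c ρ : ℝ} (hc : r < c)
    (hρ : r < ρ) :
    ∃ C : ℝ, 0 ≤ C ∧ ∀ y : ℝ, 0 < y →
      ‖loopKernel R c y‖ ≤ C * y ^ (γ - 1) * Real.exp (ρ * y) := by
  set A : ℝ := |r| + 1 with hA
  have hA1 : 1 ≤ A := by simp [hA]
  have hrA : r < A := by linarith [le_abs_self r]
  -- The midpoint still lies to the right of `r` and leaves a spare exponential `e^((ρ - ρ') y)` for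
  -- large `y`.
  set ρ' : ℝ := (r + ρ) / 2 with hρ'
  obtain ⟨C₁, hC₁0, hC₁⟩ := hR.exists_bound A hrA
  obtain ⟨C₂, hC₂0, hC₂⟩ := hR.exists_bound ρ' (by linarith)
  -- for `y ≥ 1` the power of `y` is absorbed by the exponential
  set ε : ℝ := ρ - ρ' with hε
  have hεpos : 0 < ε := by rw [hε, hρ']; linarith
  set δ : ℝ := ε / (|γ - 1| + 1) with hδ
  have hδpos : 0 < δ := by positivity
  set D : ℝ := Real.exp (|γ - 1| * |Real.log δ|) with hD
  have habsorb : ∀ y : ℝ, 1 ≤ y → 1 ≤ D * y ^ (γ - 1) * Real.exp (ε * y) := by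
    intro y hy
    have hy0 : 0 < y := by linarith
    rw [hD, Real.rpow_def_of_pos hy0, ← Real.exp_add, ← Real.exp_add]
    apply Real.one_le_exp
    have l1 : Real.log y ≤ δ * y + |Real.log δ| := by
      have := Real.log_le_sub_one_of_pos (mul_pos hδpos hy0)
      rw [Real.log_mul hδpos.ne' hy0.ne'] at this
      linarith [neg_abs_le (Real.log δ)]
    have l0 : 0 ≤ Real.log y := Real.log_nonneg hy
    have l2 : -(|γ - 1| * Real.log y) ≤ Real.log y * (γ - 1) := by
      nlinarith [neg_abs_le (γ - 1)]
    have l3 : |γ - 1| * Real.log y ≤ |γ - 1| * (δ * y + |Real.log δ|) := by gcongr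
    have l4 : |γ - 1| * δ ≤ ε := by
      rw [hδ, mul_div_assoc', div_le_iff₀ (by positivity)]
      nlinarith [abs_nonneg (γ - 1)]
    have l5 : |γ - 1| * δ * y ≤ ε * y := by gcongr
    nlinarith
  refine ⟨4 * C₁ * Real.exp A * Real.exp |ρ| + 4 * C₂ * D, by positivity, fun y hy => ?_⟩
  have hyg : 0 < y ^ (γ - 1) := Real.rpow_pos_of_pos hy _
  rcases le_total y 1 with hy1 | hy1
  -- For `y ≤ 1` the loop is scaled by `1/y`: with vertex `A / y` and height `1 / y` the exponential
  -- is at most `e^A`, while `‖R‖ ≤ C₁ y^γ` on the loop. The length factor `1/y` turns this into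
  -- `y^(γ-1)`.
  · have hi : 1 ≤ 1 / y := by rwa [le_div_iff₀ hy, one_mul]
    have hAy : A ≤ A / y := by rw [le_div_iff₀ hy]; nlinarith
    have hb := hR.norm_loopKernel_le hγ (c := c) (c' := A / y) (h := 1 / y) (C := C₁) (y := y)
      (M := C₁ * y ^ γ) hc (hrA.trans_le hAy) hi hy
      (fun s hs => hC₁ s (hs.imp_right hAy.trans)) (by
        intro s hs
        have hs' : 1 / y ≤ 1 + ‖s‖ := by
          rcases hs with h | h
          · linarith [Complex.abs_im_le_norm s]
          · have : 1 / y ≤ A / y := by gcongr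
            linarith [Complex.re_le_norm s]
        gcongr
        rw [Real.rpow_neg (by positivity), inv_le_comm₀ (by positivity) (by positivity),
          ← Real.inv_rpow hy.le, ← one_div]
        gcongr)
    refine hb.trans ?_
    have e1 : y * (A / y) = A := by field_simp
    have e2 : y ^ γ = y ^ (γ - 1) * y := by
      rw [Real.rpow_sub_one hy.ne']; field_simp
    rw [e1, e2]
    have e3 : 2 * (C₁ * (y ^ (γ - 1) * y)) * Real.exp A * (1 / y + 1 / y) =
        4 * C₁ * Real.exp A * 1 * y ^ (γ - 1) := by field_simp; ring
    rw [e3]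
    have e4 : 1 ≤ Real.exp |ρ| * Real.exp (ρ * y) := by
      rw [← Real.exp_add]
      apply Real.one_le_exp
      nlinarith [neg_abs_le ρ, abs_nonneg ρ]
    calc 4 * C₁ * Real.exp A * 1 * y ^ (γ - 1)
        ≤ 4 * C₁ * Real.exp A * (Real.exp |ρ| * Real.exp (ρ * y)) * y ^ (γ - 1) := by gcongr
      _ = (4 * C₁ * Real.exp A * Real.exp |ρ|) * y ^ (γ - 1) * Real.exp (ρ * y) := by ring
      _ ≤ _ := by
          have : 0 ≤ 4 * C₂ * D := by positivity
          gcongr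
          linarith
  -- For `y ≥ 1` a fixed loop with vertex `ρ'` suffices; `habsorb` then supplies the power of `y`.
  · have hb := hR.norm_loopKernel_le hγ (c := c) (c' := ρ') (h := 1) (C := C₂) (y := y)
      (M := C₂) hc (by linarith) le_rfl hy hC₂
      (fun s _ => mul_le_of_le_one_right hC₂0 (one_add_norm_rpow_le_one hγ s))
    refine hb.trans ?_
    have hi : 1 / y ≤ 1 := by rwa [div_le_one hy]
    have e1 : Real.exp (ρ * y) = Real.exp (y * ρ') * Real.exp (ε * y) := by
      rw [← Real.exp_add]; congr 1; rw [hε]; ring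
    calc 2 * C₂ * Real.exp (y * ρ') * (1 / y + 1)
        ≤ 2 * C₂ * Real.exp (y * ρ') * (1 + 1) := by gcongr
      _ = 4 * C₂ * Real.exp (y * ρ') * 1 := by ring
      _ ≤ 4 * C₂ * Real.exp (y * ρ') * (D * y ^ (γ - 1) * Real.exp (ε * y)) := by
          gcongr
          exact habsorb y hy1
      _ = 4 * C₂ * D * y ^ (γ - 1) * Real.exp (ρ * y) := by rw [e1]; ring
      _ ≤ _ := by
          have : 0 ≤ 4 * C₁ * Real.exp A * Real.exp |ρ| := by positivity
          gcongr
          linarith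

end MellinSymbol

end

-- Linearity and congruence of loop integrals

lemma one_add_norm_le_mul_norm_sub {a : ℝ} {s : ℂ} (h : 1 ≤ ‖s - a‖) :
    1 + ‖s‖ ≤ (2 + |a|) * ‖s - a‖ := by
  have h1 : ‖s‖ ≤ ‖s - a‖ + |a| := by
    have := norm_add_le (s - a) (a : ℂ)
    rwa [sub_add_cancel, Complex.norm_real, Real.norm_eq_abs] at this
  nlinarith [abs_nonneg a]

lemma loopIntegral_add_const_mul {F G : ℂ → ℂ} (k : ℂ) {c h : ℝ}
    (f1 : IntegrableOn (fun t : ℝ => F ((t : ℂ) + ((-h : ℝ) : ℂ) * Complex.I)) (Set.Iic c))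
    (f2 : IntegrableOn (fun t : ℝ => F ((t : ℂ) + (h : ℂ) * Complex.I)) (Set.Iic c))
    (f3 : IntervalIntegrable (fun t : ℝ => F ((c : ℂ) + (t : ℂ) * Complex.I)) volume (-h) h)
    (g1 : IntegrableOn (fun t : ℝ => G ((t : ℂ) + ((-h : ℝ) : ℂ) * Complex.I)) (Set.Iic c))
    (g2 : IntegrableOn (fun t : ℝ => G ((t : ℂ) + (h : ℂ) * Complex.I)) (Set.Iic c))
    (g3 : IntervalIntegrable (fun t : ℝ => G ((c : ℂ) + (t : ℂ) * Complex.I)) volume (-h) h) :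
    loopIntegral (fun s => F s + k * G s) c h = loopIntegral F c h + k * loopIntegral G c h := by
  simp only [loopIntegral]
  rw [integral_add f1 (g1.const_mul k), integral_add f2 (g2.const_mul k),
    intervalIntegral.integral_add f3 (g3.const_mul k), integral_const_mul, integral_const_mul,
    intervalIntegral.integral_const_mul]
  ring

/-- The loop meets the real axis only at its vertex, so functions that differ at poles or removable
singularities elsewhere on the axis have the same loop integral. -/
lemma loopIntegral_congr {F G : ℂ → ℂ} {c h : ℝ}
    (h0 : h ≠ 0) (H : ∀ s : ℂ, (s.im ≠ 0 ∨ s.re = c) → F s = G s) :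
    loopIntegral F c h = loopIntegral G c h := by
  simp only [loopIntegral]
  congr 1
  · congr 1
    · exact integral_congr_ae (ae_of_all _ fun t => H _ (Or.inl (by simpa using h0)))
    · congr 2
      ext t
      exact H _ (Or.inr (by simp))
  · exact integral_congr_ae (ae_of_all _ fun t => H _ (Or.inl (by simpa using h0)))

/-! ### The loop integral of a product of two simple fractions -/

/-- Far to the left `log(u - t) = log(-t) + log(1 + u/(-t))`, and the first term does not depend on
`u`. -/
lemma tendsto_log_sub_log (u v : ℂ) :
    Tendsto (fun t : ℝ => Complex.log (u - t) - Complex.log (v - t)) atBot (𝓝 0) := by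
  have key : ∀ u : ℂ, Tendsto (fun t : ℝ => Complex.log (u / ((-t : ℝ) : ℂ) + 1)) atBot (𝓝 0) := by
    intro u
    have h1 : Tendsto (fun t : ℝ => u / ((-t : ℝ) : ℂ)) atBot (𝓝 0) := by
      rw [tendsto_zero_iff_norm_tendsto_zero]
      have h2 : Tendsto (fun t : ℝ => ‖u‖ / |-t|) atBot (𝓝 0) := by
        refine Tendsto.div_atTop tendsto_const_nhds ?_
        exact tendsto_abs_atTop_atTop.comp tendsto_neg_atBot_atTop
      refine h2.congr fun t => ?_
      rw [norm_div, Complex.norm_real, Real.norm_eq_abs]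
    have h3 := ((continuousAt_clog (Complex.one_mem_slitPlane)).tendsto).comp
      (by simpa using h1.add_const (1 : ℂ))
    simpa [Function.comp_def] using h3
  have := (key u).sub (key v)
  rw [sub_zero] at this
  refine this.congr' ?_
  filter_upwards [Iio_mem_atBot (-(‖u‖ + ‖v‖ + 1))] with t ht
  have ht' : ‖u‖ + ‖v‖ + 1 < -t := by have := Set.mem_Iio.mp ht; linarith
  have ht0 : 0 < -t := by linarith [norm_nonneg u, norm_nonneg v]
  have ne : ((-t : ℝ) : ℂ) ≠ 0 := by exact_mod_cast ht0.ne'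
  have step : ∀ w : ℂ, ‖w‖ < -t →
      Complex.log (w - t) = Real.log (-t) + Complex.log (w / ((-t : ℝ) : ℂ) + 1) := by
    intro w hw
    rw [← Complex.log_ofReal_mul ht0]
    · congr 1
      field_simp
      push_cast
      ring
    · intro h0
      have : w = -((-t : ℝ) : ℂ) := by
        field_simp at h0
        linear_combination h0
      rw [this, norm_neg, Complex.norm_real, Real.norm_of_nonneg ht0.le] at hw
      exact lt_irrefl _ hw
  rw [step u (by linarith [norm_nonneg v]), step v (by linarith [norm_nonneg u])]
  ring

lemma log_eq_log_neg_add {z : ℂ} (hz : 0 < z.im) :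
    Complex.log z = Complex.log (-z) + Real.pi * Complex.I := by
  apply Complex.ext
  · simp only [Complex.log_re, Complex.add_re, norm_neg]; simp
  · have := Complex.arg_neg_eq_arg_sub_pi_of_im_pos hz
    simp only [Complex.log_im, Complex.add_im, this]; simp

lemma log_eq_log_neg_sub {z : ℂ} (hz : z.im < 0) :
    Complex.log z = Complex.log (-z) - Real.pi * Complex.I := by
  apply Complex.ext
  · simp only [Complex.log_re, Complex.sub_re, norm_neg]; simp
  · have := Complex.arg_neg_eq_arg_add_pi_of_im_neg hz
    simp only [Complex.log_im, Complex.sub_im, this]; simp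

/-- The logarithm of `s + τ` exceeds that of `-(s + τ)` by `πi` in the upper half-plane and falls
short by `πi` in the lower one. The two limits at the ends of the loop therefore differ by `2πi`. -/
lemma tendsto_fraction_log_upper (τ w : ℝ) :
    Tendsto (fun t : ℝ => Complex.log ((t : ℂ) + Complex.I + τ)
      - Complex.log (w - ((t : ℂ) + Complex.I))) atBot (𝓝 (Real.pi * Complex.I)) := by
  have h := (tendsto_log_sub_log (-Complex.I - τ) (w - Complex.I)).add_const
    ((Real.pi : ℂ) * Complex.I)
  rw [zero_add] at h
  refine h.congr fun t => ?_
  rw [log_eq_log_neg_add (z := (t : ℂ) + Complex.I + τ) (by simp),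
    show -Complex.I - τ - (t : ℂ) = -((t : ℂ) + Complex.I + τ) by ring,
    show (w : ℂ) - Complex.I - t = w - ((t : ℂ) + Complex.I) by ring]
  ring

lemma tendsto_fraction_log_lower (τ w : ℝ) :
    Tendsto (fun t : ℝ => Complex.log ((t : ℂ) + -Complex.I + τ)
      - Complex.log (w - ((t : ℂ) + -Complex.I))) atBot (𝓝 (-(Real.pi * Complex.I))) := by
  have h := (tendsto_log_sub_log (Complex.I - τ) (w + Complex.I)).add_const
    (-((Real.pi : ℂ) * Complex.I))
  rw [zero_add] at h
  refine h.congr fun t => ?_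
  rw [log_eq_log_neg_sub (z := (t : ℂ) + -Complex.I + τ) (by simp),
    show Complex.I - τ - (t : ℂ) = -((t : ℂ) + -Complex.I + τ) by ring,
    show (w : ℂ) + Complex.I - t = w - ((t : ℂ) + -Complex.I) by ring]
  ring

lemma hasDerivAt_fraction_log {τ w : ℝ} {s : ℂ} (h1 : s + τ ∈ Complex.slitPlane)
    (h2 : w - s ∈ Complex.slitPlane) :
    HasDerivAt (fun s : ℂ => Complex.log (s + τ) - Complex.log (w - s))
      ((w + τ) * (1 / ((s + τ) * (w - s)))) s := by
  have d1 : HasDerivAt (fun s : ℂ => Complex.log (s + τ)) (1 / (s + τ)) s :=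
    ((hasDerivAt_id s).add_const (τ : ℂ)).clog h1
  have d2 : HasDerivAt (fun s : ℂ => Complex.log (w - s)) (-1 / (w - s)) s :=
    ((hasDerivAt_id s).const_sub (w : ℂ)).clog h2
  have n1 := Complex.slitPlane_ne_zero h1
  have n2 := Complex.slitPlane_ne_zero h2
  convert! d1.sub d2 using 1
  field_simp
  ring

lemma norm_fraction_le {τ w : ℝ} {s : ℂ} (h1 : 1 ≤ ‖s + τ‖) (h2 : 1 ≤ ‖s - w‖) :
    ‖1 / ((s + τ) * (w - s))‖ ≤ (2 + |τ|) * (2 + |w|) * (1 + ‖s‖) ^ (-2 : ℝ) := by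
  have e1 : 1 + ‖s‖ ≤ (2 + |τ|) * ‖s + τ‖ := by
    have := one_add_norm_le_mul_norm_sub (a := -τ) (s := s) (by simpa using h1)
    simpa using this
  have e2 := one_add_norm_le_mul_norm_sub h2
  rw [norm_div, norm_one, norm_mul, norm_sub_rev (w : ℂ) s, Real.rpow_neg (by positivity),
    Real.rpow_two, ← div_eq_mul_inv, div_le_div_iff₀ (by positivity) (by positivity), one_mul]
  calc (1 + ‖s‖) ^ 2 = (1 + ‖s‖) * (1 + ‖s‖) := sq _
    _ ≤ ((2 + |τ|) * ‖s + τ‖) * ((2 + |w|) * ‖s - w‖) := by gcongr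
    _ = _ := by ring

lemma integrableOn_one_add_norm_rpow {C k : ℝ} (hk : 1 < k) (s : Set ℝ) :
    IntegrableOn (fun t : ℝ => C * (1 + ‖t‖) ^ (-k)) s := by
  refine Integrable.integrableOn (Integrable.const_mul ?_ C)
  exact integrable_one_add_norm (by simpa using hk)

lemma norm_le_norm_add_mul_I (t h : ℝ) : ‖t‖ ≤ ‖(t : ℂ) + (h : ℂ) * Complex.I‖ := by
  have := Complex.abs_re_le_norm ((t : ℂ) + (h : ℂ) * Complex.I)
  simpa using this

lemma one_add_norm_rpow_anti {k : ℝ} (hk : 0 ≤ k) (t h : ℝ) :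
    (1 + ‖(t : ℂ) + (h : ℂ) * Complex.I‖) ^ (-k) ≤ (1 + ‖t‖) ^ (-k) := by
  refine Real.rpow_le_rpow_of_nonpos (by positivity) ?_ (by linarith)
  linarith [norm_le_norm_add_mul_I t h]

lemma one_le_norm_add_of_im {s : ℂ} {a : ℝ} (h : 1 ≤ |s.im|) : 1 ≤ ‖s + a‖ := by
  refine h.trans ?_
  simpa using Complex.abs_im_le_norm (s + a)

lemma one_le_norm_sub_of_im {s : ℂ} {a : ℝ} (h : 1 ≤ |s.im|) : 1 ≤ ‖s - a‖ := by
  refine h.trans ?_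
  simpa using Complex.abs_im_le_norm (s - a)

lemma integrableOn_fraction_line {τ w ρ h : ℝ} (hh : 1 ≤ |h|) :
    IntegrableOn (fun t : ℝ => 1 / (((t : ℂ) + (h : ℂ) * Complex.I + τ) *
      (w - ((t : ℂ) + (h : ℂ) * Complex.I)))) (Set.Iic ρ) := by
  have him : ∀ t : ℝ, 1 ≤ |((t : ℂ) + (h : ℂ) * Complex.I).im| := fun t => by simpa using hh
  have n1 : ∀ t : ℝ, (t : ℂ) + (h : ℂ) * Complex.I + τ ≠ 0 := fun t =>
    norm_pos_iff.mp (one_pos.trans_le (one_le_norm_add_of_im (him t)))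
  have n2 : ∀ t : ℝ, (w : ℂ) - ((t : ℂ) + (h : ℂ) * Complex.I) ≠ 0 := fun t => by
    rw [← norm_pos_iff, norm_sub_rev]
    exact one_pos.trans_le (one_le_norm_sub_of_im (him t))
  refine (integrableOn_one_add_norm_rpow (C := (2 + |τ|) * (2 + |w|)) (k := 2) (by norm_num)
    (Set.Iic ρ)).mono' ?_ (ae_of_all _ fun t => ?_)
  · refine Continuous.aestronglyMeasurable ?_
    refine continuous_const.div (by fun_prop) fun t => mul_ne_zero (n1 t) (n2 t)
  · refine (norm_fraction_le (one_le_norm_add_of_im (him t))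
      (one_le_norm_sub_of_im (him t))).trans ?_
    exact mul_le_mul_of_nonneg_left (one_add_norm_rpow_anti (by norm_num) t h) (by positivity)

lemma continuous_fraction_vertical {τ w ρ : ℝ} (h1 : -τ < ρ) (h2 : ρ < w) :
    Continuous fun t : ℝ => 1 / (((ρ : ℂ) + (t : ℂ) * Complex.I + τ) *
      (w - ((ρ : ℂ) + (t : ℂ) * Complex.I))) := by
  refine continuous_const.div (by fun_prop) fun t => mul_ne_zero ?_ ?_
  · intro h0
    have := congrArg Complex.re h0
    simp at this
    linarith
  · intro h0
    have := congrArg Complex.re h0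
    simp at this
    linarith

/-- `log(s + τ) - log(w - s)` is an antiderivative of `(w + τ)` times the integrand. It is
holomorphic along the whole loop, because the real axis is crossed at `ρ`, between the cuts `(-∞,
-τ]` and `[w, ∞)`. Only the limits `±πi` at the two ends contribute. -/
lemma loopIntegral_fraction {τ w ρ : ℝ} (h1 : -τ < ρ) (h2 : ρ < w) :
    loopIntegral (fun s => 1 / ((s + τ) * (w - s))) ρ 1 =
      2 * Real.pi * Complex.I / (w + τ) := by
  have hwt : (w : ℂ) + τ ≠ 0 := by exact_mod_cast (by linarith : w + τ ≠ 0)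
  set A : ℂ → ℂ := fun s => Complex.log (s + τ) - Complex.log (w - s) with hA
  have line : ∀ h : ℝ, |h| = 1 → ∀ t : ℝ, HasDerivAt (fun t : ℝ => A ((t : ℂ) + h * Complex.I))
      ((w + τ) * (1 / (((t : ℂ) + (h : ℂ) * Complex.I + τ) *
        (w - ((t : ℂ) + (h : ℂ) * Complex.I))))) t := by
    intro h hh t
    have h0 : h ≠ 0 := by rintro rfl; norm_num at hh
    have d := hasDerivAt_fraction_log (τ := τ) (w := w) (s := (t : ℂ) + h * Complex.I)
      (Or.inr (by simpa using h0))
      (Or.inr (by simpa using h0))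
    have i : HasDerivAt (fun t : ℝ => (t : ℂ) + h * Complex.I) 1 t :=
      (Complex.ofRealCLM.hasDerivAt).add_const _
    have := d.comp t i
    simpa [Function.comp_def, hA] using this
  have l1 := integral_Iic_of_hasDerivAt_of_tendsto' (a := ρ)
    (fun t _ => line (-1) (by simp) t) ((integrableOn_fraction_line (by simp)).const_mul _)
    (m := -(Real.pi * Complex.I)) (by simpa [hA] using tendsto_fraction_log_lower τ w)
  have l2 := integral_Iic_of_hasDerivAt_of_tendsto' (a := ρ)
    (fun t _ => line 1 (by simp) t) ((integrableOn_fraction_line (by simp)).const_mul _)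
    (m := Real.pi * Complex.I) (by simpa [hA] using tendsto_fraction_log_upper τ w)
  have hcont := continuous_fraction_vertical h1 h2
  have l3 : ∫ t in (-1 : ℝ)..1, Complex.I * ((w + τ) * (1 / (((ρ : ℂ) + (t : ℂ) * Complex.I + τ) *
        (w - ((ρ : ℂ) + (t : ℂ) * Complex.I))))) =
        A (ρ + (1 : ℝ) * Complex.I) - A (ρ + (-1 : ℝ) * Complex.I) := by
    refine intervalIntegral.integral_eq_sub_of_hasDerivAt
      (f := fun t : ℝ => A ((ρ : ℂ) + (t : ℂ) * Complex.I)) (fun t _ => ?_)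
      (((hcont.const_mul _).const_mul _).intervalIntegrable _ _)
    have d := hasDerivAt_fraction_log (τ := τ) (w := w) (s := (ρ : ℂ) + (t : ℂ) * Complex.I)
      (Or.inl (by simp; linarith)) (Or.inl (by simp; linarith))
    have i : HasDerivAt (fun t : ℝ => (ρ : ℂ) + (t : ℂ) * Complex.I) Complex.I t := by
      simpa using ((Complex.ofRealCLM.hasDerivAt (x := t)).mul_const Complex.I).const_add (ρ : ℂ)
    have := d.comp t i
    rw [mul_comm Complex.I]
    simpa [Function.comp_def, hA] using this
  rw [integral_const_mul] at l1 l2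
  rw [intervalIntegral.integral_const_mul, intervalIntegral.integral_const_mul] at l3
  rw [eq_div_iff hwt]
  simp only [loopIntegral]
  linear_combination l1 - l2 + l3

section

/-- A loop integral of a function that is holomorphic off `(-∞, r]` and `O(|s|^(-1-g))` away from
this half-line vanishes. -/
lemma loopIntegral_eq_zero {H : ℂ → ℂ} {r c₀ ρ g C : ℝ} (hg : 0 < g)
    (hH : DifferentiableOn ℂ H (slitRegion r)) (hC0 : 0 ≤ C)
    (hC : ∀ s : ℂ, (1 ≤ |s.im| ∨ c₀ ≤ s.re) → ‖H s‖ ≤ C * (1 + ‖s‖) ^ (-(1 + g)))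
    (hρ : r < ρ) : loopIntegral H ρ 1 = 0 := by
  have hadm : LoopAdmissible H r (fun t => C * (1 + ‖t‖) ^ (-(1 + g))) := by
    refine ⟨hH, fun c => integrableOn_one_add_norm_rpow (by linarith) _, ?_, fun s hs => ?_⟩
    · have h1 : Tendsto (fun t : ℝ => 1 + ‖t‖) atBot atTop :=
        tendsto_atTop_add_const_left _ _ tendsto_abs_atBot_atTop
      simpa using ((tendsto_rpow_neg_atTop (by linarith : 0 < 1 + g)).comp h1).const_mul C
    · refine (hC s (Or.inl hs)).trans ?_
      refine mul_le_mul_of_nonneg_left ?_ hC0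
      refine Real.rpow_le_rpow_of_nonpos (by positivity) ?_ (by linarith)
      have := Complex.abs_re_le_norm s
      rw [Real.norm_eq_abs]
      linarith
  set K : ℝ := ∫ t : ℝ, C * (1 + ‖t‖) ^ (-(1 + g / 2)) with hK
  have hint : Integrable (fun t : ℝ => C * (1 + ‖t‖) ^ (-(1 + g / 2))) := by
    simpa using integrableOn_one_add_norm_rpow (C := C) (by linarith : 1 < 1 + g / 2) Set.univ
  have hbound : ∀ N : ℝ, max 1 (max c₀ (r + 1)) ≤ N →
      ‖loopIntegral H ρ 1‖ ≤ (2 * K) * N ^ (-(g / 2)) + 2 * C * N ^ (-g) := by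
    intro N hN
    have hN1 : 1 ≤ N := (le_max_left _ _).trans hN
    have hNc : c₀ ≤ N := (le_max_left _ _).trans ((le_max_right _ _).trans hN)
    have hNr : r < N := by
      have := (le_max_right _ _).trans ((le_max_right _ _).trans hN)
      linarith
    have hN0 : 0 < N := by linarith
    -- The vertex and the height are both moved to `N → ∞`. On the horizontal sides the exponent `1
    -- + g` is split as `g/2 + (1 + g/2)`: the first part gives the factor `N^(-g/2)`, the second
    -- stays integrable along the line.
    rw [hadm.loopIntegral_eq hρ hNr hN1]
    have horiz : ∀ h : ℝ, |h| = N → ∀ t : ℝ, ‖H ((t : ℂ) + (h : ℂ) * Complex.I)‖ ≤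
        N ^ (-(g / 2)) * (C * (1 + ‖t‖) ^ (-(1 + g / 2))) := by
      intro h hh t
      refine (hC _ (Or.inl (by simp [hh, hN1]))).trans ?_
      have hs : N ≤ ‖(t : ℂ) + (h : ℂ) * Complex.I‖ := by
        rw [← hh]
        simpa using Complex.abs_im_le_norm ((t : ℂ) + (h : ℂ) * Complex.I)
      have e : (1 + ‖(t : ℂ) + (h : ℂ) * Complex.I‖) ^ (-(1 + g)) =
          (1 + ‖(t : ℂ) + (h : ℂ) * Complex.I‖) ^ (-(g / 2)) *
          (1 + ‖(t : ℂ) + (h : ℂ) * Complex.I‖) ^ (-(1 + g / 2)) := by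
        rw [← Real.rpow_add (by positivity)]; congr 1; ring
      rw [e]
      have b1 : (1 + ‖(t : ℂ) + (h : ℂ) * Complex.I‖) ^ (-(g / 2)) ≤ N ^ (-(g / 2)) :=
        Real.rpow_le_rpow_of_nonpos hN0 (by linarith) (by linarith)
      have b2 := one_add_norm_rpow_anti (by linarith : 0 ≤ 1 + g / 2) t h
      calc _ ≤ C * (N ^ (-(g / 2)) * (1 + ‖t‖) ^ (-(1 + g / 2))) := by gcongr
        _ = _ := by ring
    have b := norm_loopIntegral_le (F := H) (c := N) (h := N) (K := C * N ^ (-(1 + g)))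
      hN0.le ((hint.const_mul (N ^ (-(g / 2)))).integrableOn)
      (fun t _ => horiz (-N) (by rw [abs_neg, abs_of_pos hN0]) t)
      (fun t _ => horiz N (abs_of_pos hN0) t) (fun t _ => by
        refine (hC _ (Or.inr (by simpa using hNc))).trans ?_
        refine mul_le_mul_of_nonneg_left ?_ hC0
        refine Real.rpow_le_rpow_of_nonpos hN0 ?_ (by linarith)
        have := Complex.abs_re_le_norm ((N : ℂ) + (t : ℂ) * Complex.I)
        simp only [Complex.add_re, Complex.ofReal_re, Complex.mul_re, Complex.I_re, mul_zero,
          Complex.ofReal_im, Complex.I_im, mul_one, sub_self, add_zero, abs_of_pos hN0] at this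
        linarith)
    refine b.trans ?_
    have b4 : ∫ t in Set.Iic N, N ^ (-(g / 2)) * (C * (1 + ‖t‖) ^ (-(1 + g / 2))) ≤
        N ^ (-(g / 2)) * K := by
      rw [integral_const_mul]
      refine mul_le_mul_of_nonneg_left ?_ (by positivity)
      exact setIntegral_le_integral hint (ae_of_all _ fun t => by positivity)
    have e5 : N * N ^ (-(1 + g)) = N ^ (-g) := by
      rw [← Real.rpow_one_add' hN0.le (by linarith)]; congr 1; ring
    calc _ ≤ 2 * (N ^ (-(g / 2)) * K) + 2 * C * (N * N ^ (-(1 + g))) := by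
          rw [show 2 * N * (C * N ^ (-(1 + g))) = 2 * C * (N * N ^ (-(1 + g))) by ring]
          gcongr
      _ = _ := by rw [e5]; ring
  have hlim : Tendsto (fun N : ℝ => (2 * K) * N ^ (-(g / 2)) + 2 * C * N ^ (-g)) atTop (𝓝 0) := by
    simpa using ((tendsto_rpow_neg_atTop (by linarith : 0 < g / 2)).const_mul (2 * K)).add
      ((tendsto_rpow_neg_atTop hg).const_mul (2 * C))
  have := ge_of_tendsto hlim ((eventually_ge_atTop _).mono hbound)
  exact norm_le_zero_iff.mp this

namespace MellinSymbol

variable {R : ℂ → ℂ} {r γ : ℝ}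

/-- Cauchy's formula for the point `w` outside the loop. Subtracting `k / (s + τ)`, with `k` chosen
to match `R` at `w`, removes the pole of the integrand at `w`. What remains decays faster than
`|s|⁻¹` and is holomorphic to the right of the loop, so its integral vanishes; the subtracted part
is an explicit product of two simple fractions. -/
lemma loopIntegral_div_sub (hR : MellinSymbol R r γ) (hγ : 0 < γ) {ρ w : ℝ} (hρ : r < ρ)
    (hw : ρ < w) :
    loopIntegral (fun s => R s / (w - s)) ρ 1 = 2 * Real.pi * Complex.I * R w := by
  -- This puts the auxiliary pole `-τ` on the slit `(-∞, r]`.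
  set τ : ℝ := |r| + 1 with hτ
  have hτr : 1 ≤ r + τ := by linarith [neg_abs_le r]
  have hwt : (w : ℂ) + τ ≠ 0 := by exact_mod_cast (by linarith : w + τ ≠ 0)
  set k : ℂ := R w * (w + τ) with hk
  set g : ℂ → ℂ := fun s => R s - k / (s + τ) with hg
  have hstau : ∀ s : ℂ, s ∈ slitRegion r → s + τ ≠ 0 := by
    intro s hs h0
    rcases hs with h | h
    · apply h
      simpa using congrArg Complex.im h0
    · have := congrArg Complex.re h0
      simp at this
      linarith
  have hgd : DifferentiableOn ℂ g (slitRegion r) := by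
    refine hR.differentiableOn.sub (DifferentiableOn.div (by fun_prop) (by fun_prop) ?_)
    exact fun s hs => hstau s hs
  have hwmem : (w : ℂ) ∈ slitRegion r := Or.inr (by simpa using hρ.trans hw)
  have hgw : g w = 0 := by
    simp only [hg, hk]
    field_simp
    simp
  -- The divided slope is `g s / (w - s)` with the singularity at `w` already removed.
  set H : ℂ → ℂ := fun s => -dslope g w s with hH
  have hHd : DifferentiableOn ℂ H (slitRegion r) :=
    ((Complex.differentiableOn_dslope ((isOpen_slitRegion r).mem_nhds hwmem)).mpr hgd).neg
  have hHeq : ∀ s : ℂ, s ≠ w → H s = g s / (w - s) := by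
    intro s hs
    simp only [hH]
    rw [dslope_of_ne _ hs, slope_def_field, hgw, sub_zero, ← div_neg, neg_sub]
  obtain ⟨C₁, hC₁0, hC₁⟩ := hR.exists_bound (w + 1) (by linarith)
  -- The correction `k / (s + τ)` decays only like `|s|⁻¹`, however large `γ` is.
  set g' : ℝ := min γ 1 with hg'
  have hg'pos : 0 < g' := by simp [hg', hγ]
  have hle : ∀ s : ℂ, (1 + ‖s‖) ^ (-γ) ≤ (1 + ‖s‖) ^ (-g') := fun s =>
    Real.rpow_le_rpow_of_exponent_le (by linarith [norm_nonneg s])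
      (by linarith [min_le_left γ 1])
  have hle1 : ∀ s : ℂ, (1 + ‖s‖) ^ (-1 : ℝ) ≤ (1 + ‖s‖) ^ (-g') := fun s =>
    Real.rpow_le_rpow_of_exponent_le (by linarith [norm_nonneg s])
      (by linarith [min_le_right γ 1])
  have hHbound : ∀ s : ℂ, (1 ≤ |s.im| ∨ w + 1 ≤ s.re) →
      ‖H s‖ ≤ (2 + |w|) * (C₁ + ‖k‖ * (2 + |τ|)) * (1 + ‖s‖) ^ (-(1 + g')) := by
    intro s hs
    have n1 : 1 ≤ ‖s - w‖ := by
      rcases hs with h | h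
      · exact one_le_norm_sub_of_im h
      · refine le_trans ?_ (Complex.re_le_norm _)
        simp; linarith
    have n2 : 1 ≤ ‖s + τ‖ := by
      rcases hs with h | h
      · exact one_le_norm_add_of_im h
      · refine le_trans ?_ (Complex.re_le_norm _)
        simp; linarith
    have hsw : s ≠ w := by
      rintro rfl
      simp at n1
      linarith
    have m1 := one_add_norm_le_mul_norm_sub n1
    have m2 : 1 + ‖s‖ ≤ (2 + |τ|) * ‖s + τ‖ := by
      have := one_add_norm_le_mul_norm_sub (a := -τ) (s := s) (by simpa using n2)
      simpa using this
    have hpos : 0 < 1 + ‖s‖ := by positivity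
    have hgs : ‖g s‖ ≤ (C₁ + ‖k‖ * (2 + |τ|)) * (1 + ‖s‖) ^ (-g') := by
      refine (norm_sub_le _ _).trans ?_
      have t1 : ‖R s‖ ≤ C₁ * (1 + ‖s‖) ^ (-g') :=
        (hC₁ s hs).trans (mul_le_mul_of_nonneg_left (hle s) hC₁0)
      have t2 : ‖k / (s + τ)‖ ≤ ‖k‖ * (2 + |τ|) * (1 + ‖s‖) ^ (-g') := by
        refine le_trans ?_ (mul_le_mul_of_nonneg_left (hle1 s) (by positivity))
        rw [norm_div, Real.rpow_neg_one, ← div_eq_mul_inv,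
          div_le_div_iff₀ (by positivity) hpos, mul_assoc]
        gcongr
      rw [add_mul]
      exact add_le_add t1 t2
    have e : (1 + ‖s‖) ^ (-(1 + g')) = (1 + ‖s‖) ^ (-g') / (1 + ‖s‖) := by
      rw [neg_add', ← Real.rpow_sub_one hpos.ne']
      congr 1; ring
    rw [hHeq s hsw, norm_div, norm_sub_rev (w : ℂ) s, e, mul_div_assoc',
      div_le_div_iff₀ (by positivity) hpos]
    calc ‖g s‖ * (1 + ‖s‖) ≤ ((C₁ + ‖k‖ * (2 + |τ|)) * (1 + ‖s‖) ^ (-g')) *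
          ((2 + |w|) * ‖s - w‖) := by gcongr
      _ = _ := by ring
  have hzero := loopIntegral_eq_zero hg'pos hHd (by positivity) hHbound hρ
  have hline : ∀ h : ℝ, |h| = 1 →
      IntegrableOn (fun t : ℝ => H ((t : ℂ) + (h : ℂ) * Complex.I)) (Set.Iic ρ) := by
    intro h hh
    have h0 : h ≠ 0 := by rintro rfl; norm_num at hh
    refine (integrableOn_one_add_norm_rpow (k := 1 + g')
      (C := (2 + |w|) * (C₁ + ‖k‖ * (2 + |τ|))) (by linarith) _).mono'
      (continuous_line hHd h0).aestronglyMeasurable (ae_of_all _ fun t => ?_)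
    refine (hHbound _ (Or.inl (by simp [hh]))).trans ?_
    exact mul_le_mul_of_nonneg_left (one_add_norm_rpow_anti (by linarith) t h) (by positivity)
  have hadd := loopIntegral_add_const_mul (F := H)
    (G := fun s : ℂ => 1 / ((s + τ) * (w - s))) k (c := ρ) (h := 1)
    (hline (-1) (by simp)) (hline 1 (by simp))
    ((continuous_vertical hHd hρ).intervalIntegrable _ _)
    (integrableOn_fraction_line (by simp)) (integrableOn_fraction_line (by simp))
    ((continuous_fraction_vertical (by linarith) hw).intervalIntegrable _ _)
  rw [hzero, loopIntegral_fraction (by linarith) hw, zero_add] at hadd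
  rw [show 2 * Real.pi * Complex.I * R w = k * (2 * Real.pi * Complex.I / (w + τ)) by
    rw [hk]; field_simp, ← hadd]
  refine loopIntegral_congr one_ne_zero fun s hs => ?_
  have hsw : s ≠ w := by
    rintro rfl
    rcases hs with h | h
    · simp at h
    · simp at h; linarith
  have h1 : s + τ ≠ 0 := hstau s (hs.imp_right fun h => by rw [h]; exact hρ)
  have h2 : (w : ℂ) - s ≠ 0 := sub_ne_zero.mpr hsw.symm
  rw [hHeq s hsw]
  simp only [hg]
  field_simp
  ring

/-! ### The Mellin transform of the loop kernel -/

/-- Fubini for one side of the loop. -/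
lemma integral_exp_side {α : Type*} [TopologicalSpace α] [SecondCountableTopology α]
    [MeasurableSpace α] [OpensMeasurableSpace α] {μ : Measure α} [SFinite μ] {f σ : α → ℂ}
    {w : ℝ} (hf : Continuous f) (hσ : Continuous σ)
    (hlt : ∀ᵐ a ∂μ, (σ a).re < w)
    (hint : Integrable (fun a => ‖f a‖ / (w - (σ a).re)) μ) :
    IntegrableOn (fun y : ℝ => (∫ a, f a * Complex.exp (σ a * y) ∂μ) * Complex.exp (-w * y))
        (Set.Ioi 0) ∧
      ∫ y in Set.Ioi (0 : ℝ), (∫ a, f a * Complex.exp (σ a * y) ∂μ) * Complex.exp (-w * y) =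
        ∫ a, f a / (w - σ a) ∂μ := by
  have hprod : Integrable (fun q : ℝ × α => f q.2 * Complex.exp ((σ q.2 - w) * q.1))
      ((volume.restrict (Set.Ioi 0)).prod μ) := by
    rw [integrable_prod_iff' (Continuous.aestronglyMeasurable (by fun_prop))]
    constructor
    · filter_upwards [hlt] with a ha
      exact (integrableOn_exp_mul_complex_Ioi (a := σ a - w) (by simpa using ha) 0).const_mul (f a)
    · refine hint.congr ?_
      filter_upwards [hlt] with a ha
      simp only [norm_mul]
      rw [integral_const_mul]
      have e : ∀ y : ℝ, ‖Complex.exp ((σ a - w) * y)‖ = Real.exp (((σ a).re - w) * y) := by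
        intro y
        rw [norm_exp_mul_real]; simp [mul_comm]
      simp only [e]
      rw [integral_exp_mul_Ioi (by linarith), mul_zero, Real.exp_zero, neg_div, ← div_neg, neg_sub,
        mul_one_div]
  have hexp : ∀ (a : α) (y : ℝ), f a * Complex.exp (σ a * y) * Complex.exp (-w * y) =
      f a * Complex.exp ((σ a - w) * y) := by
    intro a y
    rw [mul_assoc, ← Complex.exp_add]; congr 2; ring
  have hrew : ∀ y : ℝ, (∫ a, f a * Complex.exp (σ a * y) ∂μ) * Complex.exp (-w * y) =
      ∫ a, f a * Complex.exp ((σ a - w) * y) ∂μ := by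
    intro y
    rw [← integral_mul_const]
    simp only [hexp]
  simp only [hrew]
  refine ⟨hprod.integral_prod_left, ?_⟩
  rw [integral_integral_swap hprod]
  refine integral_congr_ae ?_
  filter_upwards [hlt] with a ha
  rw [integral_const_mul, integral_exp_mul_complex_Ioi (by simpa using ha)]
  have : (σ a - w) ≠ 0 := by
    intro h0
    have := congrArg Complex.re h0
    simp at this
    linarith
  have h2 : (w : ℂ) - σ a ≠ 0 := by rwa [← neg_sub, neg_ne_zero]
  simp only [Complex.ofReal_zero, mul_zero, Complex.exp_zero]
  rw [← neg_sub (w : ℂ) (σ a)]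
  field_simp

/-- The Mellin transform of the loop kernel, written in the variable `y = -log x`. -/
lemma integral_loopKernel (hR : MellinSymbol R r γ) (hγ : 0 < γ) {c w : ℝ} (hc : r < c)
    (hw : r < w) :
    IntegrableOn (fun y : ℝ => loopKernel R c y * Complex.exp (-w * y)) (Set.Ioi 0) ∧
      ∫ y in Set.Ioi (0 : ℝ), loopKernel R c y * Complex.exp (-w * y) = R w := by
  -- With the vertex moved to `ρ < w` the real part stays below `w` on the whole loop, as the
  -- integral of `e^((s - w) y)` over `y > 0` requires.
  obtain ⟨ρ, hρ, hρw⟩ := exists_between hw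
  obtain ⟨C, hC0, hC⟩ := hR.exists_bound ρ hρ
  have hkernel : ∀ y ∈ Set.Ioi (0 : ℝ), loopKernel R c y * Complex.exp (-w * y) =
      loopKernel R ρ y * Complex.exp (-w * y) := by
    intro y hy
    obtain ⟨φ, hφ⟩ := hR.exp_admissible hγ hy
    rw [loopKernel, loopKernel, hφ.loopIntegral_vertex hc hρ le_rfl]
  have hside : ∀ h : ℝ, |h| = 1 → IntegrableOn (fun t : ℝ =>
      ‖R ((t : ℂ) + h * Complex.I)‖ / (w - ((t : ℂ) + h * Complex.I).re)) (Set.Iic ρ) := by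
    intro h hh
    have h0 : h ≠ 0 := by rintro rfl; norm_num at hh
    -- With this `A`, `1 + |t| ≤ A (w - t)` for `t ≤ ρ`. The denominator from the `y`-integration
    -- thus adds one power of decay, and Fubini applies for every `γ > 0`.
    set A : ℝ := (1 + |w|) / (w - ρ) + 1 with hA
    have hwρ : 0 < w - ρ := by linarith
    refine (integrableOn_one_add_norm_rpow (k := 1 + γ) (C := C * A)
      (by linarith) _).mono' ?_ ?_
    · refine ContinuousOn.aestronglyMeasurable ?_ measurableSet_Iic
      refine ContinuousOn.div
        (continuous_line hR.differentiableOn h0).norm.continuousOn (by fun_prop) fun t ht => ?_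
      have : t ≤ ρ := ht
      simp
      linarith
    · refine (ae_restrict_iff' measurableSet_Iic).mpr (ae_of_all _ fun t ht => ?_)
      have ht' : t ≤ ρ := ht
      have hwt : 0 < w - t := by linarith
      have b1 := (hC ((t : ℂ) + h * Complex.I) (Or.inl (by simp [hh]))).trans
        (mul_le_mul_of_nonneg_left (one_add_norm_rpow_anti hγ.le t h) hC0)
      have b2 : 1 + ‖t‖ ≤ A * (w - t) := by
        have u1 : |t| ≤ |w| + (w - t) := by
          have := abs_sub_abs_le_abs_sub t w
          rw [abs_sub_comm, abs_of_pos hwt] at this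
          linarith
        have u2 : 1 + |w| ≤ (1 + |w|) / (w - ρ) * (w - t) := by
          rw [div_mul_eq_mul_div, le_div_iff₀ hwρ]
          gcongr
        rw [Real.norm_eq_abs, hA]
        nlinarith
      have e : (1 + ‖t‖) ^ (-(1 + γ)) = (1 + ‖t‖) ^ (-γ) / (1 + ‖t‖) := by
        rw [neg_add', ← Real.rpow_sub_one (by positivity)]
        congr 1; ring
      have hre : ((t : ℂ) + h * Complex.I).re = t := by simp
      rw [hre, Real.norm_of_nonneg (div_nonneg (norm_nonneg _) hwt.le), e, mul_div_assoc',
        div_le_div_iff₀ hwt (by positivity)]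
      calc ‖R ((t : ℂ) + h * Complex.I)‖ * (1 + ‖t‖)
          ≤ (C * (1 + ‖t‖) ^ (-γ)) * (A * (w - t)) := by gcongr
        _ = _ := by ring
  have hlt : ∀ h : ℝ, ∀ᵐ t : ℝ ∂(volume.restrict (Set.Iic ρ)),
      ((t : ℂ) + (h : ℂ) * Complex.I).re < w := fun h =>
    (ae_restrict_iff' measurableSet_Iic).mpr (ae_of_all _ fun t ht => by
      simpa using (Set.mem_Iic.mp ht).trans_lt hρw)
  obtain ⟨i1, v1⟩ := integral_exp_side
    (continuous_line hR.differentiableOn (h := -1) (by norm_num)) (by fun_prop) (hlt (-1))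
    (hside (-1) (by simp))
  obtain ⟨i2, v2⟩ := integral_exp_side
    (continuous_line hR.differentiableOn (h := 1) (by norm_num)) (by fun_prop) (hlt 1)
    (hside 1 (by simp))
  have hvc := continuous_vertical hR.differentiableOn hρ
  have hlt3 : ∀ᵐ t : ℝ ∂(volume.restrict (Set.Ioc (-1 : ℝ) 1)),
      ((ρ : ℂ) + (t : ℂ) * Complex.I).re < w := ae_of_all _ fun t => by simpa using hρw
  have hside3 : Integrable (fun t : ℝ => ‖R ((ρ : ℂ) + (t : ℂ) * Complex.I)‖ /
      (w - ((ρ : ℂ) + (t : ℂ) * Complex.I).re)) (volume.restrict (Set.Ioc (-1 : ℝ) 1)) := by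
    refine Continuous.integrableOn_Ioc (hvc.norm.div (by fun_prop) fun t => ?_)
    simp
    linarith
  obtain ⟨i3, v3⟩ := integral_exp_side hvc (by fun_prop) hlt3 hside3
  have hsplit : ∀ y : ℝ, loopKernel R ρ y * Complex.exp (-w * y) =
      1 / (2 * Real.pi * Complex.I) *
      ((∫ t in Set.Iic ρ, R ((t : ℂ) + ((-1 : ℝ) : ℂ) * Complex.I) *
          Complex.exp (((t : ℂ) + ((-1 : ℝ) : ℂ) * Complex.I) * y)) * Complex.exp (-w * y) +
        Complex.I * ((∫ t in Set.Ioc (-1 : ℝ) 1, R ((ρ : ℂ) + (t : ℂ) * Complex.I) *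
          Complex.exp (((ρ : ℂ) + (t : ℂ) * Complex.I) * y)) * Complex.exp (-w * y)) -
        (∫ t in Set.Iic ρ, R ((t : ℂ) + ((1 : ℝ) : ℂ) * Complex.I) *
          Complex.exp (((t : ℂ) + ((1 : ℝ) : ℂ) * Complex.I) * y)) * Complex.exp (-w * y)) := by
    intro y
    rw [loopKernel, loopIntegral, intervalIntegral.integral_of_le (by norm_num)]
    ring
  have hres := hR.loopIntegral_div_sub hγ hρ hρw
  constructor
  · rw [integrableOn_congr_fun hkernel measurableSet_Ioi]
    simp only [hsplit]
    exact ((i1.add (i3.const_mul _)).sub i2).const_mul _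
  · rw [setIntegral_congr_fun measurableSet_Ioi hkernel]
    simp only [hsplit]
    have i13 := i1.add (i3.const_mul Complex.I)
    simp only [Pi.add_def] at i13
    rw [integral_const_mul, integral_sub i13 i2, integral_add i1 (i3.const_mul _), integral_const_mul, v1, v2, v3,
      ← intervalIntegral.integral_of_le (by norm_num)]
    rw [loopIntegral] at hres
    rw [hres]
    have := Real.pi_ne_zero
    field_simp

end MellinSymbol

end

/-! ### Gamma quotients as Mellin symbols -/

/-- `Γ(b_1 + s) ⋯ Γ(b_q + s) / (Γ(a_1 + s) ⋯ Γ(a_p + s))`. -/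
def gammaRatio (as bs : List ℝ) (s : ℂ) : ℂ :=
  (bs.map fun β : ℝ => Complex.Gamma ((β : ℂ) + s)).prod *
    ((as.map fun α : ℝ => Complex.Gamma ((α : ℂ) + s)).prod)⁻¹

open Classical in
/-- The number of `x` in the list for which `Γ(x + s)` has a pole at `s`. -/
def poleCount (l : List ℝ) (s : ℂ) : ℕ := l.countP fun x : ℝ => ∃ n : ℕ, (x : ℂ) + s = -n

lemma poleCount_cons (x : ℝ) (l : List ℝ) (s : ℂ) [Decidable (∃ n : ℕ, (x : ℂ) + s = -n)] :
    poleCount (x :: l) s = poleCount l s + if ∃ n : ℕ, (x : ℂ) + s = -n then 1 else 0 := by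
  classical
  simp [poleCount, List.countP_cons]

lemma analyticAt_Gamma {z : ℂ} (hz : ∀ n : ℕ, z ≠ -n) : AnalyticAt ℂ Complex.Gamma z := by
  have h := (Complex.differentiable_one_div_Gamma.analyticAt z).inv
    (inv_ne_zero (Complex.Gamma_ne_zero hz))
  simpa [Pi.inv_def] using h

lemma analyticAt_prod_Gamma {bs : List ℝ} {s : ℂ} (h : ∀ β ∈ bs, ∀ n : ℕ, (β : ℂ) + s ≠ -n) :
    AnalyticAt ℂ (fun s => (bs.map fun β : ℝ => Complex.Gamma ((β : ℂ) + s)).prod) s := by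
  induction bs with
  | nil => simpa using analyticAt_const
  | cons β bs ih =>
    simp only [List.map_cons, List.prod_cons]
    refine AnalyticAt.mul ?_ (ih fun β hβ => h β (List.mem_cons_of_mem _ hβ))
    exact (analyticAt_Gamma (h β List.mem_cons_self)).comp (f := fun s => (β : ℂ) + s)
      (analyticAt_const.add analyticAt_id)

/-- The values `Γ(-n) = 0` and `0⁻¹ = 0` agree with the zeros of the entire function `1/Γ`, so the
denominator needs no restriction on `s`. -/
lemma analyticAt_prod_Gamma_inv (as : List ℝ) (s : ℂ) :
    AnalyticAt ℂ (fun s => ((as.map fun α : ℝ => Complex.Gamma ((α : ℂ) + s)).prod)⁻¹) s := by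
  induction as with
  | nil => simpa using analyticAt_const
  | cons α as ih =>
    simp only [List.map_cons, List.prod_cons, mul_inv]
    refine AnalyticAt.mul ?_ ih
    exact (Complex.differentiable_one_div_Gamma.analyticAt ((α : ℂ) + s)).comp
      (f := fun s => (α : ℂ) + s) (analyticAt_const.add analyticAt_id)

lemma analyticAt_gammaRatio {as bs : List ℝ} {s : ℂ} (h : ∀ β ∈ bs, ∀ n : ℕ, (β : ℂ) + s ≠ -n) :
    AnalyticAt ℂ (gammaRatio as bs) s :=
  (analyticAt_prod_Gamma h).mul (analyticAt_prod_Gamma_inv as s)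

lemma ne_neg_nat_of_im_ne_zero {β : ℝ} {s : ℂ} (h : s.im ≠ 0) (n : ℕ) : (β : ℂ) + s ≠ -n := by
  intro h0
  apply h
  simpa using congrArg Complex.im h0

/-- The functional equation `Γ(z) = Γ(z + 1) / z` carries the simple pole from `-n` to `-(n + 1)`.
-/
lemma exists_tendsto_mul_Gamma (n : ℕ) :
    ∃ c, Tendsto (fun z : ℂ => (z + n) * Complex.Gamma z) (𝓝[≠] (-n : ℂ)) (𝓝 c) := by
  induction n with
  | zero => exact ⟨1, by simpa using Complex.tendsto_self_mul_Gamma_nhds_zero⟩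
  | succ n ih =>
    obtain ⟨c, hc⟩ := ih
    refine ⟨c / (-(n + 1 : ℕ) : ℂ), ?_⟩
    have hne : (-(n + 1 : ℕ) : ℂ) ≠ 0 := by
      rw [neg_ne_zero]; exact_mod_cast n.succ_ne_zero
    have hshift : Tendsto (fun z : ℂ => z + 1) (𝓝[≠] (-(n + 1 : ℕ) : ℂ)) (𝓝[≠] (-n : ℂ)) := by
      refine tendsto_nhdsWithin_iff.mpr ⟨?_, ?_⟩
      · have : Tendsto (fun z : ℂ => z + 1) (𝓝 (-(n + 1 : ℕ) : ℂ)) (𝓝 (-(n + 1 : ℕ) + 1)) :=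
          (continuous_add_const 1).tendsto _
        rw [show (-(n + 1 : ℕ) : ℂ) + 1 = -n by push_cast; ring] at this
        exact this.mono_left nhdsWithin_le_nhds
      · filter_upwards [self_mem_nhdsWithin] with z hz h0
        apply hz
        rw [Set.mem_singleton_iff] at h0 ⊢
        push_cast
        linear_combination h0
    have hid : Tendsto (fun z : ℂ => z) (𝓝[≠] (-(n + 1 : ℕ) : ℂ)) (𝓝 (-(n + 1 : ℕ) : ℂ)) :=
      tendsto_id.mono_left nhdsWithin_le_nhds
    refine ((hc.comp hshift).div hid hne).congr' ?_
    filter_upwards [hid.eventually_ne hne] with z hz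
    change (z + 1 + n) * Complex.Gamma (z + 1) / z = _
    rw [Complex.Gamma_add_one z hz]
    field_simp
    push_cast
    ring

lemma meromorphicAt_Gamma_add (β : ℝ) (s : ℂ) :
    MeromorphicAt (fun s : ℂ => Complex.Gamma ((β : ℂ) + s)) s := by
  have h := (Complex.differentiable_one_div_Gamma.analyticAt ((β : ℂ) + s)).comp
      (f := fun s => (β : ℂ) + s) (analyticAt_const.add analyticAt_id)
  have := h.meromorphicAt.inv
  simpa [Function.comp_def, Pi.inv_def] using this

lemma neg_one_le_order_Gamma (β : ℝ) (s : ℂ) {n : ℕ} (h : (β : ℂ) + s = -n) :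
    (-1 : ℤ) ≤ meromorphicOrderAt (fun s : ℂ => Complex.Gamma ((β : ℂ) + s)) s := by
  obtain ⟨c, hc⟩ := exists_tendsto_mul_Gamma n
  have hshift : Tendsto (fun z : ℂ => (β : ℂ) + z) (𝓝[≠] s) (𝓝[≠] (-n : ℂ)) := by
    refine tendsto_nhdsWithin_iff.mpr ⟨?_, ?_⟩
    · have : Tendsto (fun z : ℂ => (β : ℂ) + z) (𝓝 s) (𝓝 ((β : ℂ) + s)) :=
        (continuous_const_add _).tendsto _
      rw [h] at this
      exact this.mono_left nhdsWithin_le_nhds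
    · filter_upwards [self_mem_nhdsWithin] with z hz h0
      apply hz
      rw [Set.mem_singleton_iff] at h0 ⊢
      linear_combination h0 - h
  have hlim := hc.comp hshift
  have e : ((fun z : ℂ => (z + n) * Complex.Gamma z) ∘ fun z : ℂ => (β : ℂ) + z) =
      (fun z => z - s) * fun z : ℂ => Complex.Gamma ((β : ℂ) + z) := by
    ext z
    simp only [Function.comp, Pi.mul_apply]
    congr 1
    linear_combination h
  rw [e] at hlim
  have hm1 : MeromorphicAt (fun z : ℂ => z - s) s := by fun_prop
  have hm2 := meromorphicAt_Gamma_add β s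
  have hnn := (tendsto_nhds_iff_meromorphicOrderAt_nonneg (hm1.mul hm2)).mp ⟨c, hlim⟩
  rw [meromorphicOrderAt_mul hm1 hm2] at hnn
  have h1 : meromorphicOrderAt (fun z : ℂ => z - s) s = 1 := meromorphicOrderAt_id_sub_const
  rw [h1] at hnn
  cases ho : meromorphicOrderAt (fun s : ℂ => Complex.Gamma ((β : ℂ) + s)) s with
  | top => exact le_top
  | coe k =>
    rw [ho] at hnn
    have : (0 : ℤ) ≤ 1 + k := by exact_mod_cast hnn
    exact_mod_cast (by omega : (-1 : ℤ) ≤ k)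

lemma one_le_order_Gamma_inv (α : ℝ) (s : ℂ) {n : ℕ} (h : (α : ℂ) + s = -n) :
    (1 : ℤ) ≤ meromorphicOrderAt (fun s : ℂ => (Complex.Gamma ((α : ℂ) + s))⁻¹) s := by
  have ha := (Complex.differentiable_one_div_Gamma.analyticAt ((α : ℂ) + s)).comp
      (f := fun s => (α : ℂ) + s) (analyticAt_const.add analyticAt_id)
  have hlim : Tendsto (fun s : ℂ => (Complex.Gamma ((α : ℂ) + s))⁻¹) (𝓝[≠] s) (𝓝 0) := by
    have := ha.continuousAt.tendsto
    simp only [Function.comp_def] at this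
    rw [h, Complex.Gamma_neg_nat_eq_zero, inv_zero] at this
    exact this.mono_left nhdsWithin_le_nhds
  have hpos := (tendsto_zero_iff_meromorphicOrderAt_pos
    (by simpa [Function.comp_def] using ha.meromorphicAt)).mp hlim
  cases ho : meromorphicOrderAt (fun s : ℂ => (Complex.Gamma ((α : ℂ) + s))⁻¹) s with
  | top => exact le_top
  | coe k =>
    rw [ho] at hpos
    have : (0 : ℤ) < k := by exact_mod_cast hpos
    exact_mod_cast (by omega : (1 : ℤ) ≤ k)

/-- Orders add over the factors, and a factor contributes at least `-1` at a pole and at least `0`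
elsewhere. With `order_prod_Gamma_inv` this shows that counting parameters decides whether a
singularity of the quotient is removable. -/
lemma order_prod_Gamma (bs : List ℝ) (s : ℂ) :
    MeromorphicAt (fun s => (bs.map fun β : ℝ => Complex.Gamma ((β : ℂ) + s)).prod) s ∧
    ((-(poleCount bs s : ℤ) : ℤ) : WithTop ℤ) ≤
      meromorphicOrderAt (fun s => (bs.map fun β : ℝ => Complex.Gamma ((β : ℂ) + s)).prod) s := by
  classical
  induction bs with
  | nil =>
    refine ⟨by simp, ?_⟩
    have : AnalyticAt ℂ (fun _ : ℂ => (1 : ℂ)) s := analyticAt_const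
    simpa [poleCount] using this.meromorphicOrderAt_nonneg
  | cons β bs ih =>
    simp only [List.map_cons, List.prod_cons]
    have hm := meromorphicAt_Gamma_add β s
    refine ⟨hm.mul ih.1, ?_⟩
    rw [fun_meromorphicOrderAt_mul hm ih.1, poleCount_cons]
    split_ifs with h
    · obtain ⟨n, hn⟩ := h
      have := add_le_add (neg_one_le_order_Gamma β s hn) ih.2
      refine le_trans (le_of_eq ?_) this
      rw [← WithTop.coe_add]
      congr 1
      push_cast
      ring
    · push Not at h
      have ha : AnalyticAt ℂ (fun s : ℂ => Complex.Gamma ((β : ℂ) + s)) s :=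
        (analyticAt_Gamma h).comp (f := fun s => (β : ℂ) + s)
          (analyticAt_const.add analyticAt_id)
      have := add_le_add ha.meromorphicOrderAt_nonneg ih.2
      rwa [zero_add] at this

lemma order_prod_Gamma_inv (as : List ℝ) (s : ℂ) :
    ((poleCount as s : ℤ) : WithTop ℤ) ≤
      meromorphicOrderAt (fun s => ((as.map fun α : ℝ => Complex.Gamma ((α : ℂ) + s)).prod)⁻¹) s := by
  classical
  induction as with
  | nil =>
    have : AnalyticAt ℂ (fun _ : ℂ => (1 : ℂ)) s := analyticAt_const
    simpa [poleCount] using this.meromorphicOrderAt_nonneg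
  | cons α as ih =>
    simp only [List.map_cons, List.prod_cons, mul_inv]
    have ha : AnalyticAt ℂ (fun s : ℂ => (Complex.Gamma ((α : ℂ) + s))⁻¹) s :=
      (Complex.differentiable_one_div_Gamma.analyticAt ((α : ℂ) + s)).comp
        (f := fun s => (α : ℂ) + s) (analyticAt_const.add analyticAt_id)
    rw [fun_meromorphicOrderAt_mul ha.meromorphicAt (analyticAt_prod_Gamma_inv as s).meromorphicAt,
      poleCount_cons]
    split_ifs with h
    · obtain ⟨n, hn⟩ := h
      have := add_le_add (one_le_order_Gamma_inv α s hn) ih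
      refine le_trans (le_of_eq ?_) this
      rw [← WithTop.coe_add]
      congr 1
      push_cast
      ring
    · have := add_le_add ha.meromorphicOrderAt_nonneg ih
      rwa [zero_add] at this

lemma meromorphicAt_gammaRatio (as bs : List ℝ) (s : ℂ) : MeromorphicAt (gammaRatio as bs) s :=
  (order_prod_Gamma bs s).1.mul (analyticAt_prod_Gamma_inv as s).meromorphicAt

lemma order_gammaRatio_nonneg {as bs : List ℝ} {s : ℂ} (h : poleCount bs s ≤ poleCount as s) :
    0 ≤ meromorphicOrderAt (gammaRatio as bs) s := by
  have hm := order_prod_Gamma bs s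
  have hi := analyticAt_prod_Gamma_inv as s
  have e := fun_meromorphicOrderAt_mul hm.1 hi.meromorphicAt
  change 0 ≤ meromorphicOrderAt (fun s => (bs.map fun β : ℝ => Complex.Gamma ((β : ℂ) + s)).prod *
    ((as.map fun α : ℝ => Complex.Gamma ((α : ℂ) + s)).prod)⁻¹) s
  rw [e]
  refine le_trans ?_ (add_le_add hm.2 (order_prod_Gamma_inv as s))
  rw [← WithTop.coe_add]
  exact_mod_cast (by omega : (0 : ℤ) ≤ -(poleCount bs s : ℤ) + poleCount as s)

lemma exists_norm_gammaRatio_le {as bs : List ℝ} (hlen : as.length = bs.length) {c : ℝ}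
    (ha : ∀ α ∈ as, 0 < α + c) (hb : ∀ β ∈ bs, 0 < β + c) :
    ∃ C : ℝ, 0 ≤ C ∧ ∀ s : ℂ, (1 ≤ |s.im| ∨ c ≤ s.re) →
      ‖gammaRatio as bs s‖ ≤ C * (1 + ‖s‖) ^ (-(as.sum - bs.sum)) := by
  induction as generalizing bs with
  | nil =>
    obtain rfl : bs = [] := List.length_eq_zero_iff.mp hlen.symm
    exact ⟨1, zero_le_one, fun s _ => by simp [gammaRatio]⟩
  | cons α as ih =>
    cases bs with
    | nil => simp at hlen
    | cons β bs =>
      obtain ⟨C₁, hC₁, h₁⟩ := ih (bs := bs) (by simpa using hlen)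
        (fun α hα => ha α (List.mem_cons_of_mem _ hα))
        (fun β hβ => hb β (List.mem_cons_of_mem _ hβ))
      obtain ⟨C₂, hC₂, h₂⟩ := exists_norm_Gamma_mul_inv_le α β (ha α List.mem_cons_self)
        (hb β List.mem_cons_self)
      refine ⟨C₂ * C₁, by positivity, fun s hs => ?_⟩
      have e : gammaRatio (α :: as) (β :: bs) s =
          (Complex.Gamma (β + s) * (Complex.Gamma (α + s))⁻¹) * gammaRatio as bs s := by
        simp only [gammaRatio, List.map_cons, List.prod_cons, mul_inv]
        ring
      have e2 : (1 + ‖s‖) ^ (-((α :: as).sum - (β :: bs).sum)) =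
          (1 + ‖s‖) ^ (β - α) * (1 + ‖s‖) ^ (-(as.sum - bs.sum)) := by
        rw [← Real.rpow_add (by positivity)]
        congr 1
        simp only [List.sum_cons]
        ring
      rw [e, e2, norm_mul]
      calc _ ≤ (C₂ * (1 + ‖s‖) ^ (β - α)) * (C₁ * (1 + ‖s‖) ^ (-(as.sum - bs.sum))) :=
            mul_le_mul (h₂ s hs) (h₁ s hs) (norm_nonneg _) (by positivity)
        _ = _ := by ring

lemma exists_forall_mem_pos_add (l : List ℝ) : ∃ c₀ : ℝ, ∀ c ≥ c₀, ∀ x ∈ l, 0 < x + c := by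
  induction l with
  | nil => exact ⟨0, by simp⟩
  | cons y l ih =>
    obtain ⟨c₀, h⟩ := ih
    refine ⟨max c₀ (1 - y), fun c hc x hx => ?_⟩
    rcases List.mem_cons.mp hx with rfl | hx
    · have := (le_max_right _ _).trans hc
      linarith
    · exact h c ((le_max_left _ _).trans hc) x hx

/-- If the Gamma quotient has no poles in `(r, ∞)`, then, after removing the removable
singularities, it is a Mellin symbol. -/
lemma exists_mellinSymbol {as bs : List ℝ} (hlen : as.length = bs.length) {r : ℝ}
    (hpole : ∀ x : ℝ, r < x → poleCount bs x ≤ poleCount as x) :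
    ∃ R : ℂ → ℂ, MellinSymbol R r (as.sum - bs.sum) ∧
      ∀ s : ℂ, (∀ β ∈ bs, ∀ n : ℕ, (β : ℂ) + s ≠ -n) → R s = gammaRatio as bs s := by
  set f := gammaRatio as bs with hf
  have hm : MeromorphicOn f Set.univ := fun s _ => meromorphicAt_gammaRatio as bs s
  -- At a cancelled pole `f` has a conventional value unrelated to its limit. The meromorphic normal
  -- form puts the limit there and agrees with `f` where all the Gamma factors of the numerator are
  -- regular.
  set R := toMeromorphicNFOn f Set.univ with hR
  have heq : ∀ s : ℂ, (∀ β ∈ bs, ∀ n : ℕ, (β : ℂ) + s ≠ -n) → R s = f s := by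
    intro s hs
    rw [hR, toMeromorphicNFOn_eq_toMeromorphicNFAt hm (Set.mem_univ s),
      toMeromorphicNFAt_eq_self.mpr (analyticAt_gammaRatio hs).meromorphicNFAt]
  have hdiff : DifferentiableOn ℂ R (slitRegion r) := by
    intro s hs
    have hnf : MeromorphicNFAt R s := meromorphicNFOn_toMeromorphicNFOn f Set.univ (Set.mem_univ s)
    refine (AnalyticAt.differentiableAt ?_).differentiableWithinAt
    rw [← hnf.meromorphicOrderAt_nonneg_iff_analyticAt, hR,
      meromorphicOrderAt_toMeromorphicNFOn hm (Set.mem_univ s)]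
    by_cases him : s.im = 0
    · have hre : r < s.re := hs.resolve_left (not_not.mpr him)
      have : s = (s.re : ℂ) := Complex.ext rfl (by simpa using him)
      rw [this]
      exact order_gammaRatio_nonneg (hpole _ hre)
    · exact (analyticAt_gammaRatio fun β _ => ne_neg_nat_of_im_ne_zero him).meromorphicOrderAt_nonneg
  refine ⟨R, ⟨hdiff, fun c hc => ?_⟩, heq⟩
  obtain ⟨c₁, h₁⟩ := exists_forall_mem_pos_add as
  obtain ⟨c₂, h₂⟩ := exists_forall_mem_pos_add bs
  set c₀ := max c₁ c₂ with hc₀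
  obtain ⟨C, hC0, hC⟩ := exists_norm_gammaRatio_le hlen (h₁ c₀ (le_max_left _ _))
    (h₂ c₀ (le_max_right _ _))
  have hfar : ∀ s : ℂ, (1 ≤ |s.im| ∨ c₀ ≤ s.re) →
      ‖R s‖ ≤ C * (1 + ‖s‖) ^ (-(as.sum - bs.sum)) := by
    intro s hs
    rw [heq s fun β hβ n h0 => ?_]
    · exact hC s hs
    · rcases hs with h | h
      · refine ne_neg_nat_of_im_ne_zero ?_ n h0
        intro h'
        rw [h'] at h
        norm_num at h
      · have := congrArg Complex.re h0
        simp only [Complex.add_re, Complex.ofReal_re, Complex.neg_re, Complex.natCast_re] at this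
        have hp := h₂ c₀ (le_max_right _ _) β hβ
        have : (0 : ℝ) ≤ n := n.cast_nonneg
        linarith
  -- Between `c` and `c₀` the Gamma factors may have cancelled poles, so the growth estimate is not
  -- available. In the strip `|Im s| ≤ 1` this region is compact and continuity of `R` gives the
  -- bound.
  have hcpt : IsCompact (Set.Icc c c₀ ×ℂ Set.Icc (-1 : ℝ) 1) := isCompact_Icc.reProdIm isCompact_Icc
  have hcont : ContinuousOn (fun s => ‖R s‖ * (1 + ‖s‖) ^ (as.sum - bs.sum))
      (Set.Icc c c₀ ×ℂ Set.Icc (-1 : ℝ) 1) := by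
    refine ContinuousOn.mul (hdiff.continuousOn.mono fun s hs => Or.inr ?_).norm ?_
    · have := (Complex.mem_reProdIm.mp hs).1.1
      linarith
    · refine ContinuousOn.rpow_const (by fun_prop) fun s _ => Or.inl ?_
      positivity
  obtain ⟨B, hB⟩ := hcpt.exists_bound_of_continuousOn hcont
  refine ⟨max C B, hC0.trans (le_max_left _ _), fun s hs => ?_⟩
  have hpos : 0 < 1 + ‖s‖ := by positivity
  by_cases hs' : 1 ≤ |s.im| ∨ c₀ ≤ s.re
  · refine (hfar s hs').trans ?_
    gcongr
    exact le_max_left _ _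
  · push Not at hs'
    have hre : c ≤ s.re := hs.resolve_left (not_le.mpr hs'.1)
    have hmem : s ∈ Set.Icc c c₀ ×ℂ Set.Icc (-1 : ℝ) 1 :=
      Complex.mem_reProdIm.mpr ⟨⟨hre, hs'.2.le⟩, (abs_le.mp hs'.1.le)⟩
    have h := hB s hmem
    rw [Real.norm_of_nonneg (by positivity)] at h
    rw [Real.rpow_neg hpos.le, ← div_eq_mul_inv, le_div_iff₀ (by positivity)]
    exact h.trans (le_max_right _ _)

lemma loopVertex_add_pos {bs : List ℝ} {β : ℝ} (hβ : β ∈ bs) : 0 < β + loopVertex bs := by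
  have h : |β| ≤ (bs.map fun β => |β|).sum :=
    List.single_le_sum (by simp) _ (List.mem_map_of_mem hβ)
  rw [loopVertex]
  linarith [neg_abs_le β]

lemma one_le_loopVertex (bs : List ℝ) : 1 ≤ loopVertex bs := by
  have h : 0 ≤ (bs.map fun β => |β|).sum := List.sum_nonneg (by simp)
  rw [loopVertex]
  linarith

/-- In `meijerIntegrand` the coercion to `ℂ` is elaborated on the whole list, through the list
monad. This turns it back into a map over the real parameters. -/
lemma map_bind_pure_ofReal (l : List ℝ) (f : ℂ → ℂ) :
    (do let x ← l; pure (x : ℂ) : List ℂ).map f = l.map fun x : ℝ => f x := by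
  induction l with
  | nil => rfl
  | cons x l ih => simpa using ih

lemma meijerIntegrand_eq (as bs : List ℝ) (x : ℝ) (s : ℂ) :
    meijerIntegrand as bs x s = gammaRatio as bs s * (x : ℂ) ^ (-s) := by
  rw [meijerIntegrand, gammaRatio, div_eq_mul_inv, map_bind_pure_ofReal, map_bind_pure_ofReal]

/-- With `y = -log x` the power `x^(-s)` becomes `e^(sy)`. The vertex lies to the right of all poles
of the numerator, so the regularized `R` equals the Gamma quotient on the loop. -/
lemma meijerG_eq_loopKernel {as bs : List ℝ} {R : ℂ → ℂ}
    (hR : ∀ s : ℂ, (∀ β ∈ bs, ∀ n : ℕ, (β : ℂ) + s ≠ -n) → R s = gammaRatio as bs s)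
    {x : ℝ} (hx : 0 < x) :
    meijerG as bs x = loopKernel R (loopVertex bs) (-Real.log x) := by
  have hint : meijerG as bs x = 1 / (2 * Real.pi * Complex.I) *
      loopIntegral (meijerIntegrand as bs x) (loopVertex bs) 1 := by
    simp only [meijerG, loopIntegral, Complex.ofReal_neg, Complex.ofReal_one, neg_mul, one_mul,
      sub_eq_add_neg]
  rw [hint, loopKernel]
  congr 1
  refine loopIntegral_congr one_ne_zero fun s hs => ?_
  rw [hR s, meijerIntegrand_eq]
  · congr 1
    rw [Complex.cpow_def_of_ne_zero (by exact_mod_cast hx.ne'), ← Complex.ofReal_log hx.le]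
    congr 1
    push_cast
    ring
  · intro β hβ n h0
    by_cases him : s.im = 0
    · have hre := hs.resolve_left (not_not.mpr him)
      have := congrArg Complex.re h0
      simp only [Complex.add_re, Complex.ofReal_re, Complex.neg_re, Complex.natCast_re, hre] at this
      have hp := loopVertex_add_pos hβ
      have : (0 : ℝ) ≤ n := n.cast_nonneg
      linarith
    · exact ne_neg_nat_of_im_ne_zero him n h0

/-! ### Moments of the Meijer function -/

lemma image_exp_neg_Ioi : (fun y : ℝ => Real.exp (-y)) '' Set.Ioi 0 = Set.Ioo 0 1 := by
  ext x
  constructor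
  · rintro ⟨y, hy, rfl⟩
    exact ⟨Real.exp_pos _, by simpa using hy⟩
  · rintro ⟨h0, h1⟩
    exact ⟨-Real.log x, by simpa using Real.log_neg h0 h1, by simp [Real.exp_log h0]⟩

lemma hasDerivWithinAt_exp_neg (y : ℝ) (s : Set ℝ) :
    HasDerivWithinAt (fun y : ℝ => Real.exp (-y)) (-Real.exp (-y)) s y := by
  have h := (Real.hasDerivAt_exp (-y)).comp y (hasDerivAt_neg y)
  simpa [Function.comp_def] using h.hasDerivWithinAt

lemma injOn_exp_neg (s : Set ℝ) : Set.InjOn (fun y : ℝ => Real.exp (-y)) s := by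
  intro x _ y _ h
  simpa using h

lemma integrableOn_Ioo_iff_exp_neg (f : ℝ → ℂ) :
    IntegrableOn f (Set.Ioo 0 1) ↔
      IntegrableOn (fun y : ℝ => (Real.exp (-y) : ℂ) * f (Real.exp (-y))) (Set.Ioi 0) := by
  rw [← image_exp_neg_Ioi, integrableOn_image_iff_integrableOn_abs_deriv_smul measurableSet_Ioi
    (fun y _ => hasDerivWithinAt_exp_neg y _) (injOn_exp_neg _)]
  simp only [abs_neg, abs_of_pos (Real.exp_pos _), Complex.real_smul, Complex.ofReal_exp]

lemma integral_Ioo_eq_exp_neg {E : Type*} [NormedAddCommGroup E] [NormedSpace ℝ E] (f : ℝ → E) :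
    ∫ x in Set.Ioo (0 : ℝ) 1, f x =
      ∫ y in Set.Ioi (0 : ℝ), Real.exp (-y) • f (Real.exp (-y)) := by
  rw [← image_exp_neg_Ioi, integral_image_eq_integral_abs_deriv_smul measurableSet_Ioi
    (fun y _ => hasDerivWithinAt_exp_neg y _) (injOn_exp_neg _)]
  simp only [abs_neg, abs_of_pos (Real.exp_pos _)]

lemma exp_neg_rpow_mul (w y : ℝ) (k : ℕ) :
    Real.exp (-y) * ((Real.exp (-y)) ^ k * (Real.exp (-y)) ^ (w - 1)) =
      Real.exp (-((w + k) * y)) := by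
  rw [← Real.exp_nat_mul, ← Real.exp_mul, ← Real.exp_add, ← Real.exp_add]
  congr 1
  ring

/-- The moments `∫₀¹ x^(w + k - 1) G(x) dx` of the Meijer function are Gamma quotients, and the
absolute moments are `O((k + 1)^(-γ))`. -/
theorem meijerG_moments {as bs : List ℝ} (hlen : as.length = bs.length)
    (hsum : bs.sum < as.sum) {r w : ℝ} (hr : r < 1) (hw : r < w)
    (hpole : ∀ x : ℝ, r < x → poleCount bs x ≤ poleCount as x)
    (hreg : ∀ k : ℕ, ∀ β ∈ bs, ∀ n : ℕ, β + (w + k) ≠ -n) :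
    (∀ k : ℕ, IntegrableOn (fun x : ℝ => (x : ℂ) ^ k * ((x ^ (w - 1) : ℝ) * meijerG as bs x))
        (Set.Ioo 0 1) ∧
      ∫ x in Set.Ioo (0 : ℝ) 1, (x : ℂ) ^ k * ((x ^ (w - 1) : ℝ) * meijerG as bs x) =
        gammaRatio as bs ((w + k : ℝ) : ℂ)) ∧
    ∃ C : ℝ, 0 ≤ C ∧ ∀ k : ℕ,
      ∫ x in Set.Ioo (0 : ℝ) 1, x ^ k * ‖(x ^ (w - 1) : ℝ) * meijerG as bs x‖ ≤
        C * ((k : ℝ) + 1) ^ (-(as.sum - bs.sum)) := by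
  obtain ⟨R, hR, hReq⟩ := exists_mellinSymbol hlen hpole
  set γ := as.sum - bs.sum with hγ
  have hγ0 : 0 < γ := sub_pos.mpr hsum
  have hc : r < loopVertex bs := hr.trans_le (one_le_loopVertex bs)
  have hG : ∀ y : ℝ, meijerG as bs (Real.exp (-y)) = loopKernel R (loopVertex bs) y := fun y => by
    rw [meijerG_eq_loopKernel hReq (Real.exp_pos _), Real.log_exp, neg_neg]
  have hfun : ∀ (k : ℕ) (y : ℝ), (Real.exp (-y) : ℂ) * ((Real.exp (-y) : ℂ) ^ k *
      (((Real.exp (-y)) ^ (w - 1) : ℝ) * meijerG as bs (Real.exp (-y)))) =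
      loopKernel R (loopVertex bs) y * Complex.exp (-((w + k : ℝ) : ℂ) * y) := by
    intro k y
    rw [hG]
    have := congrArg (fun t : ℝ => (t : ℂ)) (exp_neg_rpow_mul w y k)
    simp only [Complex.ofReal_mul, Complex.ofReal_pow, Complex.ofReal_exp, Complex.ofReal_neg]
      at this
    rw [neg_mul, ← this]
    simp only [Complex.ofReal_exp, Complex.ofReal_neg]
    ring
  refine ⟨fun k => ?_, ?_⟩
  · have hwk : r < w + k := by linarith [(k.cast_nonneg : (0 : ℝ) ≤ k)]
    have hI := hR.integral_loopKernel hγ0 hc hwk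
    constructor
    · rw [integrableOn_Ioo_iff_exp_neg]
      simp only [hfun]
      exact hI.1
    · rw [integral_Ioo_eq_exp_neg]
      simp only [Complex.real_smul, hfun]
      rw [hI.2, hReq]
      intro β hβ n h0
      exact hreg k β hβ n (by exact_mod_cast h0)
  · obtain ⟨ρ, hρ, hρw⟩ := exists_between hw
    obtain ⟨C, hC0, hC⟩ := hR.exists_norm_loopKernel_le hγ0 hc hρ
    -- Chosen so that `m (k + 1) ≤ w + k - ρ` for all `k`. The absolute moment is at most `C Γ(γ) (w
    -- + k - ρ)^(-γ)`, the Euler integral of the bound `C y^(γ-1) e^(ρy)`.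
    set m : ℝ := min (w - ρ) 1 with hm
    have hm0 : 0 < m := lt_min (by linarith) one_pos
    refine ⟨C * Real.Gamma γ * m ^ (-γ), by
      have := Real.Gamma_pos_of_pos hγ0; positivity, fun k => ?_⟩
    have hk : (0 : ℝ) ≤ k := k.cast_nonneg
    have ht : 0 < w + k - ρ := by linarith
    rw [integral_Ioo_eq_exp_neg]
    have hle : ∀ y ∈ Set.Ioi (0 : ℝ), Real.exp (-y) • ((Real.exp (-y)) ^ k *
        ‖((Real.exp (-y) ^ (w - 1) : ℝ) : ℂ) * meijerG as bs (Real.exp (-y))‖) ≤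
        C * (y ^ (γ - 1) * Real.exp (-((w + k - ρ) * y))) := by
      intro y hy
      rw [hG, norm_mul, Complex.norm_real, Real.norm_of_nonneg (by positivity), smul_eq_mul,
        ← mul_assoc, ← mul_assoc, mul_assoc (Real.exp (-y)), exp_neg_rpow_mul]
      calc _ ≤ Real.exp (-((w + k) * y)) * (C * y ^ (γ - 1) * Real.exp (ρ * y)) := by
            gcongr
            exact hC y hy
        _ = C * (y ^ (γ - 1) * (Real.exp (-((w + k) * y)) * Real.exp (ρ * y))) := by ring
        _ = _ := by
            rw [← Real.exp_add]
            congr 3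
            ring
    have hint : IntegrableOn (fun y : ℝ => C * (y ^ (γ - 1) * Real.exp (-((w + k - ρ) * y))))
        (Set.Ioi 0) := by
      have := integrableOn_rpow_mul_exp_neg_mul_rpow (p := 1) (s := γ - 1) (b := w + k - ρ)
        (by linarith) one_pos ht
      simp only [Real.rpow_one, neg_mul] at this
      exact this.const_mul C
    refine (integral_mono_of_nonneg (ae_of_all _ fun y => by
      simp only [Pi.zero_apply, smul_eq_mul]; positivity) hint
      ((ae_restrict_iff' measurableSet_Ioi).mpr (ae_of_all _ hle))).trans ?_
    rw [integral_const_mul, Real.integral_rpow_mul_exp_neg_mul_Ioi hγ0 ht, one_div,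
      Real.inv_rpow ht.le, ← Real.rpow_neg ht.le]
    have hmk : m * (k + 1) ≤ w + k - ρ := by
      have h1 : m ≤ w - ρ := min_le_left _ _
      have h2 : m ≤ 1 := min_le_right _ _
      nlinarith
    have : (w + k - ρ) ^ (-γ) ≤ m ^ (-γ) * ((k : ℝ) + 1) ^ (-γ) := by
      rw [← Real.mul_rpow hm0.le (by positivity)]
      exact Real.rpow_le_rpow_of_nonpos (by positivity) hmk (by linarith)
    have hΓ := Real.Gamma_pos_of_pos hγ0
    calc C * ((w + k - ρ) ^ (-γ) * Real.Gamma γ)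
        ≤ C * ((m ^ (-γ) * ((k : ℝ) + 1) ^ (-γ)) * Real.Gamma γ) := by gcongr
      _ = _ := by ring

/-! ### Polar coordinates in a disc -/

/-- The point with polar coordinates `(r, φ)`. -/
def polarPoint (r φ : ℝ) : ℂ := r * Complex.exp (φ * Complex.I)

lemma polarPoint_eq (p : ℝ × ℝ) : Complex.polarCoord.symm p = polarPoint p.1 p.2 := by
  rw [Complex.polarCoord_symm_apply, polarPoint, Complex.exp_mul_I, Complex.ofReal_cos,
    Complex.ofReal_sin]

lemma norm_polarPoint {r : ℝ} (hr : 0 ≤ r) (φ : ℝ) : ‖polarPoint r φ‖ = r := by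
  rw [polarPoint, norm_mul, Complex.norm_exp_ofReal_mul_I, mul_one, Complex.norm_real,
    Real.norm_of_nonneg hr]

lemma continuous_polarPoint : Continuous fun p : ℝ × ℝ => polarPoint p.1 p.2 := by
  unfold polarPoint; fun_prop

/-- The range of the polar coordinates of a disc. -/
def polarDisc (R : ℝ) : Set (ℝ × ℝ) := Set.Ioo 0 R ×ˢ Set.Ioo (-Real.pi) Real.pi

lemma measurableSet_polarDisc (R : ℝ) : MeasurableSet (polarDisc R) :=
  measurableSet_Ioo.prod measurableSet_Ioo

lemma polarDisc_subset (R : ℝ) : polarDisc R ⊆ polarCoord.target :=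
  Set.prod_mono (fun _ h => h.1) subset_rfl

lemma indicator_ball_polarPoint {E : Type*} [Zero E] {R : ℝ} (f : ℂ → E) {p : ℝ × ℝ}
    (hp : p ∈ polarCoord.target) :
    (Metric.ball (0 : ℂ) R).indicator f (polarPoint p.1 p.2) =
      (polarDisc R).indicator (fun p => f (polarPoint p.1 p.2)) p := by
  have h0 : 0 < p.1 := hp.1
  have hn := norm_polarPoint h0.le p.2
  by_cases h : p.1 < R
  · rw [Set.indicator_of_mem, Set.indicator_of_mem]
    · exact ⟨⟨h0, h⟩, hp.2⟩
    · simpa [hn] using h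
  · rw [Set.indicator_of_notMem, Set.indicator_of_notMem]
    · exact fun hh => h hh.1.2
    · simpa [hn] using h

lemma setIntegral_ball_eq_polar {E : Type*} [NormedAddCommGroup E] [NormedSpace ℝ E] (f : ℂ → E)
    (R : ℝ) :
    ∫ z in Metric.ball (0 : ℂ) R, f z = ∫ p in polarDisc R, p.1 • f (polarPoint p.1 p.2) := by
  rw [← integral_indicator Metric.isOpen_ball.measurableSet,
    ← Complex.integral_comp_polarCoord_symm]
  have h : ∀ p ∈ polarCoord.target,
      p.1 • (Metric.ball (0 : ℂ) R).indicator f (Complex.polarCoord.symm p) =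
      (polarDisc R).indicator (fun p => p.1 • f (polarPoint p.1 p.2)) p := by
    intro p hp
    rw [polarPoint_eq, indicator_ball_polarPoint f hp]
    by_cases hm : p ∈ polarDisc R <;> simp [hm]
  rw [setIntegral_congr_fun polarCoord.open_target.measurableSet h,
    setIntegral_indicator (measurableSet_polarDisc R),
    Set.inter_eq_right.mpr (polarDisc_subset R)]

lemma setLIntegral_ball_eq_polar (f : ℂ → ENNReal) (R : ℝ) :
    ∫⁻ z in Metric.ball (0 : ℂ) R, f z =
      ∫⁻ p in polarDisc R, ENNReal.ofReal p.1 * f (polarPoint p.1 p.2) := by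
  rw [← lintegral_indicator Metric.isOpen_ball.measurableSet,
    ← Complex.lintegral_comp_polarCoord_symm]
  have h : ∀ p ∈ polarCoord.target, ENNReal.ofReal p.1 •
        (Metric.ball (0 : ℂ) R).indicator f (Complex.polarCoord.symm p) =
      (polarDisc R).indicator (fun p => ENNReal.ofReal p.1 * f (polarPoint p.1 p.2)) p := by
    intro p hp
    rw [polarPoint_eq, indicator_ball_polarPoint f hp]
    by_cases hm : p ∈ polarDisc R <;> simp [hm]
  rw [setLIntegral_congr_fun polarCoord.open_target.measurableSet h,
    lintegral_indicator (measurableSet_polarDisc R), Measure.restrict_restrict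
      (measurableSet_polarDisc R), Set.inter_eq_left.mpr (polarDisc_subset R)]

/-- Finiteness of the integral of the norm passes through the polar change of variables as an
identity of lower Lebesgue integrals, which needs no integrability beforehand. -/
lemma integrableOn_ball_of_polar {f : ℂ → ℂ} {R : ℝ}
    (hf : AEStronglyMeasurable f (volume.restrict (Metric.ball (0 : ℂ) R)))
    (hp : IntegrableOn (fun p : ℝ × ℝ => p.1 • f (polarPoint p.1 p.2)) (polarDisc R)) :
    IntegrableOn f (Metric.ball (0 : ℂ) R) := by
  refine ⟨hf, ?_⟩
  rw [HasFiniteIntegral, setLIntegral_ball_eq_polar]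
  have h := hp.2
  rw [HasFiniteIntegral] at h
  refine lt_of_le_of_lt (le_of_eq ?_) h
  refine setLIntegral_congr_fun (measurableSet_polarDisc R) fun p hp => ?_
  have h0 : 0 < p.1 := hp.1.1
  simp only [enorm_smul]
  rw [Real.enorm_eq_ofReal h0.le]

/-! ### Parseval's identity on circles -/

lemma integral_exp_int_mul (n : ℤ) :
    ∫ φ in Set.Ioo (-Real.pi) Real.pi, Complex.exp (n * (φ * Complex.I)) =
      if n = 0 then (2 * Real.pi : ℂ) else 0 := by
  rw [← integral_Ioc_eq_integral_Ioo, ← intervalIntegral.integral_of_le (by linarith [Real.pi_pos])]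
  split_ifs with h
  · subst h
    simp
    ring
  · have hc : (n : ℂ) * Complex.I ≠ 0 := mul_ne_zero (by exact_mod_cast h) Complex.I_ne_zero
    have e : ∀ φ : ℝ, Complex.exp (n * (φ * Complex.I)) =
        Complex.exp (n * Complex.I * φ) := fun φ => by congr 1; ring
    simp only [e]
    rw [integral_exp_mul_complex hc]
    have : Complex.exp (n * Complex.I * Real.pi) =
        Complex.exp (n * Complex.I * (-Real.pi : ℝ)) := by
      rw [← mul_one (Complex.exp (n * Complex.I * (-Real.pi : ℝ))),
        ← Complex.exp_int_mul_two_pi_mul_I n, ← Complex.exp_add]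
      congr 1
      push_cast
      ring
    rw [this, sub_self, zero_div]

lemma integral_monomial_mul_conj (r : ℝ) (j k : ℕ) :
    ∫ φ in Set.Ioo (-Real.pi) Real.pi, polarPoint r φ ^ j * conj (polarPoint r φ ^ k) =
      if j = k then (2 * Real.pi : ℂ) * (r : ℂ) ^ (2 * k) else 0 := by
  have e : ∀ φ : ℝ, polarPoint r φ ^ j * conj (polarPoint r φ ^ k) =
      (r : ℂ) ^ (j + k) * Complex.exp (((j - k : ℤ) : ℂ) * (φ * Complex.I)) := by
    intro φ
    have hc : conj (polarPoint r φ) = r * Complex.exp (-(φ * Complex.I)) := by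
      rw [polarPoint, map_mul, Complex.conj_ofReal, ← Complex.exp_conj, map_mul, Complex.conj_I,
        Complex.conj_ofReal, mul_neg]
    rw [map_pow, hc, polarPoint, mul_pow, mul_pow, ← Complex.exp_nat_mul, ← Complex.exp_nat_mul,
      mul_mul_mul_comm, ← Complex.exp_add, pow_add]
    congr 2
    push_cast
    ring
  simp only [e]
  rw [integral_const_mul, integral_exp_int_mul]
  by_cases h : j = k
  · subst h
    simp only [sub_self, if_true]
    ring
  · have : ((j : ℤ) - k) ≠ 0 := by omega
    simp [h, this]

/-- The double series for `F conj H` converges absolutely, uniformly on the circle, so it may be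
integrated term by term; orthogonality of the characters leaves the diagonal. -/
lemma circle_parseval {u v : ℕ → ℂ} {F H : ℂ → ℂ} {r : ℝ} (hr : 0 ≤ r)
    (hu : Summable fun k => ‖u k‖ * r ^ k) (hv : Summable fun k => ‖v k‖ * r ^ k)
    (hF : ∀ z : ℂ, ‖z‖ = r → HasSum (fun k => u k * z ^ k) (F z))
    (hH : ∀ z : ℂ, ‖z‖ = r → HasSum (fun k => v k * z ^ k) (H z)) :
    HasSum (fun k => 2 * Real.pi * (u k * conj (v k) * (r : ℂ) ^ (2 * k)))
      (∫ φ in Set.Ioo (-Real.pi) Real.pi, F (polarPoint r φ) * conj (H (polarPoint r φ))) := by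
  set G : ℕ × ℕ → ℝ → ℂ := fun q φ =>
    (u q.1 * polarPoint r φ ^ q.1) * conj (v q.2 * polarPoint r φ ^ q.2) with hG
  have hcont : Continuous fun φ => polarPoint r φ := by unfold polarPoint; fun_prop
  have hGnorm : ∀ q φ, ‖G q φ‖ = (‖u q.1‖ * r ^ q.1) * (‖v q.2‖ * r ^ q.2) := by
    intro q φ
    simp only [hG, norm_mul, RCLike.norm_conj, norm_pow, norm_polarPoint hr]
  have hGint : ∀ q, Integrable (G q) (volume.restrict (Set.Ioo (-Real.pi) Real.pi)) := by
    intro q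
    have : Continuous (G q) := by
      simp only [hG]
      fun_prop
    exact this.integrableOn_Icc.mono_set Set.Ioo_subset_Icc_self
  have hvol : (volume.restrict (Set.Ioo (-Real.pi) Real.pi)).real Set.univ = 2 * Real.pi := by
    simp [Measure.real, Real.pi_pos.le]
    ring
  have hsum : Summable fun q => ∫ φ in Set.Ioo (-Real.pi) Real.pi, ‖G q φ‖ := by
    simp only [hGnorm, integral_const, hvol, smul_eq_mul]
    refine Summable.mul_left _ ?_
    exact summable_mul_of_summable_norm (f := fun k => ‖u k‖ * r ^ k)
      (g := fun k => ‖v k‖ * r ^ k) hu.norm hv.norm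
  have h := hasSum_integral_of_summable_integral_norm hGint hsum
  have hval : ∀ φ : ℝ, ∑' q, G q φ = F (polarPoint r φ) * conj (H (polarPoint r φ)) := by
    intro φ
    have h1 := hF (polarPoint r φ) (norm_polarPoint hr φ)
    have h2 := (hH (polarPoint r φ) (norm_polarPoint hr φ)).map (starRingEnd ℂ)
      Complex.continuous_conj
    refine (h1.mul h2 ?_).tsum_eq
    refine summable_mul_of_summable_norm (f := fun k => u k * polarPoint r φ ^ k)
      (g := (starRingEnd ℂ) ∘ fun k => v k * polarPoint r φ ^ k) ?_ ?_
    · simpa [norm_polarPoint hr] using hu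
    · simpa [norm_polarPoint hr] using hv
  simp only [hval] at h
  have hterm : ∀ q : ℕ × ℕ, ∫ φ in Set.Ioo (-Real.pi) Real.pi, G q φ =
      if q.1 = q.2 then 2 * Real.pi * (u q.1 * conj (v q.2) * (r : ℂ) ^ (2 * q.2)) else 0 := by
    intro q
    have e : ∀ φ, G q φ = (u q.1 * conj (v q.2)) *
        (polarPoint r φ ^ q.1 * conj (polarPoint r φ ^ q.2)) := by
      intro φ
      simp only [hG, map_mul]
      ring
    simp only [e]
    rw [integral_const_mul, integral_monomial_mul_conj]
    split_ifs <;> ring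
  simp only [hterm] at h
  have hinj : Function.Injective fun k : ℕ => (k, k) := fun i j hij => by simpa using hij
  have h' := (hinj.hasSum_iff (by
    rintro ⟨i, j⟩ hij
    rw [if_neg]
    intro hc
    exact hij ⟨i, Prod.ext rfl hc⟩)).mpr h
  simpa [Function.comp_def] using h'

/-! ### Radial integrals -/

lemma image_sq_div {θ : ℝ} (hθ : 0 < θ) :
    (fun r : ℝ => r ^ 2 / θ) '' Set.Ioo 0 (Real.sqrt θ) = Set.Ioo 0 1 := by
  ext x
  constructor
  · rintro ⟨r, ⟨h0, h1⟩, rfl⟩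
    refine ⟨by positivity, ?_⟩
    rw [div_lt_one hθ]
    exact (Real.lt_sqrt h0.le).mp h1
  · rintro ⟨h0, h1⟩
    refine ⟨Real.sqrt (θ * x), ⟨by positivity, Real.sqrt_lt_sqrt (by positivity) (by nlinarith)⟩, ?_⟩
    simp only
    rw [Real.sq_sqrt (by positivity)]
    field_simp

lemma injOn_sq_div {θ : ℝ} (hθ : 0 < θ) :
    Set.InjOn (fun r : ℝ => r ^ 2 / θ) (Set.Ioo 0 (Real.sqrt θ)) := by
  intro x hx y hy h
  simp only [div_left_inj' hθ.ne'] at h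
  exact (pow_left_inj₀ hx.1.le hy.1.le (by norm_num)).mp h

lemma hasDerivWithinAt_sq_div (θ r : ℝ) (s : Set ℝ) :
    HasDerivWithinAt (fun r : ℝ => r ^ 2 / θ) (2 * r / θ) s r := by
  simpa using (((hasDerivAt_pow 2 r).div_const θ).hasDerivWithinAt (s := s))

lemma radial_integrableOn_iff {θ : ℝ} (hθ : 0 < θ) (f : ℝ → ℂ) :
    IntegrableOn f (Set.Ioo 0 1) ↔
      IntegrableOn (fun r : ℝ => r • f (r ^ 2 / θ)) (Set.Ioo 0 (Real.sqrt θ)) := by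
  rw [← image_sq_div hθ, integrableOn_image_iff_integrableOn_abs_deriv_smul measurableSet_Ioo
    (fun y _ => hasDerivWithinAt_sq_div θ y _) (injOn_sq_div hθ)]
  have e : ∀ r ∈ Set.Ioo 0 (Real.sqrt θ), |2 * r / θ| • f (r ^ 2 / θ) =
      ((2 / θ : ℝ) : ℂ) * (r • f (r ^ 2 / θ)) := by
    intro r hr
    have : 0 < r := hr.1
    rw [abs_of_pos (by positivity), Complex.real_smul, Complex.real_smul]
    push_cast
    ring
  rw [integrableOn_congr_fun e measurableSet_Ioo]
  refine integrable_const_mul_iff ?_ _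
  exact isUnit_iff_ne_zero.mpr (by exact_mod_cast (by positivity : (2 / θ : ℝ) ≠ 0))

lemma radial_integral {E : Type*} [NormedAddCommGroup E] [NormedSpace ℝ E] {θ : ℝ} (hθ : 0 < θ)
    (f : ℝ → E) :
    ∫ r in Set.Ioo 0 (Real.sqrt θ), r • f (r ^ 2 / θ) =
      (θ / 2) • ∫ x in Set.Ioo (0 : ℝ) 1, f x := by
  rw [← image_sq_div hθ, integral_image_eq_integral_abs_deriv_smul measurableSet_Ioo
    (fun y _ => hasDerivWithinAt_sq_div θ y _) (injOn_sq_div hθ), ← integral_smul]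
  refine setIntegral_congr_fun measurableSet_Ioo fun r hr => ?_
  have : 0 < r := hr.1
  simp only [smul_smul]
  rw [abs_of_pos (by positivity)]
  congr 1
  field_simp

/-! ### Area integrals with radial weights -/

/-- `F` is the sum of the power series with coefficients `u` in the disc of radius `R`. -/
def IsPowerSeriesOn (u : ℕ → ℂ) (F : ℂ → ℂ) (R : ℝ) : Prop :=
  ContinuousOn F (Metric.ball 0 R) ∧ ∀ z : ℂ, ‖z‖ < R → HasSum (fun k => u k * z ^ k) (F z)

lemma IsPowerSeriesOn.summable_norm {u : ℕ → ℂ} {F : ℂ → ℂ} {R r : ℝ}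
    (h : IsPowerSeriesOn u F R) (hr : 0 ≤ r) (hrR : r < R) :
    Summable fun k => ‖u k‖ * r ^ k := by
  have := (h.2 (r : ℂ) (by rwa [Complex.norm_real, Real.norm_of_nonneg hr])).summable.norm
  simpa [abs_of_nonneg hr] using this

lemma IsPowerSeriesOn.parseval {u v : ℕ → ℂ} {F H : ℂ → ℂ} {R r : ℝ}
    (hF : IsPowerSeriesOn u F R) (hH : IsPowerSeriesOn v H R) (hr : 0 ≤ r) (hrR : r < R) :
    HasSum (fun k => 2 * Real.pi * (u k * conj (v k) * (r : ℂ) ^ (2 * k)))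
      (∫ φ in Set.Ioo (-Real.pi) Real.pi, F (polarPoint r φ) * conj (H (polarPoint r φ))) :=
  circle_parseval hr (hF.summable_norm hr hrR) (hH.summable_norm hr hrR)
    (fun z hz => hF.2 z (hz ▸ hrR)) (fun z hz => hH.2 z (hz ▸ hrR))

lemma continuousOn_comp_polarPoint {F : ℂ → ℂ} {R : ℝ} (hF : ContinuousOn F (Metric.ball 0 R)) :
    ContinuousOn (fun p : ℝ × ℝ => F (polarPoint p.1 p.2)) (polarDisc R) := by
  refine hF.comp continuous_polarPoint.continuousOn fun p hp => ?_
  simpa [norm_polarPoint hp.1.1.le] using hp.1.2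

lemma continuous_comp_polarPoint_angle {F : ℂ → ℂ} {R r : ℝ} (hF : ContinuousOn F (Metric.ball 0 R))
    (hr : 0 ≤ r) (hrR : r < R) : Continuous fun φ : ℝ => F (polarPoint r φ) := by
  refine hF.comp_continuous (by unfold polarPoint; fun_prop) fun φ => ?_
  simpa [norm_polarPoint hr] using hrR

/-- Parseval's identity for one function, in `ENNReal`, where it can be multiplied by the radial
weight and summed by Tonelli without any convergence question. -/
lemma ofReal_setIntegral_norm_sq {u : ℕ → ℂ} {F : ℂ → ℂ} {R r : ℝ}
    (hF : IsPowerSeriesOn u F R) (hr : 0 ≤ r) (hrR : r < R) :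
    ∫⁻ φ in Set.Ioo (-Real.pi) Real.pi, ENNReal.ofReal (‖F (polarPoint r φ)‖ ^ 2) =
      ∑' k, ENNReal.ofReal (2 * Real.pi * (‖u k‖ ^ 2 * r ^ (2 * k))) := by
  have hc := continuous_comp_polarPoint_angle hF.1 hr hrR
  have hint : Integrable (fun φ => ‖F (polarPoint r φ)‖ ^ 2)
      (volume.restrict (Set.Ioo (-Real.pi) Real.pi)) := by
    have : Continuous fun φ => ‖F (polarPoint r φ)‖ ^ 2 := hc.norm.pow 2
    exact this.integrableOn_Icc.mono_set Set.Ioo_subset_Icc_self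
  rw [← ofReal_integral_eq_lintegral_ofReal hint (ae_of_all _ fun φ => by positivity)]
  have e1 : ∀ z : ℂ, z * conj z = ((‖z‖ ^ 2 : ℝ) : ℂ) := fun z => by
    rw [Complex.mul_conj, Complex.normSq_eq_norm_sq]
  have h : HasSum (fun k => ((2 * Real.pi * (‖u k‖ ^ 2 * r ^ (2 * k)) : ℝ) : ℂ))
      ((∫ φ in Set.Ioo (-Real.pi) Real.pi, ‖F (polarPoint r φ)‖ ^ 2 : ℝ) : ℂ) := by
    have e2 : (fun k => 2 * Real.pi * (u k * conj (u k) * (r : ℂ) ^ (2 * k))) =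
        fun k => ((2 * Real.pi * (‖u k‖ ^ 2 * r ^ (2 * k)) : ℝ) : ℂ) := by
      funext k
      rw [e1]
      push_cast
      ring
    have e3 : (∫ φ in Set.Ioo (-Real.pi) Real.pi,
        F (polarPoint r φ) * conj (F (polarPoint r φ))) =
        ((∫ φ in Set.Ioo (-Real.pi) Real.pi, ‖F (polarPoint r φ)‖ ^ 2 : ℝ) : ℂ) := by
      exact (integral_congr_ae (ae_of_all _ fun φ => e1 _)).trans integral_ofReal
    have h0 := hF.parseval hF hr hrR
    rwa [e2, e3] at h0
  have h' := Complex.hasSum_ofReal.mp h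
  rw [← h'.tsum_eq, ENNReal.ofReal_tsum_of_nonneg (fun k => by positivity) h'.summable]

/-- By Tonelli the integral is `π θ ∑ ‖u k‖² θ^k ∫₀¹ x^k ‖W x‖ dx`: Parseval on each circle, then
the substitution `x = r²/θ`. The hypothesis on absolute moments says that this is finite. -/
lemma lintegral_norm_sq_mul_weight {u : ℕ → ℂ} {F : ℂ → ℂ} {θ : ℝ} (hθ : 0 < θ)
    (hF : IsPowerSeriesOn u F (Real.sqrt θ)) {W : ℝ → ℂ} (hW : Measurable W)
    (hWint : ∀ k : ℕ, IntegrableOn (fun x : ℝ => (x : ℂ) ^ k * W x) (Set.Ioo 0 1))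
    (hsum : Summable fun k => ‖u k‖ ^ 2 * θ ^ k * ∫ x in Set.Ioo (0 : ℝ) 1, x ^ k * ‖W x‖) :
    IntegrableOn (fun p : ℝ × ℝ => p.1 • (‖F (polarPoint p.1 p.2)‖ ^ 2 * ‖W (p.1 ^ 2 / θ)‖))
      (polarDisc (Real.sqrt θ)) := by
  set R := Real.sqrt θ with hR
  have hmeasW : Measurable fun r : ℝ => ENNReal.ofReal (r * ‖W (r ^ 2 / θ)‖) := by fun_prop
  have hcF := continuousOn_comp_polarPoint hF.1
  refine ⟨?_, ?_⟩
  · refine AEStronglyMeasurable.smul (f := fun p : ℝ × ℝ => p.1)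
      measurable_fst.aestronglyMeasurable ?_
    refine AEStronglyMeasurable.mul ?_ ?_
    · exact (hcF.norm.pow 2).aestronglyMeasurable (measurableSet_polarDisc _)
    · refine Measurable.aestronglyMeasurable ?_
      fun_prop
  rw [HasFiniteIntegral]
  have hstep : ∀ p ∈ polarDisc R,
      ‖p.1 • (‖F (polarPoint p.1 p.2)‖ ^ 2 * ‖W (p.1 ^ 2 / θ)‖)‖ₑ =
      ENNReal.ofReal (p.1 * ‖W (p.1 ^ 2 / θ)‖) * ENNReal.ofReal (‖F (polarPoint p.1 p.2)‖ ^ 2) := by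
    intro p hp
    have h0 : 0 < p.1 := hp.1.1
    rw [Real.enorm_of_nonneg (by rw [smul_eq_mul]; positivity),
      ← ENNReal.ofReal_mul (by positivity)]
    congr 1
    rw [smul_eq_mul]
    ring
  rw [setLIntegral_congr_fun (measurableSet_polarDisc _) hstep]
  rw [polarDisc, Measure.volume_eq_prod, ← Measure.prod_restrict, lintegral_prod _ (by
    refine AEMeasurable.mul (hmeasW.comp measurable_fst).aemeasurable ?_
    rw [Measure.prod_restrict, ← Measure.volume_eq_prod]
    exact ((hcF.norm.pow 2).aemeasurable (measurableSet_polarDisc _)).ennreal_ofReal)]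
  have hinner : ∀ r ∈ Set.Ioo 0 R,
      ∫⁻ φ in Set.Ioo (-Real.pi) Real.pi, ENNReal.ofReal (r * ‖W (r ^ 2 / θ)‖) *
        ENNReal.ofReal (‖F (polarPoint r φ)‖ ^ 2) =
      ∑' k, ENNReal.ofReal (r * ‖W (r ^ 2 / θ)‖) *
        ENNReal.ofReal (2 * Real.pi * (‖u k‖ ^ 2 * r ^ (2 * k))) := by
    intro r hr
    rw [lintegral_const_mul' _ _ ENNReal.ofReal_ne_top, ofReal_setIntegral_norm_sq hF hr.1.le hr.2,
      ENNReal.tsum_mul_left]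
  rw [setLIntegral_congr_fun measurableSet_Ioo hinner, lintegral_tsum fun k => by
    exact (hmeasW.mul (by fun_prop)).aemeasurable]
  have hterm : ∀ k : ℕ, ∫⁻ r in Set.Ioo 0 R, ENNReal.ofReal (r * ‖W (r ^ 2 / θ)‖) *
        ENNReal.ofReal (2 * Real.pi * (‖u k‖ ^ 2 * r ^ (2 * k))) =
      ENNReal.ofReal (Real.pi * θ *
        (‖u k‖ ^ 2 * θ ^ k * ∫ x in Set.Ioo (0 : ℝ) 1, x ^ k * ‖W x‖)) := by
    intro k
    have hI := ((radial_integrableOn_iff hθ _).mp (hWint k)).norm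
    have e1 : ∀ r ∈ Set.Ioo 0 R, ENNReal.ofReal (r * ‖W (r ^ 2 / θ)‖) *
        ENNReal.ofReal (2 * Real.pi * (‖u k‖ ^ 2 * r ^ (2 * k))) =
        ENNReal.ofReal ((2 * Real.pi * ‖u k‖ ^ 2 * θ ^ k) *
          ‖r • ((((r ^ 2 / θ : ℝ) : ℂ)) ^ k * W (r ^ 2 / θ))‖) := by
      intro r hr
      have h0 : 0 < r := hr.1
      rw [← ENNReal.ofReal_mul (by positivity)]
      congr 1
      rw [norm_smul, norm_mul, norm_pow, Complex.norm_real, Real.norm_of_nonneg h0.le,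
        Real.norm_of_nonneg (by positivity), div_pow, ← pow_mul]
      field_simp
    rw [setLIntegral_congr_fun measurableSet_Ioo e1,
      ← ofReal_integral_eq_lintegral_ofReal (hI.const_mul _) (ae_of_all _ fun r => by positivity)]
    congr 1
    rw [integral_const_mul]
    have e2 : ∀ r ∈ Set.Ioo 0 R, ‖r • ((((r ^ 2 / θ : ℝ) : ℂ)) ^ k * W (r ^ 2 / θ))‖ =
        r • ((r ^ 2 / θ) ^ k * ‖W (r ^ 2 / θ)‖) := by
      intro r hr
      have h0 : 0 < r := hr.1
      rw [norm_smul, norm_mul, norm_pow, Complex.norm_real, Real.norm_of_nonneg h0.le,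
        Real.norm_of_nonneg (by positivity), smul_eq_mul]
    rw [setIntegral_congr_fun measurableSet_Ioo e2,
      radial_integral hθ (fun x : ℝ => x ^ k * ‖W x‖), smul_eq_mul]
    ring
  simp only [hterm]
  rw [← ENNReal.ofReal_tsum_of_nonneg (fun k => ?_) (hsum.mul_left _)]
  · exact ENNReal.ofReal_lt_top
  · have : 0 ≤ ∫ x in Set.Ioo (0 : ℝ) 1, x ^ k * ‖W x‖ :=
      setIntegral_nonneg measurableSet_Ioo fun x hx => by
        have := hx.1
        positivity
    positivity

/-- The area integral of `F * conj H` against a radial weight. -/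
theorem area_integral {u v : ℕ → ℂ} {F H : ℂ → ℂ} {θ : ℝ} (hθ : 0 < θ)
    (hF : IsPowerSeriesOn u F (Real.sqrt θ)) (hH : IsPowerSeriesOn v H (Real.sqrt θ))
    {W : ℝ → ℂ} (hW : Measurable W)
    (hWint : ∀ k : ℕ, IntegrableOn (fun x : ℝ => (x : ℂ) ^ k * W x) (Set.Ioo 0 1))
    (hu : Summable fun k => ‖u k‖ ^ 2 * θ ^ k * ∫ x in Set.Ioo (0 : ℝ) 1, x ^ k * ‖W x‖)
    (hv : Summable fun k => ‖v k‖ ^ 2 * θ ^ k * ∫ x in Set.Ioo (0 : ℝ) 1, x ^ k * ‖W x‖) :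
    IntegrableOn (fun z : ℂ => F z * conj (H z) * W (‖z‖ ^ 2 / θ))
        (Metric.ball 0 (Real.sqrt θ)) ∧
      HasSum (fun k => Real.pi * θ * (u k * conj (v k) * θ ^ k *
          ∫ x in Set.Ioo (0 : ℝ) 1, (x : ℂ) ^ k * W x))
        (∫ z in Metric.ball (0 : ℂ) (Real.sqrt θ), F z * conj (H z) * W (‖z‖ ^ 2 / θ)) := by
  set R := Real.sqrt θ with hR
  have hcF := continuousOn_comp_polarPoint hF.1
  have hcH := continuousOn_comp_polarPoint hH.1
  have hpol : IntegrableOn (fun p : ℝ × ℝ => p.1 • (F (polarPoint p.1 p.2) *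
      conj (H (polarPoint p.1 p.2)) * W (p.1 ^ 2 / θ))) (polarDisc R) := by
    -- The mixed integrand is dominated through `‖F‖ ‖H‖ ≤ ‖F‖² + ‖H‖²`.
    have hdom := (lintegral_norm_sq_mul_weight hθ hF hW hWint hu).add
      (lintegral_norm_sq_mul_weight hθ hH hW hWint hv)
    refine Integrable.mono' hdom ?_ ?_
    · refine AEStronglyMeasurable.smul (f := fun p : ℝ × ℝ => p.1)
        measurable_fst.aestronglyMeasurable (AEStronglyMeasurable.mul ?_ ?_)
      · exact (hcF.mul (Complex.continuous_conj.comp_continuousOn hcH)).aestronglyMeasurable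
          (measurableSet_polarDisc _)
      · refine Measurable.aestronglyMeasurable ?_
        fun_prop
    · refine (ae_restrict_iff' (measurableSet_polarDisc _)).mpr (ae_of_all _ fun p hp => ?_)
      have h0 : 0 < p.1 := hp.1.1
      simp only [Pi.add_apply, smul_eq_mul]
      rw [norm_smul, norm_mul, norm_mul, RCLike.norm_conj, Real.norm_of_nonneg h0.le, ← mul_add,
        ← add_mul]
      gcongr
      nlinarith [sq_nonneg (‖F (polarPoint p.1 p.2)‖ - ‖H (polarPoint p.1 p.2)‖),
        sq_nonneg (‖F (polarPoint p.1 p.2)‖ + ‖H (polarPoint p.1 p.2)‖)]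
  have hnorm : ∀ p ∈ polarDisc R, p.1 • (F (polarPoint p.1 p.2) *
      conj (H (polarPoint p.1 p.2)) * W (‖polarPoint p.1 p.2‖ ^ 2 / θ)) =
      p.1 • (F (polarPoint p.1 p.2) * conj (H (polarPoint p.1 p.2)) * W (p.1 ^ 2 / θ)) := by
    intro p hp
    rw [norm_polarPoint hp.1.1.le]
  constructor
  · refine integrableOn_ball_of_polar ?_ ?_
    · refine AEStronglyMeasurable.mul ?_ ?_
      · exact (hF.1.mul (Complex.continuous_conj.comp_continuousOn hH.1)).aestronglyMeasurable
          Metric.isOpen_ball.measurableSet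
      · refine Measurable.aestronglyMeasurable ?_
        fun_prop
    · rwa [integrableOn_congr_fun hnorm (measurableSet_polarDisc _)]
  · rw [setIntegral_ball_eq_polar, setIntegral_congr_fun (measurableSet_polarDisc _) hnorm]
    have hprod : ∫ p in polarDisc R, p.1 • (F (polarPoint p.1 p.2) *
        conj (H (polarPoint p.1 p.2)) * W (p.1 ^ 2 / θ)) =
        ∫ r in Set.Ioo 0 R, ∑' k, r • (W (r ^ 2 / θ) * (2 * Real.pi *
          (u k * conj (v k) * (r : ℂ) ^ (2 * k)))) := by
      rw [polarDisc, Measure.volume_eq_prod, setIntegral_prod _ hpol]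
      refine setIntegral_congr_fun measurableSet_Ioo fun r hr => ?_
      have hs := hF.parseval hH hr.1.le hr.2
      simp only
      rw [integral_smul, integral_mul_const, ← hs.tsum_eq, mul_comm, ← tsum_mul_left,
        ← tsum_const_smul'']
    rw [hprod]
    have hterm : ∀ (k : ℕ), ∀ r ∈ Set.Ioo 0 R, r • (W (r ^ 2 / θ) * (2 * Real.pi *
          (u k * conj (v k) * (r : ℂ) ^ (2 * k)))) =
        (2 * Real.pi * (u k * conj (v k)) * (θ : ℂ) ^ k) *
          (r • ((((r ^ 2 / θ : ℝ) : ℂ)) ^ k * W (r ^ 2 / θ))) := by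
      intro k r hr
      have hθ' : (θ : ℂ) ≠ 0 := by exact_mod_cast hθ.ne'
      rw [Complex.real_smul, Complex.real_smul]
      push_cast
      rw [div_pow, ← pow_mul]
      field_simp
    have hI : ∀ k : ℕ, Integrable (fun r => (2 * Real.pi * (u k * conj (v k)) * (θ : ℂ) ^ k) *
          (r • ((((r ^ 2 / θ : ℝ) : ℂ)) ^ k * W (r ^ 2 / θ))))
        (volume.restrict (Set.Ioo 0 R)) := fun k =>
      ((radial_integrableOn_iff hθ _).mp (hWint k)).const_mul _
    have hM : ∀ k : ℕ, 0 ≤ ∫ x in Set.Ioo (0 : ℝ) 1, x ^ k * ‖W x‖ := fun k =>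
      setIntegral_nonneg measurableSet_Ioo fun x hx => by
        have := hx.1
        positivity
    have hInorm : ∀ k : ℕ, ∫ r in Set.Ioo 0 R,
        ‖(2 * Real.pi * (u k * conj (v k)) * (θ : ℂ) ^ k) *
          (r • ((((r ^ 2 / θ : ℝ) : ℂ)) ^ k * W (r ^ 2 / θ)))‖ =
        Real.pi * θ * (‖u k‖ * ‖v k‖ * θ ^ k * ∫ x in Set.Ioo (0 : ℝ) 1, x ^ k * ‖W x‖) := by
      intro k
      have e2 : ∀ r ∈ Set.Ioo 0 R, ‖(2 * Real.pi * (u k * conj (v k)) * (θ : ℂ) ^ k) *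
          (r • ((((r ^ 2 / θ : ℝ) : ℂ)) ^ k * W (r ^ 2 / θ)))‖ =
          (2 * Real.pi * (‖u k‖ * ‖v k‖) * θ ^ k) * (r • ((r ^ 2 / θ) ^ k * ‖W (r ^ 2 / θ)‖)) := by
        intro r hr
        have h0 : 0 < r := hr.1
        rw [norm_mul, norm_mul, norm_mul, norm_mul, norm_mul, RCLike.norm_conj, norm_pow,
          norm_smul, norm_mul, norm_pow, Complex.norm_real, Complex.norm_real, Complex.norm_real,
          Real.norm_of_nonneg h0.le, Real.norm_of_nonneg (by positivity : 0 ≤ r ^ 2 / θ),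
          Real.norm_of_nonneg Real.pi_pos.le, Real.norm_of_nonneg hθ.le, Complex.norm_ofNat,
          smul_eq_mul]
      rw [setIntegral_congr_fun measurableSet_Ioo e2, integral_const_mul,
        radial_integral hθ (fun x : ℝ => x ^ k * ‖W x‖), smul_eq_mul]
      ring
    have hsum : Summable fun k => ∫ r in Set.Ioo 0 R,
        ‖(2 * Real.pi * (u k * conj (v k)) * (θ : ℂ) ^ k) *
          (r • ((((r ^ 2 / θ : ℝ) : ℂ)) ^ k * W (r ^ 2 / θ)))‖ := by
      simp only [hInorm]
      refine Summable.mul_left _ (Summable.of_nonneg_of_le (fun k => ?_) (fun k => ?_)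
        (hu.add hv))
      · have := hM k
        positivity
      · rw [← add_mul, ← add_mul]
        have := hM k
        gcongr
        nlinarith [sq_nonneg (‖u k‖ - ‖v k‖), sq_nonneg (‖u k‖ + ‖v k‖)]
    -- The order is angular integral, Parseval, radial integral term by term. The absolute moments
    -- with `‖u k‖ ‖v k‖ ≤ ‖u k‖² + ‖v k‖²` allow the last exchange.
    have h := hasSum_integral_of_summable_integral_norm hI hsum
    have e3 : ∫ r in Set.Ioo 0 R, ∑' k, r • (W (r ^ 2 / θ) * (2 * Real.pi *
          (u k * conj (v k) * (r : ℂ) ^ (2 * k)))) =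
        ∫ r in Set.Ioo 0 R, ∑' k, (2 * Real.pi * (u k * conj (v k)) * (θ : ℂ) ^ k) *
          (r • ((((r ^ 2 / θ : ℝ) : ℂ)) ^ k * W (r ^ 2 / θ))) := by
      refine setIntegral_congr_fun measurableSet_Ioo fun r hr => ?_
      exact tsum_congr fun k => hterm k r hr
    rw [e3]
    refine (congrArg (fun f => HasSum f _) (funext fun k => ?_)).mpr h
    rw [integral_const_mul, radial_integral hθ (fun x : ℝ => (x : ℂ) ^ k * W x),
      Complex.real_smul]
    push_cast
    ring

-- Area integrals against Meijer functions

/-- Each side of the loop is a parameter integral of a jointly continuous function. The area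
integral is taken in two variables and needs the weight to be measurable. -/
lemma measurable_loopKernel {R : ℂ → ℂ} {r c : ℝ} (hR : DifferentiableOn ℂ R (slitRegion r))
    (hc : r < c) : Measurable (loopKernel R c) := by
  have hexp : ∀ s : ℝ → ℂ, Continuous s → Continuous (fun t : ℝ => R (s t)) → ∀ I : Set ℝ,
      Measurable fun y : ℝ => ∫ t in I, R (s t) * Complex.exp (s t * y) := by
    intro s hs hRs I
    refine StronglyMeasurable.measurable (StronglyMeasurable.integral_prod_right
      (f := fun y t : ℝ => R (s t) * Complex.exp (s t * y)) (Continuous.stronglyMeasurable ?_))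
    simp only [Function.uncurry_def]
    have h2 : Continuous fun p : ℝ × ℝ => R (s p.2) := hRs.comp continuous_snd
    have h3 : Continuous fun p : ℝ × ℝ => s p.2 := hs.comp continuous_snd
    exact h2.mul (Complex.continuous_exp.comp
      (h3.mul (Complex.continuous_ofReal.comp continuous_fst)))
  unfold loopKernel loopIntegral
  refine Measurable.const_mul ?_ _
  refine (Measurable.add ?_ (Measurable.const_mul ?_ _)).sub ?_
  · exact hexp (fun t : ℝ => (t : ℂ) + ((-1 : ℝ) : ℂ) * Complex.I) (by fun_prop)
      (continuous_line hR (by norm_num)) _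
  · simp only [intervalIntegral.integral_of_le (by norm_num : (-1 : ℝ) ≤ 1)]
    exact hexp (fun t : ℝ => (c : ℂ) + (t : ℂ) * Complex.I) (by fun_prop)
      (continuous_vertical hR hc) _
  · exact hexp (fun t : ℝ => (t : ℂ) + ((1 : ℝ) : ℂ) * Complex.I) (by fun_prop)
      (continuous_line hR (by norm_num)) _

/-- The area integral against a power times a Meijer function of `|z|² / θ`. -/
theorem area_integral_meijerG {u v : ℕ → ℂ} {F H : ℂ → ℂ} {θ : ℝ} (hθ : 0 < θ)
    (hF : IsPowerSeriesOn u F (Real.sqrt θ)) (hH : IsPowerSeriesOn v H (Real.sqrt θ))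
    {as bs : List ℝ} (hlen : as.length = bs.length)
    (hsum : bs.sum < as.sum) {r w : ℝ} (hr : r < 1) (hw : r < w)
    (hpole : ∀ x : ℝ, r < x → poleCount bs x ≤ poleCount as x)
    (hreg : ∀ k : ℕ, ∀ β ∈ bs, ∀ n : ℕ, β + (w + k) ≠ -n)
    (hu : Summable fun k : ℕ => ‖u k‖ ^ 2 * θ ^ k * ((k : ℝ) + 1) ^ (-(as.sum - bs.sum)))
    (hv : Summable fun k : ℕ => ‖v k‖ ^ 2 * θ ^ k * ((k : ℝ) + 1) ^ (-(as.sum - bs.sum))) :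
    IntegrableOn (fun z : ℂ => F z * conj (H z) *
        ((((‖z‖ ^ 2 / θ) ^ (w - 1) : ℝ) : ℂ) * meijerG as bs (‖z‖ ^ 2 / θ)))
        (Metric.ball 0 (Real.sqrt θ)) ∧
      HasSum (fun k : ℕ => Real.pi * θ * (u k * conj (v k) * θ ^ k *
          gammaRatio as bs ((w + k : ℝ) : ℂ)))
        (∫ z in Metric.ball (0 : ℂ) (Real.sqrt θ), F z * conj (H z) *
          ((((‖z‖ ^ 2 / θ) ^ (w - 1) : ℝ) : ℂ) * meijerG as bs (‖z‖ ^ 2 / θ))) := by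
  obtain ⟨R, hR, hRe⟩ := exists_mellinSymbol hlen hpole
  obtain ⟨hmom, C, hC, hbound⟩ := meijerG_moments hlen hsum hr hw hpole hreg
  have hVm : Measurable (loopKernel R (loopVertex bs)) :=
    measurable_loopKernel hR.differentiableOn (hr.trans_le (one_le_loopVertex bs))
  -- The loop kernel of the regularized symbol replaces `meijerG`: it is measurable on the whole
  -- line and gives the same values for `x > 0`.
  set W : ℝ → ℂ := fun x => ((x ^ (w - 1) : ℝ) : ℂ) * loopKernel R (loopVertex bs) (-Real.log x)
    with hWdef
  have hW : Measurable W := by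
    refine Measurable.mul (by fun_prop) (hVm.comp (by fun_prop))
  have hWe : ∀ x : ℝ, 0 < x → ((x ^ (w - 1) : ℝ) : ℂ) * meijerG as bs x = W x := fun x hx => by
    rw [hWdef, meijerG_eq_loopKernel hRe hx]
  have hWint : ∀ k : ℕ, IntegrableOn (fun x : ℝ => (x : ℂ) ^ k * W x) (Set.Ioo 0 1) := fun k =>
    (hmom k).1.congr_fun (fun x hx => by simp only [hWe x hx.1]) measurableSet_Ioo
  have hWmom : ∀ k : ℕ, ∫ x in Set.Ioo (0 : ℝ) 1, (x : ℂ) ^ k * W x =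
      gammaRatio as bs ((w + k : ℝ) : ℂ) := fun k => by
    rw [← (hmom k).2]
    exact setIntegral_congr_fun measurableSet_Ioo fun x hx => by simp only [hWe x hx.1]
  have hWabs : ∀ k : ℕ, ∫ x in Set.Ioo (0 : ℝ) 1, x ^ k * ‖W x‖ ≤
      C * ((k : ℝ) + 1) ^ (-(as.sum - bs.sum)) := fun k => by
    refine le_trans (le_of_eq ?_) (hbound k)
    exact setIntegral_congr_fun measurableSet_Ioo fun x hx => by simp only [hWe x hx.1]
  have hS : ∀ u : ℕ → ℂ,
      Summable (fun k : ℕ => ‖u k‖ ^ 2 * θ ^ k * ((k : ℝ) + 1) ^ (-(as.sum - bs.sum))) →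
      Summable fun k : ℕ => ‖u k‖ ^ 2 * θ ^ k * ∫ x in Set.Ioo (0 : ℝ) 1, x ^ k * ‖W x‖ := by
    intro u hu
    refine Summable.of_nonneg_of_le (fun k => ?_) (fun k => ?_) (hu.mul_left C)
    · have : 0 ≤ ∫ x in Set.Ioo (0 : ℝ) 1, x ^ k * ‖W x‖ :=
        setIntegral_nonneg measurableSet_Ioo fun x hx => by
          have := hx.1
          positivity
      positivity
    · calc ‖u k‖ ^ 2 * θ ^ k * ∫ x in Set.Ioo (0 : ℝ) 1, x ^ k * ‖W x‖
          ≤ ‖u k‖ ^ 2 * θ ^ k * (C * ((k : ℝ) + 1) ^ (-(as.sum - bs.sum))) := by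
            gcongr
            exact hWabs k
        _ = _ := by ring
  obtain ⟨h1, h2⟩ := area_integral hθ hF hH hW hWint (hS u hu) (hS v hv)
  have hae : (fun z : ℂ => F z * conj (H z) * W (‖z‖ ^ 2 / θ)) =ᵐ[volume.restrict
      (Metric.ball 0 (Real.sqrt θ))] fun z : ℂ => F z * conj (H z) *
        ((((‖z‖ ^ 2 / θ) ^ (w - 1) : ℝ) : ℂ) * meijerG as bs (‖z‖ ^ 2 / θ)) := by
    refine ae_restrict_of_ae ?_
    -- The two weights may differ at `x = 0`, which corresponds to the single point `z = 0`.
    have h0 : ∀ᵐ z : ℂ, z ≠ 0 := by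
      simp [ae_iff]
    filter_upwards [h0] with z hz
    have : 0 < ‖z‖ := norm_pos_iff.mpr hz
    rw [hWe _ (by positivity)]
  refine ⟨h1.congr hae, ?_⟩
  rw [← integral_congr_ae hae]
  simpa only [hWmom] using h2

section

/-! ### Sequences of power-like growth -/

/-- The sequence `f` has no zeros and its modulus is comparable with `(k + 1)^e`. -/
def IsPowerLike (f : ℕ → ℝ) (e : ℝ) : Prop :=
  ∃ C : ℝ, 0 < C ∧ ∀ k : ℕ, ((k : ℝ) + 1) ^ e ≤ C * |f k| ∧ |f k| ≤ C * ((k : ℝ) + 1) ^ e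

lemma rpow_succ_pos (e : ℝ) (k : ℕ) : 0 < ((k : ℝ) + 1) ^ e := by positivity

namespace IsPowerLike

lemma abs_pos {f : ℕ → ℝ} {e : ℝ} (h : IsPowerLike f e) (k : ℕ) : 0 < |f k| := by
  obtain ⟨C, hC, hf⟩ := h
  exact pos_of_mul_pos_right ((rpow_succ_pos e k).trans_le (hf k).1) hC.le

lemma mul {f g : ℕ → ℝ} {d e : ℝ} (hf : IsPowerLike f d) (hg : IsPowerLike g e) :
    IsPowerLike (fun k => f k * g k) (d + e) := by
  obtain ⟨C, hC, hf⟩ := hf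
  obtain ⟨C', hC', hg⟩ := hg
  refine ⟨C * C', by positivity, fun k => ?_⟩
  have hk : (0 : ℝ) < (k : ℝ) + 1 := by positivity
  rw [Real.rpow_add hk, abs_mul]
  constructor
  · calc _ ≤ (C * |f k|) * (C' * |g k|) := by
          gcongr
          exacts [(hf k).1, (hg k).1]
      _ = _ := by ring
  · calc _ ≤ (C * ((k : ℝ) + 1) ^ d) * (C' * ((k : ℝ) + 1) ^ e) := by
          gcongr
          exacts [(hf k).2, (hg k).2]
      _ = _ := by ring

lemma inv {f : ℕ → ℝ} {e : ℝ} (hf : IsPowerLike f e) : IsPowerLike (fun k => (f k)⁻¹) (-e) := by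
  have hpos := hf.abs_pos
  obtain ⟨C, hC, hf⟩ := hf
  refine ⟨C, hC, fun k => ?_⟩
  have hk : (0 : ℝ) < (k : ℝ) + 1 := by positivity
  have h1 := rpow_succ_pos e k
  have h2 := hpos k
  rw [Real.rpow_neg hk.le, abs_inv]
  constructor
  · rw [← div_eq_mul_inv, le_div_iff₀ h2, inv_mul_le_iff₀ h1, mul_comm]
    exact (hf k).2
  · rw [← div_eq_mul_inv, le_div_iff₀ h1, inv_mul_le_iff₀ h2, mul_comm]
    exact (hf k).1

lemma one : IsPowerLike (fun _ => 1) 0 := ⟨1, one_pos, fun k => by simp⟩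

lemma prod {ι : Type*} (s : Finset ι) {f : ι → ℕ → ℝ} {e : ι → ℝ}
    (h : ∀ i ∈ s, IsPowerLike (f i) (e i)) :
    IsPowerLike (fun k => ∏ i ∈ s, f i k) (∑ i ∈ s, e i) := by
  classical
  induction s using Finset.induction_on with
  | empty => simpa using one
  | insert i s hi ih =>
    simp only [Finset.prod_insert hi, Finset.sum_insert hi]
    exact (h i (by simp)).mul (ih fun j hj => h j (by simp [hj]))

/-- The quotient and its inverse both converge, hence both are bounded; the nonvanishing of every
term takes care of the finitely many small `k`. -/
lemma of_tendsto {f : ℕ → ℝ} {e L : ℝ} (hf : ∀ k, f k ≠ 0) (hL : L ≠ 0)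
    (h : Tendsto (fun k : ℕ => f k / ((k : ℝ) + 1) ^ e) atTop (𝓝 L)) : IsPowerLike f e := by
  obtain ⟨A, hA⟩ := h.abs.bddAbove_range
  obtain ⟨B, hB⟩ := (h.abs.inv₀ (by simpa using hL)).bddAbove_range
  refine ⟨max 1 (max A B), by positivity, fun k => ?_⟩
  have h1 := rpow_succ_pos e k
  have h2 : 0 < |f k| := _root_.abs_pos.mpr (hf k)
  have hAk : |f k / ((k : ℝ) + 1) ^ e| ≤ A := hA ⟨k, rfl⟩
  have hBk : |f k / ((k : ℝ) + 1) ^ e|⁻¹ ≤ B := hB ⟨k, rfl⟩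
  rw [abs_div, abs_of_pos h1] at hAk hBk
  rw [inv_div, div_le_iff₀ h2] at hBk
  rw [div_le_iff₀ h1] at hAk
  constructor
  · refine hBk.trans ?_
    gcongr
    exact (le_max_right _ _).trans (le_max_right _ _)
  · refine hAk.trans ?_
    gcongr
    exact (le_max_left _ _).trans (le_max_right _ _)

end IsPowerLike

/-! ### Pochhammer symbols -/

lemma poch_zero (x : ℝ) : poch x 0 = 1 := by simp [poch]

lemma poch_succ (x : ℝ) (k : ℕ) : poch x (k + 1) = poch x k * (x + k) :=
  ascPochhammer_succ_eval k x

lemma poch_eq_prod (x : ℝ) (k : ℕ) : poch x k = ∏ j ∈ Finset.range k, (x + j) := by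
  induction k with
  | zero => simp [poch_zero]
  | succ k ih => rw [poch_succ, ih, Finset.prod_range_succ]

lemma poch_ne_zero {x : ℝ} (hx : ∀ n : ℕ, x ≠ -n) (k : ℕ) : poch x k ≠ 0 := by
  rw [poch_eq_prod]
  exact Finset.prod_ne_zero_iff.mpr fun j _ h => hx j (by linarith)

lemma Gamma_add_nat {x : ℝ} (hx : ∀ n : ℕ, x ≠ -n) (k : ℕ) :
    Real.Gamma (x + k) = poch x k * Real.Gamma x := by
  induction k with
  | zero => simp [poch_zero]
  | succ k ih =>
    have h : x + k ≠ 0 := fun h => hx k (by linarith)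
    rw [poch_succ, Nat.cast_succ, ← add_assoc, Real.Gamma_add_one h, ih]
    ring

/-- Euler's sequence is `n^x n! / (x)_(n+1)`, so after a shift of the index by one the quotient is
the inverse of that sequence times elementary factors tending to `1`. -/
lemma isPowerLike_poch {x : ℝ} (hx : ∀ n : ℕ, x ≠ -n) :
    IsPowerLike (fun k => poch x k / k.factorial) (x - 1) := by
  have hΓ : Real.Gamma x ≠ 0 := Real.Gamma_ne_zero hx
  refine IsPowerLike.of_tendsto (L := (Real.Gamma x)⁻¹)
    (fun k => div_ne_zero (poch_ne_zero hx k) (by positivity)) (inv_ne_zero hΓ) ?_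
  rw [← tendsto_add_atTop_iff_nat 1]
  have h1 := (Real.GammaSeq_tendsto_Gamma x).inv₀ hΓ
  have h2 : Tendsto (fun n : ℕ => (n : ℝ) / (n + 1)) atTop (𝓝 1) :=
    tendsto_natCast_div_add_atTop (1 : ℝ)
  have h3 : Tendsto (fun n : ℕ => (n : ℝ) / (n + 2)) atTop (𝓝 1) :=
    tendsto_natCast_div_add_atTop (2 : ℝ)
  have h4 := h1.mul (h2.mul (h3.rpow_const (p := x - 1) (Or.inl one_ne_zero)))
  rw [Real.one_rpow, mul_one, mul_one] at h4
  refine h4.congr' ?_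
  filter_upwards [eventually_ge_atTop 1] with n hn
  have hn0 : (0 : ℝ) < n := by exact_mod_cast hn
  have hp := poch_ne_zero hx (n + 1)
  have e1 : (n : ℝ) ^ x = n * (n : ℝ) ^ (x - 1) := by
    rw [Real.rpow_sub_one hn0.ne']
    field_simp
  rw [Real.GammaSeq, ← poch_eq_prod, Real.div_rpow hn0.le (by positivity), e1,
    Nat.factorial_succ]
  have h5 : (0 : ℝ) < (n : ℝ) ^ (x - 1) := by positivity
  have h6 : (0 : ℝ) < ((n : ℝ) + 2) ^ (x - 1) := by positivity
  push_cast
  rw [show (n : ℝ) + 1 + 1 = n + 2 by ring]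
  field_simp

variable {p : ℕ}

lemma coeffWeight_ne_zero {a : Fin p → ℝ} {b : Fin (p - 1) → ℝ} {θ : ℝ} (hθ : 0 < θ)
    (ha : ∀ i, ∀ n : ℕ, a i ≠ -(n : ℝ)) (hb : ∀ i, ∀ n : ℕ, b i ≠ -(n : ℝ)) (k : ℕ) :
    coeffWeight a b θ k ≠ 0 := by
  have h1 : ∏ i, poch (a i) k ≠ 0 := Finset.prod_ne_zero_iff.mpr fun i _ => poch_ne_zero (ha i) k
  have h2 : ∏ i, poch (b i) k ≠ 0 := Finset.prod_ne_zero_iff.mpr fun i _ => poch_ne_zero (hb i) k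
  unfold coeffWeight
  positivity

/-- The single `k!` of the weight makes the factorials match: `p` upper and `p - 1` lower Pochhammer
symbols can each be divided by `k!`, and `∑ (b - 1) - ∑ (a - 1) = ∑ b + 1 - ∑ a`. -/
lemma isPowerLike_coeffWeight (hp : 1 ≤ p) {a : Fin p → ℝ} {b : Fin (p - 1) → ℝ} {θ : ℝ}
    (hθ : 0 < θ)
    (ha : ∀ i, ∀ n : ℕ, a i ≠ -(n : ℝ)) (hb : ∀ i, ∀ n : ℕ, b i ≠ -(n : ℝ)) :
    IsPowerLike (fun k => coeffWeight a b θ k / θ ^ k) ((∑ i, b i) + 1 - ∑ i, a i) := by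
  have h := (IsPowerLike.prod Finset.univ fun i _ => isPowerLike_poch (hb i)).mul
    (IsPowerLike.prod Finset.univ fun i _ => isPowerLike_poch (ha i)).inv
  have e1 : (∑ i, (b i - 1)) + -∑ i, (a i - 1) = (∑ i, b i) + 1 - ∑ i, a i := by
    simp only [Finset.sum_sub_distrib, Finset.sum_const, Finset.card_univ, Fintype.card_fin,
      nsmul_eq_mul, mul_one, Nat.cast_sub hp]
    push_cast
    ring
  rw [e1] at h
  convert h using 2 with k
  simp only [Finset.prod_div_distrib, Finset.prod_const, Finset.card_univ, Fintype.card_fin,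
    coeffWeight]
  have hf : (k.factorial : ℝ) ^ p = k.factorial ^ (p - 1) * k.factorial := by
    rw [← pow_succ, Nat.sub_add_cancel hp]
  rw [hf]
  have h1 : ∏ i, poch (a i) k ≠ 0 := Finset.prod_ne_zero_iff.mpr fun i _ => poch_ne_zero (ha i) k
  field_simp

lemma isPowerLike_of_eq {f g : ℕ → ℝ} {d e : ℝ} (h : IsPowerLike f d) (hfg : f = g) (hde : d = e) :
    IsPowerLike g e := hfg ▸ hde ▸ h

lemma summable_rpow_mul_geometric (e : ℝ) {q : ℝ} (hq0 : 0 ≤ q) (hq : q < 1) :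
    Summable fun k : ℕ => ((k : ℝ) + 1) ^ e * q ^ k := by
  obtain ⟨N, hN⟩ := exists_nat_ge e
  set s := (q + 1) / 2
  have hs0 : 0 < s := by positivity
  have hs1 : s < 1 := by simp only [s]; linarith
  have h1 : Summable fun k : ℕ => ((k : ℝ)) ^ N * s ^ k :=
    summable_pow_mul_geometric_of_norm_lt_one N (by rwa [Real.norm_of_nonneg hs0.le])
  have h2 := ((summable_nat_add_iff 1).mpr h1).mul_right s⁻¹
  refine Summable.of_nonneg_of_le (fun k => by positivity) (fun k => ?_) h2
  have h3 : ((k : ℝ) + 1) ^ e ≤ ((k : ℝ) + 1) ^ N := by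
    rw [← Real.rpow_natCast]
    exact Real.rpow_le_rpow_of_exponent_le (by linarith [k.cast_nonneg (α := ℝ)]) hN
  have h4 : q ^ k ≤ s ^ k := by
    gcongr
    simp only [s]
    linarith
  push_cast
  rw [pow_succ, mul_assoc, mul_assoc (s ^ k), mul_inv_cancel₀ hs0.ne', mul_one]
  gcongr

/-! ### Power series -/

lemma hasSum_taylorCoeff {F : ℂ → ℂ} {R : ℝ} (hF : DifferentiableOn ℂ F (Metric.ball 0 R))
    {z : ℂ} (hz : ‖z‖ < R) : HasSum (fun k => taylorCoeff F k * z ^ k) (F z) := by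
  have h := Complex.hasSum_taylorSeries_on_ball hF (z := z) (by simpa using hz)
  refine (congrArg (fun f => HasSum f _) (funext fun k => ?_)).mpr h
  simp only [taylorCoeff, smul_eq_mul, sub_zero]
  ring

lemma isPowerSeriesOn_taylorCoeff {F : ℂ → ℂ} {R : ℝ}
    (hF : DifferentiableOn ℂ F (Metric.ball 0 R)) : IsPowerSeriesOn (taylorCoeff F) F R :=
  ⟨hF.continuousOn, fun _ hz => hasSum_taylorCoeff hF hz⟩

lemma taylorCoeff_eq_of_hasSum {F : ℂ → ℂ} {u : ℕ → ℂ} {R : ℝ} (hR : 0 < R)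
    (h : ∀ z : ℂ, ‖z‖ < R → HasSum (fun k => u k * z ^ k) (F z)) : taylorCoeff F = u := by
  have h1 : HasFPowerSeriesAt F (FormalMultilinearSeries.ofScalars ℂ u) 0 := by
    rw [hasFPowerSeriesAt_iff]
    filter_upwards [Metric.ball_mem_nhds (0 : ℂ) hR] with z hz
    simpa [FormalMultilinearSeries.coeff_ofScalars, mul_comm] using h z (by simpa using hz)
  have h2 := h1.eq_formalMultilinearSeries h1.analyticAt.hasFPowerSeriesAt
  have h3 := FormalMultilinearSeries.ofScalars_series_injective ℂ ℂ h2
  exact h3.symm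

lemma differentiableOn_of_hasSum {F : ℂ → ℂ} {u : ℕ → ℂ} {R : ℝ}
    (h : ∀ z : ℂ, ‖z‖ < R → HasSum (fun k => u k * z ^ k) (F z)) :
    DifferentiableOn ℂ F (Metric.ball 0 R) := by
  intro z hz
  rw [mem_ball_zero_iff] at hz
  obtain ⟨r, hzr, hrR⟩ := exists_between hz
  have hr0 : 0 ≤ r := (norm_nonneg z).trans hzr.le
  have hs : Summable fun k => ‖u k‖ * r ^ k := by
    have := (h (r : ℂ) (by rwa [Complex.norm_real, Real.norm_of_nonneg hr0])).summable.norm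
    simpa [abs_of_nonneg hr0] using this
  have hd : DifferentiableOn ℂ (fun w : ℂ => ∑' k, u k * w ^ k) (Metric.ball 0 r) := by
    refine Complex.differentiableOn_tsum_of_summable_norm hs (fun k => by fun_prop)
      Metric.isOpen_ball fun k w hw => ?_
    rw [mem_ball_zero_iff] at hw
    rw [norm_mul, norm_pow]
    gcongr
  have hmem : Metric.ball (0 : ℂ) r ∈ 𝓝 z := Metric.isOpen_ball.mem_nhds (by simpa using hzr)
  refine ((hd.differentiableAt hmem).congr_of_eventuallyEq ?_).differentiableWithinAt
  filter_upwards [hmem] with w hw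
  rw [mem_ball_zero_iff] at hw
  exact (h w (hw.trans hrR)).tsum_eq.symm

lemma differentiableOn_iteratedDeriv {F : ℂ → ℂ} {U : Set ℂ} (hU : IsOpen U)
    (hF : DifferentiableOn ℂ F U) (l : ℕ) : DifferentiableOn ℂ (iteratedDeriv l F) U := by
  induction l with
  | zero => simpa using hF
  | succ l ih =>
    rw [iteratedDeriv_succ]
    exact ih.deriv hU

lemma taylorCoeff_iteratedDeriv (F : ℂ → ℂ) (l k : ℕ) :
    taylorCoeff (iteratedDeriv l F) k =
      ((k + l).factorial / k.factorial : ℝ) * taylorCoeff F (k + l) := by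
  have e : iteratedDeriv k (iteratedDeriv l F) = iteratedDeriv (k + l) F := by
    simp only [iteratedDeriv_eq_iterate, Function.iterate_add_apply]
  have h1 : ((k + l).factorial : ℂ) ≠ 0 := by exact_mod_cast (k + l).factorial_ne_zero
  rw [taylorCoeff, taylorCoeff, e]
  push_cast
  field_simp

lemma differentiableOn_Dz {F : ℂ → ℂ} {U : Set ℂ} (hU : IsOpen U)
    (hF : DifferentiableOn ℂ F U) : DifferentiableOn ℂ (Dz F) U :=
  (differentiableOn_id.mul hF).deriv hU

lemma taylorCoeff_Dz {F : ℂ → ℂ} {R : ℝ} (hR : 0 < R)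
    (hF : DifferentiableOn ℂ F (Metric.ball 0 R)) (k : ℕ) :
    taylorCoeff (Dz F) k = ((k : ℂ) + 1) * taylorCoeff F k := by
  have h1 : taylorCoeff (fun w => w * F w) =
      fun k => if k = 0 then 0 else taylorCoeff F (k - 1) := by
    refine taylorCoeff_eq_of_hasSum hR fun z hz => ?_
    rw [← hasSum_nat_add_iff' 1]
    simpa [pow_succ, mul_assoc, mul_comm, mul_left_comm] using
      (hasSum_taylorCoeff hF hz).mul_left z
  have h2 := taylorCoeff_iteratedDeriv (fun w => w * F w) 1 k
  rw [iteratedDeriv_one, h1] at h2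
  have h3 : Dz F = deriv fun w => w * F w := rfl
  rw [h3, h2, Nat.factorial_succ]
  have : (k.factorial : ℂ) ≠ 0 := by exact_mod_cast k.factorial_ne_zero
  simp only [Nat.add_eq_zero_iff, one_ne_zero, and_false, if_false, Nat.add_sub_cancel]
  push_cast
  field_simp

lemma differentiableOn_iterate_Dz {F : ℂ → ℂ} {R : ℝ}
    (hF : DifferentiableOn ℂ F (Metric.ball 0 R)) (l : ℕ) :
    DifferentiableOn ℂ (Dz^[l] F) (Metric.ball 0 R) := by
  induction l with
  | zero => simpa using hF
  | succ l ih =>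
    rw [Function.iterate_succ_apply']
    exact differentiableOn_Dz Metric.isOpen_ball ih

lemma taylorCoeff_iterate_Dz {F : ℂ → ℂ} {R : ℝ} (hR : 0 < R)
    (hF : DifferentiableOn ℂ F (Metric.ball 0 R)) (l k : ℕ) :
    taylorCoeff (Dz^[l] F) k = ((k : ℂ) + 1) ^ l * taylorCoeff F k := by
  induction l with
  | zero => simp
  | succ l ih =>
    rw [Function.iterate_succ_apply', taylorCoeff_Dz hR (differentiableOn_iterate_Dz hF l), ih]
    ring

end

section

/-! ### The Hilbert majorant of a Krein space -/

namespace FormSpace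

variable {D : Set ℂ} {S : FormSpace D} {P N : Submodule ℂ S.carrier}

namespace IsFundamentalDecomposition

/-- The space with the norm `([Pf, Pf] - [Nf, Nf])^(1/2)`. -/
def Majorant (_h : S.IsFundamentalDecomposition P N) : Type := S.carrier

instance (h : S.IsFundamentalDecomposition P N) : AddCommGroup h.Majorant :=
  inferInstanceAs (AddCommGroup S.carrier)

instance (h : S.IsFundamentalDecomposition P N) : Module ℂ h.Majorant :=
  inferInstanceAs (Module ℂ S.carrier)

/-- The identity map to the majorant. -/
def maj (h : S.IsFundamentalDecomposition P N) : S.carrier ≃ₗ[ℂ] h.Majorant :=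
  LinearEquiv.refl ℂ S.carrier

/-- The component in the positive part. -/
def pos (h : S.IsFundamentalDecomposition P N) : S.carrier →ₗ[ℂ] S.carrier :=
  P.projection N h.2.1

/-- The component in the negative part. -/
def neg (h : S.IsFundamentalDecomposition P N) : S.carrier →ₗ[ℂ] S.carrier :=
  N.projection P h.2.1.symm

lemma pos_mem (h : S.IsFundamentalDecomposition P N) (f : S.carrier) : h.pos f ∈ P :=
  Submodule.projection_apply_mem _ _

lemma neg_mem (h : S.IsFundamentalDecomposition P N) (f : S.carrier) : h.neg f ∈ N :=
  Submodule.projection_apply_mem _ _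

lemma pos_add_neg (h : S.IsFundamentalDecomposition P N) (f : S.carrier) :
    h.pos f + h.neg f = f :=
  Submodule.projection_add_projection_eq_self _ _

lemma pos_of_mem (h : S.IsFundamentalDecomposition P N) {f : S.carrier} (hf : f ∈ P) :
    h.pos f = f := Submodule.projection_apply_of_mem_left _ hf

lemma neg_of_mem (h : S.IsFundamentalDecomposition P N) {f : S.carrier} (hf : f ∈ N) :
    h.neg f = f := Submodule.projection_apply_of_mem_left _ hf

lemma pos_of_mem_neg (h : S.IsFundamentalDecomposition P N) {f : S.carrier} (hf : f ∈ N) :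
    h.pos f = 0 := (Submodule.projection_apply_eq_zero_iff h.2.1).mpr hf

lemma neg_of_mem_pos (h : S.IsFundamentalDecomposition P N) {f : S.carrier} (hf : f ∈ P) :
    h.neg f = 0 := (Submodule.projection_apply_eq_zero_iff h.2.1.symm).mpr hf

lemma form_conj (h : S.IsFundamentalDecomposition P N) (f g : S.carrier) :
    conj (S.form g f) = S.form f g := (h.1 f g).symm

lemma form_pos_neg (h : S.IsFundamentalDecomposition P N) {f g : S.carrier} (hf : f ∈ P)
    (hg : g ∈ N) : S.form f g = 0 := h.2.2.1 f hf g hg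

lemma form_neg_pos (h : S.IsFundamentalDecomposition P N) {f g : S.carrier} (hf : f ∈ N)
    (hg : g ∈ P) : S.form f g = 0 := by
  rw [h.1, h.form_pos_neg hg hf, map_zero]

lemma form_eq (h : S.IsFundamentalDecomposition P N) (f g : S.carrier) :
    S.form f g = S.form (h.pos f) (h.pos g) + S.form (h.neg f) (h.neg g) := by
  conv_lhs => rw [← h.pos_add_neg f, ← h.pos_add_neg g]
  simp only [map_add, LinearMap.add_apply, h.form_pos_neg (h.pos_mem f) (h.neg_mem g),
    h.form_neg_pos (h.neg_mem f) (h.pos_mem g)]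
  ring

lemma form_self_nonneg (h : S.IsFundamentalDecomposition P N) {f : S.carrier} (hf : f ∈ P) :
    0 ≤ (S.form f f).re := by
  rcases eq_or_ne f 0 with rfl | h0
  · simp
  · simpa using (h.2.2.2.1.1 f hf h0).le

lemma form_self_nonpos (h : S.IsFundamentalDecomposition P N) {f : S.carrier} (hf : f ∈ N) :
    (S.form f f).re ≤ 0 := by
  rcases eq_or_ne f 0 with rfl | h0
  · simp
  · simpa using (h.2.2.2.2.1 f hf h0).le

lemma eq_zero_of_nonpos (h : S.IsFundamentalDecomposition P N) {f : S.carrier} (hf : f ∈ P)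
    (h0 : (S.form f f).re ≤ 0) : f = 0 := by
  by_contra hne
  have := h.2.2.2.1.1 f hf hne
  linarith

lemma eq_zero_of_nonneg (h : S.IsFundamentalDecomposition P N) {f : S.carrier} (hf : f ∈ N)
    (h0 : 0 ≤ (S.form f f).re) : f = 0 := by
  by_contra hne
  have := h.2.2.2.2.1 f hf hne
  linarith

/-- The inner product of the majorant. -/
@[reducible]
def majCore (h : S.IsFundamentalDecomposition P N) : InnerProductSpace.Core ℂ h.Majorant where
  -- The arguments are exchanged because `inner` is conjugate-linear in the first slot, whereas the
  -- form is linear there.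
  inner x y := S.form (h.pos (h.maj.symm y)) (h.pos (h.maj.symm x)) -
    S.form (h.neg (h.maj.symm y)) (h.neg (h.maj.symm x))
  conj_inner_symm x y := by
    simp only [map_sub, h.form_conj]
  re_inner_nonneg x := by
    have h1 := h.form_self_nonneg (h.pos_mem (h.maj.symm x))
    have h2 := h.form_self_nonpos (h.neg_mem (h.maj.symm x))
    simp only [map_sub, RCLike.re_to_complex]
    linarith
  add_left x y z := by
    simp only [map_add]
    ring
  smul_left x y r := by
    simp only [map_smul, LinearMap.map_smulₛₗ, smul_eq_mul]
    ring
  definite x hx := by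
    have h1 := h.form_self_nonneg (h.pos_mem (h.maj.symm x))
    have h2 := h.form_self_nonpos (h.neg_mem (h.maj.symm x))
    have h3 := congrArg Complex.re hx
    simp only [Complex.sub_re, Complex.zero_re] at h3
    have h4 := h.eq_zero_of_nonpos (h.pos_mem (h.maj.symm x)) (by linarith)
    have h5 := h.eq_zero_of_nonneg (h.neg_mem (h.maj.symm x)) (by linarith)
    have h6 := h.pos_add_neg (h.maj.symm x)
    rw [h4, h5, add_zero] at h6
    exact h.maj.symm.map_eq_zero_iff.mp h6.symm

instance (h : S.IsFundamentalDecomposition P N) : NormedAddCommGroup h.Majorant :=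
  h.majCore.toNormedAddCommGroup

instance (h : S.IsFundamentalDecomposition P N) : InnerProductSpace ℂ h.Majorant :=
  InnerProductSpace.ofCore h.majCore.toCore

lemma inner_maj (h : S.IsFundamentalDecomposition P N) (f g : S.carrier) :
    inner ℂ (h.maj f) (h.maj g) =
      S.form (h.pos g) (h.pos f) - S.form (h.neg g) (h.neg f) := rfl

lemma norm_maj_sq (h : S.IsFundamentalDecomposition P N) (f : S.carrier) :
    ‖h.maj f‖ ^ 2 = (S.form (h.pos f) (h.pos f)).re - (S.form (h.neg f) (h.neg f)).re := by
  rw [← inner_self_eq_norm_sq (𝕜 := ℂ), inner_maj]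
  simp

/-- The fundamental symmetry. -/
def symm (h : S.IsFundamentalDecomposition P N) (f : S.carrier) : S.carrier := h.pos f - h.neg f

lemma pos_symm (h : S.IsFundamentalDecomposition P N) (f : S.carrier) :
    h.pos (h.symm f) = h.pos f := by
  rw [symm, map_sub, h.pos_of_mem (h.pos_mem f), h.pos_of_mem_neg (h.neg_mem f), sub_zero]

lemma neg_symm (h : S.IsFundamentalDecomposition P N) (f : S.carrier) :
    h.neg (h.symm f) = -h.neg f := by
  rw [symm, map_sub, h.neg_of_mem (h.neg_mem f), h.neg_of_mem_pos (h.pos_mem f), zero_sub]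

/-- The form is the majorant inner product twisted by an isometric involution. This gives the
Cauchy–Schwarz inequality `norm_form_le` and the continuity of the form. -/
lemma inner_maj_symm (h : S.IsFundamentalDecomposition P N) (f g : S.carrier) :
    inner ℂ (h.maj f) (h.maj (h.symm g)) = S.form g f := by
  rw [inner_maj, pos_symm, neg_symm, h.form_eq g f, map_neg, LinearMap.neg_apply, sub_neg_eq_add]

lemma norm_maj_symm (h : S.IsFundamentalDecomposition P N) (f : S.carrier) :
    ‖h.maj (h.symm f)‖ = ‖h.maj f‖ := by
  refine (pow_left_inj₀ (norm_nonneg _) (norm_nonneg _) two_ne_zero).mp ?_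
  simp [norm_maj_sq, pos_symm, neg_symm]

lemma norm_form_le (h : S.IsFundamentalDecomposition P N) (f g : S.carrier) :
    ‖S.form f g‖ ≤ ‖h.maj f‖ * ‖h.maj g‖ := by
  rw [← inner_maj_symm, mul_comm, ← h.norm_maj_symm f]
  exact norm_inner_le_norm _ _

lemma norm_sq_eq (h : S.IsFundamentalDecomposition P N) (f : S.carrier) :
    ‖h.maj f‖ ^ 2 = (S.form f f).re + 2 * ‖h.maj (h.neg f)‖ ^ 2 := by
  rw [norm_maj_sq, norm_maj_sq, h.form_eq f f, h.pos_of_mem_neg (h.neg_mem f),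
    h.neg_of_mem (h.neg_mem f)]
  simp
  ring

lemma norm_maj_pos_le (h : S.IsFundamentalDecomposition P N) (f : S.carrier) :
    (S.form (h.pos f) (h.pos f)).re ≤ ‖h.maj f‖ ^ 2 := by
  rw [norm_maj_sq]
  linarith [h.form_self_nonpos (h.neg_mem f)]

lemma norm_maj_neg_le (h : S.IsFundamentalDecomposition P N) (f : S.carrier) :
    -(S.form (h.neg f) (h.neg f)).re ≤ ‖h.maj f‖ ^ 2 := by
  rw [norm_maj_sq]
  linarith [h.form_self_nonneg (h.pos_mem f)]

/-- The squared norm is the sum of the definite forms of the two components, so a Cauchy sequence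
has Cauchy components, and each converges in its own Hilbert space. -/
instance (h : S.IsFundamentalDecomposition P N) : CompleteSpace h.Majorant := by
  refine Metric.complete_of_cauchySeq_tendsto fun u hu => ?_
  set v : ℕ → S.carrier := fun n => h.maj.symm (u n) with hv
  have huv : ∀ n, u n = h.maj (v n) := fun n => (h.maj.apply_symm_apply (u n)).symm
  have hsmall : ∀ δ : ℝ, 0 < δ → ∃ n₀ : ℕ, ∀ i ≥ n₀, ∀ j ≥ n₀, ‖h.maj (v i - v j)‖ ^ 2 < δ := by
    intro δ hδ
    obtain ⟨n₀, hn⟩ := Metric.cauchySeq_iff.mp hu (Real.sqrt δ) (Real.sqrt_pos.mpr hδ)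
    refine ⟨n₀, fun i hi j hj => ?_⟩
    have := hn i hi j hj
    rw [dist_eq_norm, huv, huv, ← map_sub] at this
    exact (Real.lt_sqrt (norm_nonneg _)).mp this
  obtain ⟨f, hf, hfl⟩ := h.2.2.2.1.2 (fun n => h.pos (v n)) (fun n => h.pos_mem _) (by
    intro δ hδ
    obtain ⟨n₀, hn⟩ := hsmall δ hδ
    refine ⟨n₀, fun i hi j hj => ?_⟩
    rw [← map_sub, one_mul]
    exact (h.norm_maj_pos_le _).trans_lt (hn i hi j hj))
  obtain ⟨g, hg, hgl⟩ := h.2.2.2.2.2 (fun n => h.neg (v n)) (fun n => h.neg_mem _) (by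
    intro δ hδ
    obtain ⟨n₀, hn⟩ := hsmall δ hδ
    refine ⟨n₀, fun i hi j hj => ?_⟩
    rw [← map_sub, neg_one_mul]
    exact (h.norm_maj_neg_le _).trans_lt (hn i hi j hj))
  refine ⟨h.maj (f + g), ?_⟩
  rw [tendsto_iff_norm_sub_tendsto_zero]
  have hsq : Tendsto (fun n => ‖u n - h.maj (f + g)‖ ^ 2) atTop (𝓝 0) := by
    have hadd := hfl.add hgl
    rw [add_zero] at hadd
    refine hadd.congr fun n => ?_
    have e1 : h.pos (v n - (f + g)) = h.pos (v n) - f := by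
      rw [map_sub h.pos, map_add h.pos, h.pos_of_mem hf, h.pos_of_mem_neg hg, add_zero]
    have e2 : h.neg (v n - (f + g)) = h.neg (v n) - g := by
      rw [map_sub h.neg, map_add h.neg, h.neg_of_mem hg, h.neg_of_mem_pos hf, zero_add]
    rw [huv, ← map_sub, norm_maj_sq, e1, e2]
    ring
  have := hsq.sqrt
  rw [Real.sqrt_zero] at this
  exact this.congr fun n => Real.sqrt_sq (norm_nonneg _)

end IsFundamentalDecomposition

end FormSpace

end

-- Uniqueness of a Pontryagin space with a given reproducing kernel

section

namespace FormSpace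

variable {D : Set ℂ} {K : ℂ → ℂ → ℂ}

/-- The span of the kernel functions. -/
def kernelSpan (D : Set ℂ) (K : ℂ → ℂ → ℂ) : Submodule ℂ (D → ℂ) :=
  Submodule.span ℂ (Set.range fun u : D => fun z : D => K z u)

lemma HasReproducingKernel.kernelSpan_le {S : FormSpace D} (hK : S.HasReproducingKernel K) :
    kernelSpan D K ≤ S.carrier := by
  rw [kernelSpan, Submodule.span_le]
  rintro _ ⟨u, rfl⟩
  exact (hK u).1

/-- For `ψ = K(·, u)` both sides are `φ u`; the general case follows by conjugate-linearity in `ψ`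
alone. -/
lemma HasReproducingKernel.form_kernelSpan_eq {S S' : FormSpace D}
    (hK : S.HasReproducingKernel K) (hK' : S'.HasReproducingKernel K) {φ ψ : D → ℂ}
    (hφ : φ ∈ kernelSpan D K) (hψ : ψ ∈ kernelSpan D K) :
    S.form ⟨φ, hK.kernelSpan_le hφ⟩ ⟨ψ, hK.kernelSpan_le hψ⟩ =
      S'.form ⟨φ, hK'.kernelSpan_le hφ⟩ ⟨ψ, hK'.kernelSpan_le hψ⟩ := by
  induction hψ using Submodule.span_induction with
  | mem x hx =>
    obtain ⟨u, rfl⟩ := hx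
    exact ((hK u).2 ⟨φ, hK.kernelSpan_le hφ⟩).symm.trans ((hK' u).2 ⟨φ, hK'.kernelSpan_le hφ⟩)
  | zero =>
    have e1 : (⟨0, hK.kernelSpan_le (zero_mem _)⟩ : S.carrier) = 0 := rfl
    have e2 : (⟨0, hK'.kernelSpan_le (zero_mem _)⟩ : S'.carrier) = 0 := rfl
    rw [e1, e2, map_zero, map_zero]
  | add x y hx hy h1 h2 =>
    have e1 : (⟨x + y, hK.kernelSpan_le (add_mem hx hy)⟩ : S.carrier) =
      ⟨x, hK.kernelSpan_le hx⟩ + ⟨y, hK.kernelSpan_le hy⟩ := rfl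
    have e2 : (⟨x + y, hK'.kernelSpan_le (add_mem hx hy)⟩ : S'.carrier) =
      ⟨x, hK'.kernelSpan_le hx⟩ + ⟨y, hK'.kernelSpan_le hy⟩ := rfl
    rw [e1, e2, map_add, map_add, h1, h2]
  | smul r x hx h1 =>
    have e1 : (⟨r • x, hK.kernelSpan_le (Submodule.smul_mem _ r hx)⟩ : S.carrier) =
      r • ⟨x, hK.kernelSpan_le hx⟩ := rfl
    have e2 : (⟨r • x, hK'.kernelSpan_le (Submodule.smul_mem _ r hx)⟩ : S'.carrier) =
      r • ⟨x, hK'.kernelSpan_le hx⟩ := rfl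
    rw [e1, e2, LinearMap.map_smulₛₗ, LinearMap.map_smulₛₗ, h1]

namespace IsFundamentalDecomposition

variable {S : FormSpace D} {P N : Submodule ℂ S.carrier}

/-- If `g` is orthogonal to all kernel functions in the majorant, then the form of its image under
the fundamental symmetry with each `K(·, u)` is zero. By the reproducing property that image
vanishes at every point, hence `g = 0`, and the span is dense. -/
lemma exists_kernelSpan_near (h : S.IsFundamentalDecomposition P N)
    (hK : S.HasReproducingKernel K) (f : S.carrier) {η : ℝ} (hη : 0 < η) :
    ∃ φ : S.carrier, (φ : D → ℂ) ∈ kernelSpan D K ∧ ‖h.maj (φ - f)‖ < η := by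
  set M : Submodule ℂ h.Majorant :=
    ((kernelSpan D K).comap S.carrier.subtype).map h.maj.toLinearMap with hM
  have htop : M.topologicalClosure = ⊤ := by
    rw [Submodule.topologicalClosure_eq_top_iff, Submodule.eq_bot_iff]
    intro x hx
    set g := h.maj.symm x with hg
    have hxg : x = h.maj g := (h.maj.apply_symm_apply x).symm
    have hzero : h.symm g = 0 := by
      ext u
      obtain ⟨hu, hu'⟩ := hK u
      rw [hu']
      have h1 : h.maj ⟨fun z : D => K z u, hu⟩ ∈ M :=
        ⟨_, Submodule.subset_span ⟨u, rfl⟩, rfl⟩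
      have h2 := (Submodule.mem_orthogonal M x).mp hx _ h1
      rw [hxg, inner_maj] at h2
      rw [h.form_eq, pos_symm, neg_symm, map_neg, LinearMap.neg_apply, ← sub_eq_add_neg, h2]
      rfl
    have hpos : h.pos g = 0 := by rw [← h.pos_symm, hzero, map_zero]
    have hneg : h.neg g = 0 := by
      have := h.neg_symm g
      rw [hzero, map_zero] at this
      exact neg_eq_zero.mp this.symm
    rw [hxg, ← h.pos_add_neg g, hpos, hneg, add_zero, map_zero]
  have hmem : h.maj f ∈ closure (M : Set h.Majorant) := by
    rw [← Submodule.topologicalClosure_coe, htop]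
    trivial
  obtain ⟨y, ⟨φ, hφ, rfl⟩, hy⟩ := Metric.mem_closure_iff.mp hmem η hη
  refine ⟨φ, hφ, ?_⟩
  rw [dist_comm, dist_eq_norm] at hy
  rwa [map_sub]

/-- If the negative part is finite-dimensional, then the norm of the majorant is controlled by
the form and by the values of finitely many functionals that are represented by combinations of
kernel functions. -/
lemma exists_norm_sq_le (h : S.IsFundamentalDecomposition P N) [FiniteDimensional ℂ N]
    (hK : S.HasReproducingKernel K) :
    ∃ (k : ℕ) (m : Fin k → S.carrier), (∀ i, (m i : D → ℂ) ∈ kernelSpan D K) ∧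
      ∀ f : S.carrier, ‖h.maj f‖ ^ 2 ≤ 2 * ((S.form f f).re + 4 * ∑ i, ‖S.form f (m i)‖ ^ 2) := by
  set N' : Submodule ℂ h.Majorant := N.map h.maj.toLinearMap with hN'
  have : FiniteDimensional ℂ N' := inferInstance
  set e := stdOrthonormalBasis ℂ N' with he
  set k := Module.finrank ℂ N' with hk
  set e' : Fin k → S.carrier := fun i => h.maj.symm (e i : h.Majorant) with he'
  have hmaj : ∀ i, h.maj (e' i) = (e i : h.Majorant) := fun i => h.maj.apply_symm_apply _
  have he'N : ∀ i, e' i ∈ N := fun i => by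
    obtain ⟨y, hy, hye⟩ := (e i).2
    have : e' i = y := by
      rw [he']
      simp only
      rw [← hye]
      exact h.maj.symm_apply_apply y
    rwa [this]
  -- An orthonormal basis of the negative part is approximated in the span up to `η`. The total
  -- error `2 k η ‖f‖²` is at most `‖f‖² / 4`, and since the negative part enters `‖f‖²` with the
  -- factor `2`, half of `‖f‖²` can be absorbed on the left.
  set η : ℝ := 1 / (8 * (k + 1)) with hη
  have hη0 : 0 < η := by positivity
  have hη1 : η ≤ 1 := by
    rw [hη, div_le_one (by positivity)]
    linarith [k.cast_nonneg (α := ℝ)]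
  choose m hm hme using fun i => h.exists_kernelSpan_near hK (e' i) hη0
  refine ⟨k, m, hm, fun f => ?_⟩
  have hsum : ‖h.maj (h.neg f)‖ ^ 2 = ∑ i, ‖S.form f (e' i)‖ ^ 2 := by
    have hmem : h.maj (h.neg f) ∈ N' := ⟨_, h.neg_mem f, rfl⟩
    have h1 := e.sum_sq_norm_inner_right ⟨h.maj (h.neg f), hmem⟩
    rw [Submodule.coe_norm] at h1
    rw [← h1]
    refine Finset.sum_congr rfl fun i _ => ?_
    rw [Submodule.coe_inner, ← hmaj, inner_maj, h.form_eq f, h.pos_of_mem_neg (he'N i),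
      h.neg_of_mem (he'N i), h.neg_of_mem (h.neg_mem f), map_zero, map_zero, zero_sub, zero_add,
      norm_neg]
  have hterm : ∀ i, ‖S.form f (e' i)‖ ^ 2 ≤
      2 * ‖S.form f (m i)‖ ^ 2 + 2 * η * ‖h.maj f‖ ^ 2 := by
    intro i
    have h1 : S.form f (e' i) = S.form f (m i) - S.form f (m i - e' i) := by
      rw [map_sub]
      ring
    have h2 : ‖S.form f (m i - e' i)‖ ≤ ‖h.maj f‖ * η :=
      (h.norm_form_le _ _).trans (by gcongr; exact (hme i).le)
    have h3 : ‖S.form f (e' i)‖ ≤ ‖S.form f (m i)‖ + ‖h.maj f‖ * η := by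
      rw [h1]
      exact (norm_sub_le _ _).trans (by gcongr)
    have h4 : (‖h.maj f‖ * η) ^ 2 ≤ η * ‖h.maj f‖ ^ 2 := by
      rw [mul_pow, mul_comm]
      gcongr
      nlinarith
    calc ‖S.form f (e' i)‖ ^ 2 ≤ (‖S.form f (m i)‖ + ‖h.maj f‖ * η) ^ 2 := by gcongr
      _ ≤ 2 * ‖S.form f (m i)‖ ^ 2 + 2 * (‖h.maj f‖ * η) ^ 2 := by
        nlinarith [sq_nonneg (‖S.form f (m i)‖ - ‖h.maj f‖ * η)]
      _ ≤ _ := by linarith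
  have hle : ‖h.maj (h.neg f)‖ ^ 2 ≤
      2 * ∑ i, ‖S.form f (m i)‖ ^ 2 + (k : ℝ) * (2 * η * ‖h.maj f‖ ^ 2) := by
    rw [hsum]
    refine (Finset.sum_le_sum fun i _ => hterm i).trans (le_of_eq ?_)
    rw [Finset.sum_add_distrib, ← Finset.mul_sum]
    simp
  have hkη : (k : ℝ) * (2 * η * ‖h.maj f‖ ^ 2) ≤ 1 / 4 * ‖h.maj f‖ ^ 2 := by
    have : (k : ℝ) * (2 * η) ≤ 1 / 4 := by
      rw [hη, mul_one_div, mul_div_assoc', div_le_div_iff₀ (by positivity) (by norm_num)]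
      linarith
    nlinarith [sq_nonneg ‖h.maj f‖]
  have := h.norm_sq_eq f
  linarith

lemma tendsto_form (h : S.IsFundamentalDecomposition P N) {u v : ℕ → S.carrier} {f g : S.carrier}
    (hu : Tendsto (fun n => h.maj (u n)) atTop (𝓝 (h.maj f)))
    (hv : Tendsto (fun n => h.maj (v n)) atTop (𝓝 (h.maj g))) :
    Tendsto (fun n => S.form (u n) (v n)) atTop (𝓝 (S.form f g)) := by
  have h1 : ∀ f g : S.carrier, S.form f g = inner ℂ (h.maj (h.symm g)) (h.maj f) := fun f g => by
    rw [inner_maj, pos_symm, neg_symm, h.form_eq, map_neg, sub_neg_eq_add]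
  simp only [h1]
  refine Tendsto.inner ?_ hu
  rw [tendsto_iff_norm_sub_tendsto_zero] at hv ⊢
  refine hv.congr fun n => ?_
  have h2 : h.symm (v n) - h.symm g = h.symm (v n - g) := by
    simp only [IsFundamentalDecomposition.symm, map_sub]
    abel
  rw [← map_sub, ← map_sub, h2, h.norm_maj_symm]

lemma tendsto_eval (h : S.IsFundamentalDecomposition P N) (hK : S.HasReproducingKernel K)
    {u : ℕ → S.carrier} {f : S.carrier}
    (hu : Tendsto (fun n => h.maj (u n)) atTop (𝓝 (h.maj f))) (z : D) :
    Tendsto (fun n => (u n : D → ℂ) z) atTop (𝓝 ((f : D → ℂ) z)) := by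
  obtain ⟨hz, hz'⟩ := hK z
  simp only [hz']
  exact h.tendsto_form hu tendsto_const_nhds

lemma exists_seq_tendsto (h : S.IsFundamentalDecomposition P N) (hK : S.HasReproducingKernel K)
    (f : S.carrier) : ∃ u : ℕ → S.carrier, (∀ n, (u n : D → ℂ) ∈ kernelSpan D K) ∧
      Tendsto (fun n => h.maj (u n)) atTop (𝓝 (h.maj f)) := by
  choose u hu hun using fun n : ℕ => h.exists_kernelSpan_near hK f
    (η := 1 / ((n : ℝ) + 1)) (by positivity)
  refine ⟨u, hu, ?_⟩
  rw [tendsto_iff_norm_sub_tendsto_zero]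
  refine squeeze_zero (fun n => norm_nonneg _) (fun n => ?_)
    tendsto_one_div_add_atTop_nhds_zero_nat
  rw [← map_sub]
  exact (hun n).le

end IsFundamentalDecomposition

/-- A Krein space is contained, with its form, in every positive Pontryagin space with the same
reproducing kernel. -/
theorem exists_form_eq_of_kernel {S S' : FormSpace D} {P N : Submodule ℂ S.carrier}
    {P' N' : Submodule ℂ S'.carrier} (h : S.IsFundamentalDecomposition P N)
    [FiniteDimensional ℂ N] (h' : S'.IsFundamentalDecomposition P' N')
    (hK : S.HasReproducingKernel K) (hK' : S'.HasReproducingKernel K) :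
    ∃ hle : S'.carrier ≤ S.carrier, ∀ f g : S'.carrier,
      S'.form f g = S.form ⟨f, hle f.2⟩ ⟨g, hle g.2⟩ := by
  obtain ⟨k, m, hm, hle⟩ := h.exists_norm_sq_le hK
  set m' : Fin k → S'.carrier := fun i => ⟨m i, hK'.kernelSpan_le (hm i)⟩ with hm'
  set C : ℝ := 2 * (1 + 4 * ∑ i, ‖h'.maj (m' i)‖ ^ 2) with hC
  have hC0 : 0 < C := by positivity
  -- On the kernel span the form and the functionals `[·, m i]` have the same values in both spaces,
  -- and in `S'` they are bounded by the majorant norm. So convergence in `S'` implies the Cauchy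
  -- property in `S`.
  have hbound : ∀ (φ : S.carrier) (φ' : S'.carrier), (φ : D → ℂ) = φ' →
      (φ : D → ℂ) ∈ kernelSpan D K → ‖h.maj φ‖ ^ 2 ≤ C * ‖h'.maj φ'‖ ^ 2 := by
    rintro ⟨φ, hφS⟩ ⟨_, hφS'⟩ rfl hφ
    refine (hle _).trans ?_
    rw [hK.form_kernelSpan_eq hK' hφ hφ]
    have h1 : (S'.form ⟨φ, hφS'⟩ ⟨φ, hφS'⟩).re ≤ ‖h'.maj ⟨φ, hφS'⟩‖ ^ 2 := by
      rw [sq]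
      exact (Complex.re_le_norm _).trans (h'.norm_form_le _ _)
    have h2 : ∀ i, ‖S.form ⟨φ, hφS⟩ (m i)‖ ^ 2 ≤
        ‖h'.maj ⟨φ, hφS'⟩‖ ^ 2 * ‖h'.maj (m' i)‖ ^ 2 := fun i => by
      have e := hK.form_kernelSpan_eq hK' hφ (hm i)
      have e' : S.form ⟨φ, hφS⟩ (m i) = S'.form ⟨φ, hφS'⟩ (m' i) := e
      rw [e', ← mul_pow]
      gcongr
      exact h'.norm_form_le _ _
    have h3 := Finset.sum_le_sum fun i (_ : i ∈ Finset.univ) => h2 i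
    rw [← Finset.mul_sum] at h3
    rw [hC]
    linarith
  have hlim : ∀ f : S'.carrier, ∃ g : S.carrier, (g : D → ℂ) = f ∧
      ∃ (u : ℕ → S.carrier) (u' : ℕ → S'.carrier), (∀ n, (u n : D → ℂ) = u' n) ∧
        (∀ n, (u n : D → ℂ) ∈ kernelSpan D K) ∧
        Tendsto (fun n => h.maj (u n)) atTop (𝓝 (h.maj g)) ∧
        Tendsto (fun n => h'.maj (u' n)) atTop (𝓝 (h'.maj f)) := by
    intro f
    obtain ⟨u', hu', hlim'⟩ := h'.exists_seq_tendsto hK' f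
    set u : ℕ → S.carrier := fun n => ⟨u' n, hK.kernelSpan_le (hu' n)⟩ with hu
    have hc : CauchySeq fun n => h.maj (u n) := by
      rw [Metric.cauchySeq_iff]
      intro δ hδ
      obtain ⟨n₀, hn⟩ := Metric.cauchySeq_iff.mp hlim'.cauchySeq (δ / Real.sqrt C)
        (div_pos hδ (Real.sqrt_pos.mpr hC0))
      refine ⟨n₀, fun i hi j hj => ?_⟩
      have h1 := hn i hi j hj
      rw [dist_eq_norm, ← map_sub, lt_div_iff₀ (Real.sqrt_pos.mpr hC0)] at h1
      rw [dist_eq_norm, ← map_sub]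
      have h2 := hbound (u i - u j) (u' i - u' j) rfl (sub_mem (hu' i) (hu' j))
      refine lt_of_le_of_lt ?_ h1
      refine le_of_sq_le_sq ?_ (by positivity)
      rw [mul_pow, Real.sq_sqrt hC0.le]
      linarith
    obtain ⟨x, hx⟩ := cauchySeq_tendsto_of_complete hc
    refine ⟨h.maj.symm x, ?_, u, u', fun n => rfl, hu', ?_, hlim'⟩
    · have hx' : Tendsto (fun n => h.maj (u n)) atTop (𝓝 (h.maj (h.maj.symm x))) := by
        rwa [h.maj.apply_symm_apply]
      funext z
      -- Point evaluations are continuous in both majorants, so the two limits are the same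
      -- function.
      exact tendsto_nhds_unique (h.tendsto_eval hK hx' z) (h'.tendsto_eval hK' hlim' z)
    · rwa [h.maj.apply_symm_apply]
  have hsub : S'.carrier ≤ S.carrier := fun f hf => by
    obtain ⟨g, hg, -⟩ := hlim ⟨f, hf⟩
    have : f = g := hg.symm
    rw [this]
    exact g.2
  refine ⟨hsub, fun f g => ?_⟩
  obtain ⟨f₁, hf₁, u, u', huu', huK, hu, hu'⟩ := hlim f
  obtain ⟨g₁, hg₁, v, v', hvv', hvK, hv, hv'⟩ := hlim g
  have e1 : (⟨f, hsub f.2⟩ : S.carrier) = f₁ := Subtype.ext hf₁.symm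
  have e2 : (⟨g, hsub g.2⟩ : S.carrier) = g₁ := Subtype.ext hg₁.symm
  rw [e1, e2]
  refine tendsto_nhds_unique (h'.tendsto_form hu' hv') ((h.tendsto_form hu hv).congr fun n => ?_)
  have e3 : u' n = ⟨u n, hK'.kernelSpan_le (huK n)⟩ := Subtype.ext (huu' n).symm
  have e4 : v' n = ⟨v n, hK'.kernelSpan_le (hvK n)⟩ := Subtype.ext (hvv' n).symm
  rw [e3, e4]
  exact hK.form_kernelSpan_eq hK' (huK n) (hvK n)

/-- The projection onto `N` along `P` has kernel `P`, so it is injective on a subspace whose image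
meets `P` only trivially. -/
lemma finiteDimensional_of_compl_disjoint {V V' : Type*} [AddCommGroup V] [Module ℂ V]
    [AddCommGroup V'] [Module ℂ V'] (j : V' →ₗ[ℂ] V) {N P : Submodule ℂ V} {N' : Submodule ℂ V'}
    (hc : IsCompl N P) (hN' : ∀ x ∈ N', j x ∈ P → x = 0) (hN : FiniteDimensional ℂ N) :
    FiniteDimensional ℂ N' ∧ Module.finrank ℂ N' ≤ Module.finrank ℂ N := by
  let T : N' →ₗ[ℂ] N := ((N.projectionOnto P hc).comp j).comp N'.subtype
  have hinj : Function.Injective T := by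
    refine (injective_iff_map_eq_zero T).mpr fun x hx => Subtype.ext (hN' x x.2 ?_)
    exact (Submodule.projectionOnto_apply_eq_zero_iff _).mp hx
  exact ⟨Module.Finite.of_injective T hinj, LinearMap.finrank_le_finrank_of_injective hinj⟩

/-- A negative part of a space that is contained, with its form, in a positive Pontryagin space
is finite-dimensional, and its dimension is at most the negative index of the latter. -/
theorem IsFundamentalDecomposition.finiteDimensional_neg {S S' : FormSpace D}
    {P N : Submodule ℂ S.carrier} {P' N' : Submodule ℂ S'.carrier}
    (h : S.IsFundamentalDecomposition P N) (h' : S'.IsFundamentalDecomposition P' N')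
    (hle : S'.carrier ≤ S.carrier)
    (hform : ∀ f g : S'.carrier, S'.form f g = S.form ⟨f, hle f.2⟩ ⟨g, hle g.2⟩)
    (hN : FiniteDimensional ℂ N) :
    FiniteDimensional ℂ N' ∧ Module.finrank ℂ N' ≤ Module.finrank ℂ N := by
  refine finiteDimensional_of_compl_disjoint (Submodule.inclusion hle) h.2.1.symm
    (fun x hx hxP => h'.eq_zero_of_nonneg hx ?_) hN
  rw [hform]
  exact h.form_self_nonneg hxP

/-- The space with the opposite form. -/
def opp (S : FormSpace D) : FormSpace D := ⟨S.carrier, -S.form⟩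

lemma opp_form_self (S : FormSpace D) (ε : ℝ) (f : S.carrier) :
    -ε * (S.opp.form f f).re = ε * (S.form f f).re := by
  change -ε * (-(S.form f f)).re = _
  rw [Complex.neg_re, neg_mul_neg]

lemma IsHilbertOn.opp {S : FormSpace D} {ε : ℝ} {P : Submodule ℂ S.carrier}
    (h : S.IsHilbertOn ε P) : S.opp.IsHilbertOn (-ε) P := by
  refine ⟨fun f hf h0 => (h.1 f hf h0).trans_eq (S.opp_form_self ε f).symm, fun u hu hc => ?_⟩
  obtain ⟨f, hf, hl⟩ := h.2 u hu fun δ hδ => by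
    obtain ⟨n, hn⟩ := hc δ hδ
    exact ⟨n, fun i hi j hj => (S.opp_form_self ε _).symm.trans_lt (hn i hi j hj)⟩
  exact ⟨f, hf, hl.congr fun n => (S.opp_form_self ε _).symm⟩

lemma eq_of_form_eq {S S' : FormSpace D} (hle : S'.carrier ≤ S.carrier)
    (hge : S.carrier ≤ S'.carrier)
    (hform : ∀ f g : S'.carrier, S'.form f g = S.form ⟨f, hle f.2⟩ ⟨g, hle g.2⟩) : S = S' := by
  obtain ⟨c, form⟩ := S
  obtain ⟨c', form'⟩ := S'
  obtain rfl : c = c' := le_antisymm hge hle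
  congr
  ext f g
  exact (hform f g).symm

lemma opp_opp (S : FormSpace D) : S.opp.opp = S :=
  eq_of_form_eq (S := S.opp.opp) (S' := S) le_rfl le_rfl fun f g => (neg_neg (S.form f g)).symm

lemma IsFundamentalDecomposition.opp {S : FormSpace D} {P N : Submodule ℂ S.carrier}
    (h : S.IsFundamentalDecomposition P N) : S.opp.IsFundamentalDecomposition N P := by
  refine ⟨fun f g => ?_, h.2.1.symm, fun f hf g hg => ?_, ?_, h.2.2.2.1.opp⟩
  · change -S.form f g = conj (-S.form g f)
    rw [h.1 f g, map_neg]
  · change -S.form f g = 0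
    rw [h.form_neg_pos hf hg, neg_zero]
  · have := h.2.2.2.2.opp
    rwa [neg_neg] at this

/-- The double opposite has the same carrier, but its form equals the original one only by
`neg_neg`. Generalizing over the form keeps the types of `P` and `N` fixed during the rewriting. -/
lemma IsFundamentalDecomposition.of_opp {S : FormSpace D} {P N : Submodule ℂ S.carrier}
    (h : S.opp.IsFundamentalDecomposition N P) : S.IsFundamentalDecomposition P N := by
  obtain ⟨c, form⟩ := S
  have h2 : ∀ φ, φ = form → (FormSpace.mk c φ).IsFundamentalDecomposition P N →
      (FormSpace.mk c form).IsFundamentalDecomposition P N := by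
    rintro _ rfl h
    exact h
  refine h2 _ ?_ h.opp
  ext f g
  exact neg_neg (form f g)

lemma isPositivePontryagin_opp {S : FormSpace D} {κ : ℕ} :
    S.opp.IsPositivePontryagin κ ↔ S.IsNegativePontryagin κ :=
  ⟨fun ⟨P, N, h, hf, hr⟩ => ⟨N, P, h.of_opp, hf, hr⟩,
    fun ⟨P, N, h, hf, hr⟩ => ⟨N, P, h.opp, hf, hr⟩⟩

lemma HasReproducingKernel.opp {S : FormSpace D} (hK : S.HasReproducingKernel K) :
    S.opp.HasReproducingKernel fun z u => -K z u := by
  intro u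
  obtain ⟨hu, hu'⟩ := hK u
  refine ⟨S.carrier.neg_mem hu, fun f => ?_⟩
  have e : (⟨fun z : D => -K z u, S.carrier.neg_mem hu⟩ : S.carrier) =
    -⟨fun z : D => K z u, hu⟩ := rfl
  have h1 : S.opp.form f ⟨fun z : D => -K z u, S.carrier.neg_mem hu⟩ =
      -S.form f ⟨fun z : D => -K z u, S.carrier.neg_mem hu⟩ := rfl
  rw [h1, e, map_neg, neg_neg]
  exact hu' f

end FormSpace

end

section

/-! ### Weighted spaces of power series -/

lemma ext_apply {D : Set ℂ} (f : D → ℂ) {z : ℂ} (hz : z ∈ D) : ext f z = f ⟨z, hz⟩ :=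
  Subtype.val_injective.extend_apply f 0 ⟨z, hz⟩

lemma ext_add {D : Set ℂ} (f g : D → ℂ) : ext (f + g) = ext f + ext g := by
  have := Function.extend_add (Subtype.val : D → ℂ) f g 0 0
  rwa [add_zero] at this

lemma ext_smul {D : Set ℂ} (r : ℂ) (f : D → ℂ) : ext (r • f) = r • ext f := by
  have := Function.extend_smul r (Subtype.val : D → ℂ) f 0
  rwa [smul_zero] at this

lemma ext_zero {D : Set ℂ} : ext (0 : D → ℂ) = 0 := by
  simpa using ext_smul 0 (0 : D → ℂ)

section Weighted

variable {R : ℝ}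

/-- The Taylor coefficients of a function on a disc. -/
abbrev coef (f : Metric.ball (0 : ℂ) R → ℂ) (k : ℕ) : ℂ := taylorCoeff (ext f) k

/-- Holomorphy on the disc. -/
abbrev IsHol (f : Metric.ball (0 : ℂ) R → ℂ) : Prop :=
  DifferentiableOn ℂ (ext f) (Metric.ball (0 : ℂ) R)

lemma coef_add (hR : 0 < R) {f g : Metric.ball (0 : ℂ) R → ℂ} (hf : IsHol f) (hg : IsHol g)
    (k : ℕ) : coef (f + g) k = coef f k + coef g k := by
  refine congrFun (taylorCoeff_eq_of_hasSum (u := fun k => coef f k + coef g k) hR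
    fun z hz => ?_) k
  simpa only [ext_add, add_mul, Pi.add_apply] using
    (hasSum_taylorCoeff hf hz).add (hasSum_taylorCoeff hg hz)

lemma coef_smul (hR : 0 < R) (r : ℂ) {f : Metric.ball (0 : ℂ) R → ℂ} (hf : IsHol f)
    (k : ℕ) : coef (r • f) k = r * coef f k := by
  refine congrFun (taylorCoeff_eq_of_hasSum (u := fun k => r * coef f k) hR fun z hz => ?_) k
  simpa only [ext_smul, mul_assoc, Pi.smul_apply, smul_eq_mul] using
    (hasSum_taylorCoeff hf hz).mul_left r

lemma coef_zero (k : ℕ) : coef (0 : Metric.ball (0 : ℂ) R → ℂ) k = 0 := by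
  simp [coef, ext_zero, taylorCoeff]

lemma IsHol.add {f g : Metric.ball (0 : ℂ) R → ℂ} (hf : IsHol f) (hg : IsHol g) :
    IsHol (f + g) := by
  rw [IsHol, ext_add]
  exact DifferentiableOn.add hf hg

lemma IsHol.smul (r : ℂ) {f : Metric.ball (0 : ℂ) R → ℂ} (hf : IsHol f) : IsHol (r • f) := by
  rw [IsHol, ext_smul]
  exact DifferentiableOn.const_smul hf r

lemma summable_weight_add {c : ℕ → ℝ} {x y : ℕ → ℂ} (hx : Summable fun k => |c k| * ‖x k‖ ^ 2)
    (hy : Summable fun k => |c k| * ‖y k‖ ^ 2) :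
    Summable fun k => |c k| * ‖x k + y k‖ ^ 2 := by
  refine Summable.of_nonneg_of_le (fun k => by positivity) (fun k => ?_)
    ((hx.add hy).mul_left 2)
  calc |c k| * ‖x k + y k‖ ^ 2 ≤ |c k| * (‖x k‖ + ‖y k‖) ^ 2 := by
        gcongr
        exact norm_add_le _ _
    _ ≤ |c k| * (2 * (‖x k‖ ^ 2 + ‖y k‖ ^ 2)) := by
        gcongr
        nlinarith [sq_nonneg (‖x k‖ - ‖y k‖)]
    _ = _ := by ring

lemma summable_weight_mul {c : ℕ → ℝ} {x y : ℕ → ℂ} (hx : Summable fun k => |c k| * ‖x k‖ ^ 2)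
    (hy : Summable fun k => |c k| * ‖y k‖ ^ 2) :
    Summable fun k => (c k : ℂ) * x k * conj (y k) := by
  refine Summable.of_norm_bounded (hx.add hy) fun k => ?_
  rw [norm_mul, norm_mul, RCLike.norm_conj, Complex.norm_real, Real.norm_eq_abs, ← mul_add,
    mul_assoc]
  gcongr
  nlinarith [sq_nonneg (‖x k‖ - ‖y k‖), sq_nonneg (‖x k‖ + ‖y k‖)]

/-- The holomorphic functions on the disc of radius `R` with
`∑ |c_k| |f_k|² < ∞`, with the form `∑ c_k f_k conj g_k`. -/
def weightedSpace (c : ℕ → ℝ) (hR : 0 < R) : FormSpace (Metric.ball (0 : ℂ) R) where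
  carrier :=
    { carrier := {f | IsHol f ∧ Summable fun k => |c k| * ‖coef f k‖ ^ 2}
      add_mem' := fun {f g} hf hg => ⟨hf.1.add hg.1, by
        simpa only [coef_add hR hf.1 hg.1] using summable_weight_add hf.2 hg.2⟩
      zero_mem' := ⟨by rw [IsHol, ext_zero]; exact differentiableOn_const 0, by
        simpa only [coef_zero, norm_zero, ne_eq, OfNat.ofNat_ne_zero, not_false_eq_true, zero_pow,
          mul_zero] using summable_zero⟩
      smul_mem' := fun r f hf => ⟨hf.1.smul r, by
        simpa only [coef_smul hR r hf.1, norm_mul, mul_pow, mul_left_comm] using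
          hf.2.mul_left (‖r‖ ^ 2)⟩ }
  form := LinearMap.mk₂'ₛₗ (RingHom.id ℂ) (starRingEnd ℂ)
    (fun f g => ∑' k, (c k : ℂ) * coef f.1 k * conj (coef g.1 k))
    (fun f f' g => by
      rw [← (summable_weight_mul f.2.2 g.2.2).tsum_add (summable_weight_mul f'.2.2 g.2.2)]
      refine tsum_congr fun k => ?_
      rw [Submodule.coe_add, coef_add hR f.2.1 f'.2.1]
      ring)
    (fun r f g => by
      rw [RingHom.id_apply, smul_eq_mul, ← tsum_mul_left]
      refine tsum_congr fun k => ?_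
      rw [Submodule.coe_smul, coef_smul hR r f.2.1]
      ring)
    (fun f g g' => by
      rw [← (summable_weight_mul f.2.2 g.2.2).tsum_add (summable_weight_mul f.2.2 g'.2.2)]
      refine tsum_congr fun k => ?_
      rw [Submodule.coe_add, coef_add hR g.2.1 g'.2.1, map_add]
      ring)
    (fun r f g => by
      rw [smul_eq_mul, ← tsum_mul_left]
      refine tsum_congr fun k => ?_
      rw [Submodule.coe_smul, coef_smul hR r g.2.1, map_mul]
      ring)

variable {c : ℕ → ℝ}

lemma mem_weightedSpace (hR : 0 < R) {f : Metric.ball (0 : ℂ) R → ℂ} :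
    f ∈ (weightedSpace c hR).carrier ↔ IsHol f ∧ Summable fun k => |c k| * ‖coef f k‖ ^ 2 :=
  Iff.rfl

lemma hasSum_weightedSpace_form (hR : 0 < R) (f g : (weightedSpace c hR).carrier) :
    HasSum (fun k => (c k : ℂ) * coef f.1 k * conj (coef g.1 k)) ((weightedSpace c hR).form f g) :=
  (summable_weight_mul f.2.2 g.2.2).hasSum

lemma coef_coe_add (hR : 0 < R) (f g : (weightedSpace c hR).carrier) (k : ℕ) :
    coef (f + g).1 k = coef f.1 k + coef g.1 k := coef_add hR f.2.1 g.2.1 k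

lemma coef_coe_smul (hR : 0 < R) (r : ℂ) (f : (weightedSpace c hR).carrier) (k : ℕ) :
    coef (r • f).1 k = r * coef f.1 k := coef_smul hR r f.2.1 k

/-- The `k`-th Taylor coefficient as a functional. -/
def coefMap (c : ℕ → ℝ) (hR : 0 < R) (k : ℕ) : (weightedSpace c hR).carrier →ₗ[ℂ] ℂ where
  toFun f := coef f.1 k
  map_add' f g := coef_coe_add hR f g k
  map_smul' r f := coef_coe_smul hR r f k

lemma coef_coe_sub (hR : 0 < R) (f g : (weightedSpace c hR).carrier) (k : ℕ) :
    coef (f - g).1 k = coef f.1 k - coef g.1 k := (coefMap c hR k).map_sub f g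

lemma eq_of_coef_eq (hR : 0 < R) {f g : (weightedSpace c hR).carrier}
    (h : ∀ k, coef f.1 k = coef g.1 k) : f = g := by
  ext z
  have hz : ‖(z : ℂ)‖ < R := mem_ball_zero_iff.mp z.2
  have h1 := hasSum_taylorCoeff f.2.1 hz
  have h2 := hasSum_taylorCoeff g.2.1 hz
  rw [ext_apply f.1 z.2] at h1
  rw [ext_apply g.1 z.2] at h2
  have h3 : taylorCoeff (ext f.1) = taylorCoeff (ext g.1) := funext h
  rw [h3] at h1
  exact h1.unique h2

/-- The weights have no zeros and decay slowly enough for the elements of the weighted space to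
be power series that converge in the disc of radius `R`. -/
structure IsWeight (c : ℕ → ℝ) (R : ℝ) : Prop where
  ne_zero : ∀ k, c k ≠ 0
  summable : ∀ q : ℝ, 0 ≤ q → q < R ^ 2 → Summable fun k => q ^ k / |c k|

namespace IsWeight

lemma neg (hc : IsWeight c R) : IsWeight (-c) R :=
  ⟨fun k => by simpa using hc.ne_zero k, fun q hq hqR => by
    simpa using hc.summable q hq hqR⟩

/-- The weighted inequality `2 ‖x‖ ‖z‖^k ≤ |c_k| ‖x‖² + ‖z‖^(2k) / |c_k|`, both terms on the right
being summable. -/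
lemma summable_mul_pow (hc : IsWeight c R) {x : ℕ → ℂ}
    (hx : Summable fun k => |c k| * ‖x k‖ ^ 2) {z : ℂ} (hz : ‖z‖ < R) :
    Summable fun k => x k * z ^ k := by
  have h1 := hc.summable (‖z‖ ^ 2) (by positivity) (by gcongr)
  refine Summable.of_norm_bounded (hx.add h1) fun k => ?_
  have hpos : 0 < |c k| := abs_pos.mpr (hc.ne_zero k)
  rw [norm_mul, norm_pow, ← pow_mul, mul_comm 2 k, pow_mul]
  have h2 : 0 ≤ (|c k| * ‖x k‖ - ‖z‖ ^ k) ^ 2 / |c k| := by positivity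
  have h3 : (|c k| * ‖x k‖ - ‖z‖ ^ k) ^ 2 / |c k| =
      |c k| * ‖x k‖ ^ 2 + (‖z‖ ^ k) ^ 2 / |c k| - 2 * (‖x k‖ * ‖z‖ ^ k) := by
    field_simp
    ring
  have h4 : 0 ≤ ‖x k‖ * ‖z‖ ^ k := by positivity
  linarith

/-- The element of the weighted space with given Taylor coefficients. -/
lemma exists_coef_eq (hc : IsWeight c R) (hR : 0 < R) {x : ℕ → ℂ}
    (hx : Summable fun k => |c k| * ‖x k‖ ^ 2) :
    ∃ f : (weightedSpace c hR).carrier, (∀ k, coef f.1 k = x k) ∧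
      ∀ z : Metric.ball (0 : ℂ) R, f.1 z = ∑' k, x k * (z : ℂ) ^ k := by
  set f : Metric.ball (0 : ℂ) R → ℂ := fun z => ∑' k, x k * (z : ℂ) ^ k with hf
  have hsum : ∀ z : ℂ, ‖z‖ < R → HasSum (fun k => x k * z ^ k) (ext f z) := by
    intro z hz
    rw [ext_apply f (by simpa using hz : z ∈ Metric.ball (0 : ℂ) R)]
    exact (hc.summable_mul_pow hx hz).hasSum
  have hcoef : taylorCoeff (ext f) = x := taylorCoeff_eq_of_hasSum hR hsum
  refine ⟨⟨f, differentiableOn_of_hasSum hsum, ?_⟩, fun k => congrFun hcoef k, fun z => rfl⟩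
  simpa only [coef, hcoef] using hx

/-- The reproducing kernel of the weighted space. -/
theorem hasReproducingKernel (hc : IsWeight c R) (hR : 0 < R) :
    (weightedSpace c hR).HasReproducingKernel fun z u => ∑' k, (z * conj u) ^ k / (c k : ℂ) := by
  intro u
  have hu : ‖(u : ℂ)‖ < R := mem_ball_zero_iff.mp u.2
  -- The Taylor coefficients of `K(·, u)`. Its weighted norm is `∑ ‖u‖^(2k) / |c_k|`, finite by the
  -- definition of a weight.
  set x : ℕ → ℂ := fun k => conj (u : ℂ) ^ k / (c k : ℂ) with hx
  have hsx : Summable fun k => |c k| * ‖x k‖ ^ 2 := by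
    refine (hc.summable (‖(u : ℂ)‖ ^ 2) (by positivity) (by gcongr)).congr fun k => ?_
    have hpos : 0 < |c k| := abs_pos.mpr (hc.ne_zero k)
    rw [hx]
    simp only [norm_div, norm_pow, RCLike.norm_conj, Complex.norm_real, Real.norm_eq_abs]
    rw [div_pow, ← pow_mul, ← pow_mul, mul_comm 2 k]
    field_simp
  obtain ⟨h, hcoef, hval⟩ := hc.exists_coef_eq hR hsx
  have hh : h.1 = fun z : Metric.ball (0 : ℂ) R => ∑' k, ((z : ℂ) * conj (u : ℂ)) ^ k / (c k : ℂ) := by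
    funext z
    rw [hval]
    refine tsum_congr fun k => ?_
    rw [hx, mul_pow]
    ring
  refine ⟨hh ▸ h.2, fun f => ?_⟩
  have e : (⟨_, hh ▸ h.2⟩ : (weightedSpace c hR).carrier) = h := Subtype.ext hh.symm
  rw [e]
  have h1 := hasSum_taylorCoeff f.2.1 hu
  rw [ext_apply f.1 u.2] at h1
  refine h1.unique ?_
  refine (congrArg (fun g => HasSum g _) (funext fun k => ?_)).mpr (hasSum_weightedSpace_form hR f h)
  have hne : (c k : ℂ) ≠ 0 := by exact_mod_cast hc.ne_zero k
  rw [hcoef, hx, map_div₀, map_pow, Complex.conj_conj, Complex.conj_ofReal]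
  field_simp

end IsWeight

/-- The elements whose Taylor coefficients vanish where `ε c_k < 0`. -/
def signPart (c : ℕ → ℝ) (hR : 0 < R) (ε : ℝ) : Submodule ℂ (weightedSpace c hR).carrier where
  carrier := {f | ∀ k, ε * c k < 0 → coef f.1 k = 0}
  add_mem' := fun {f g} hf hg k hk => by rw [coef_coe_add, hf k hk, hg k hk, add_zero]
  zero_mem' := fun k _ => coef_zero k
  smul_mem' := fun r f hf k hk => by rw [coef_coe_smul, hf k hk, mul_zero]

lemma hasSum_form_of_mem_signPart (hR : 0 < R) {ε : ℝ} (hε : |ε| = 1)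
    {f : (weightedSpace c hR).carrier} (hf : f ∈ signPart c hR ε) :
    HasSum (fun k => |c k| * ‖coef f.1 k‖ ^ 2) (ε * ((weightedSpace c hR).form f f).re) := by
  have h := (Complex.hasSum_re (hasSum_weightedSpace_form hR f f)).mul_left ε
  refine (congrArg (fun g => HasSum g _) (funext fun k => ?_)).mpr h
  rw [mul_assoc, Complex.mul_conj, Complex.normSq_eq_norm_sq, ← Complex.ofReal_mul,
    Complex.ofReal_re]
  rcases lt_or_ge (ε * c k) 0 with hk | hk
  · simp [hf k hk]
  · rw [← mul_assoc, ← abs_of_nonneg hk, abs_mul, hε, one_mul]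

lemma signPart_eq_zero_of_form (hc : ∀ k, c k ≠ 0) (hR : 0 < R) {ε : ℝ} (hε : |ε| = 1)
    {f : (weightedSpace c hR).carrier} (hf : f ∈ signPart c hR ε)
    (h : ε * ((weightedSpace c hR).form f f).re ≤ 0) : f = 0 := by
  have hs := hasSum_form_of_mem_signPart hR hε hf
  have h0 : ε * ((weightedSpace c hR).form f f).re = 0 :=
    le_antisymm h (hs.nonneg fun k => by positivity)
  rw [h0] at hs
  refine eq_of_coef_eq hR fun k => ?_
  have h1 := congrFun ((hasSum_zero_iff_of_nonneg fun k => by positivity).mp hs) k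
  have h2 : |c k| ≠ 0 := abs_ne_zero.mpr (hc k)
  have h3 : coef f.1 k = 0 := by simpa [h2] using h1
  rw [h3]
  exact (coef_zero k).symm

/-- The sequence `|c_k|^(1/2) f_k`. -/
def toL2 (hR : 0 < R) (f : (weightedSpace c hR).carrier) : lp (fun _ : ℕ => ℂ) 2 :=
  ⟨fun k => (Real.sqrt |c k| : ℂ) * coef f.1 k, memℓp_gen (by
    refine f.2.2.congr fun k => ?_
    rw [ENNReal.toReal_ofNat, Real.rpow_two, norm_mul, mul_pow, Complex.norm_real,
      Real.norm_of_nonneg (Real.sqrt_nonneg _), Real.sq_sqrt (abs_nonneg _)])⟩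

lemma toL2_sub (hR : 0 < R) (f g : (weightedSpace c hR).carrier) :
    toL2 hR (f - g) = toL2 hR f - toL2 hR g := by
  ext k
  change (Real.sqrt |c k| : ℂ) * coef (f - g).1 k =
    (Real.sqrt |c k| : ℂ) * coef f.1 k - (Real.sqrt |c k| : ℂ) * coef g.1 k
  rw [coef_coe_sub, mul_sub]

lemma norm_toL2_sq (hR : 0 < R) {ε : ℝ} (hε : |ε| = 1) {f : (weightedSpace c hR).carrier}
    (hf : f ∈ signPart c hR ε) :
    ‖toL2 hR f‖ ^ 2 = ε * ((weightedSpace c hR).form f f).re := by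
  have h := lp.norm_rpow_eq_tsum (p := 2) (by norm_num) (toL2 hR f)
  rw [ENNReal.toReal_ofNat, Real.rpow_two] at h
  rw [h, ← (hasSum_form_of_mem_signPart hR hε hf).tsum_eq]
  refine tsum_congr fun k => ?_
  change ‖(Real.sqrt |c k| : ℂ) * coef f.1 k‖ ^ (2 : ℝ) = _
  rw [Real.rpow_two, norm_mul, mul_pow, Complex.norm_real,
    Real.norm_of_nonneg (Real.sqrt_nonneg _), Real.sq_sqrt (abs_nonneg _)]

namespace IsWeight

/-- On a sign part `toL2` preserves the norm. A Cauchy sequence converges in `ℓ²`, dividing by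
`|c_k|^(1/2)` gives the Taylor coefficients of the limit, and the vanishing coefficients stay zero
because coordinates are continuous. -/
lemma isHilbertOn_signPart (hc : IsWeight c R) (hR : 0 < R) {ε : ℝ} (hε : |ε| = 1) :
    (weightedSpace c hR).IsHilbertOn ε (signPart c hR ε) := by
  refine ⟨fun f hf h0 => ?_, fun u hu hcau => ?_⟩
  · by_contra hle
    exact h0 (signPart_eq_zero_of_form hc.ne_zero hR hε hf (not_lt.mp hle))
  have hcs : CauchySeq fun n => toL2 hR (u n) := by
    rw [Metric.cauchySeq_iff]
    intro δ hδ
    obtain ⟨n₀, hn⟩ := hcau (δ ^ 2) (by positivity)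
    refine ⟨n₀, fun i hi j hj => ?_⟩
    have h1 := hn i hi j hj
    rw [← norm_toL2_sq hR hε (sub_mem (hu i) (hu j)), toL2_sub] at h1
    rw [dist_eq_norm]
    exact lt_of_pow_lt_pow_left₀ 2 hδ.le h1
  obtain ⟨y, hy⟩ := cauchySeq_tendsto_of_complete hcs
  set x : ℕ → ℂ := fun k => (Real.sqrt |c k| : ℂ)⁻¹ * y k with hx
  have hpos : ∀ k, 0 < |c k| := fun k => abs_pos.mpr (hc.ne_zero k)
  have hsx : Summable fun k => |c k| * ‖x k‖ ^ 2 := by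
    have h1 := (lp.memℓp y).summable (by norm_num)
    refine h1.congr fun k => ?_
    rw [hx]
    simp only [norm_mul, norm_inv, Complex.norm_real, Real.norm_of_nonneg (Real.sqrt_nonneg _),
      mul_pow, inv_pow, Real.sq_sqrt (hpos k).le, ENNReal.toReal_ofNat, Real.rpow_two]
    rw [← mul_assoc, mul_inv_cancel₀ (hpos k).ne', one_mul]
  obtain ⟨f, hcoef, -⟩ := hc.exists_coef_eq hR hsx
  have hfy : toL2 hR f = y := by
    ext k
    change (Real.sqrt |c k| : ℂ) * coef f.1 k = y k
    have : (Real.sqrt |c k| : ℂ) ≠ 0 := by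
      exact_mod_cast (Real.sqrt_pos.mpr (hpos k)).ne'
    rw [hcoef, hx, ← mul_assoc, mul_inv_cancel₀ this, one_mul]
  have hlim : Tendsto (fun n => ‖toL2 hR (u n - f)‖) atTop (𝓝 0) := by
    simp only [toL2_sub, hfy]
    exact tendsto_iff_norm_sub_tendsto_zero.mp hy
  have hf : f ∈ signPart c hR ε := by
    intro k hk
    have h1 : ∀ n, ‖toL2 hR f k‖ ≤ ‖toL2 hR (u n - f)‖ := fun n => by
      have h2 := lp.norm_apply_le_norm (p := 2) (by norm_num) (toL2 hR (u n - f)) k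
      have h3 : toL2 hR (u n - f) k = -toL2 hR f k := by
        change (Real.sqrt |c k| : ℂ) * coef (u n - f).1 k = -((Real.sqrt |c k| : ℂ) * coef f.1 k)
        rw [coef_coe_sub, hu n k hk]
        ring
      rwa [h3, norm_neg] at h2
    have h4 : ‖toL2 hR f k‖ ≤ 0 := ge_of_tendsto' hlim h1
    have h5 : (Real.sqrt |c k| : ℂ) * coef f.1 k = 0 := norm_le_zero_iff.mp h4
    have : (Real.sqrt |c k| : ℂ) ≠ 0 := by
      exact_mod_cast (Real.sqrt_pos.mpr (hpos k)).ne'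
    exact (mul_eq_zero.mp h5).resolve_left this
  refine ⟨f, hf, ?_⟩
  have h6 := hlim.pow 2
  rw [zero_pow two_ne_zero] at h6
  exact h6.congr fun n => norm_toL2_sq hR hε (sub_mem (hu n) hf)

/-- The weighted space is a Krein space. -/
theorem isFundamentalDecomposition (hc : IsWeight c R) (hR : 0 < R) :
    (weightedSpace c hR).IsFundamentalDecomposition (signPart c hR 1) (signPart c hR (-1)) := by
  have hform0 : ∀ f ∈ signPart c hR 1, ∀ g ∈ signPart c hR (-1),
      (weightedSpace c hR).form f g = 0 := by
    intro f hf g hg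
    refine (hasSum_weightedSpace_form hR f g).unique ?_
    refine (congrArg (fun g => HasSum g _) (funext fun k => ?_)).mpr hasSum_zero
    rcases lt_or_gt_of_ne (hc.ne_zero k) with hk | hk
    · rw [hf k (by linarith)]
      simp
    · rw [hg k (by linarith)]
      simp
  refine ⟨fun f g => ?_, ?_, hform0, hc.isHilbertOn_signPart hR (by simp),
    hc.isHilbertOn_signPart hR (by simp)⟩
  · refine (hasSum_weightedSpace_form hR f g).unique ?_
    refine (congrArg (fun g => HasSum g _) (funext fun k => ?_)).mpr
      (Complex.hasSum_conj'.mpr (hasSum_weightedSpace_form hR g f))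
    rw [map_mul, map_mul, Complex.conj_ofReal, Complex.conj_conj]
    ring
  · constructor
    · rw [Submodule.disjoint_def]
      intro f hf hg
      refine eq_of_coef_eq hR fun k => ?_
      rw [show coef ((0 : (weightedSpace c hR).carrier)).1 k = 0 from coef_zero k]
      rcases lt_or_gt_of_ne (hc.ne_zero k) with hk | hk
      · exact hf k (by linarith)
      · exact hg k (by linarith)
    · rw [codisjoint_iff, eq_top_iff]
      intro f _
      -- Restricting the Taylor coefficients to the indices with `c k > 0`, or to the others, keeps
      -- the weighted sum finite; the two restrictions are the components.
      have hsub : ∀ q : ℕ → Prop, ∀ _ : DecidablePred q,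
          Summable fun k => |c k| * ‖if q k then coef f.1 k else 0‖ ^ 2 := by
        intro q _
        refine Summable.of_nonneg_of_le (fun k => by positivity) (fun k => ?_) f.2.2
        split_ifs
        · exact le_rfl
        · simp only [norm_zero, ne_eq, OfNat.ofNat_ne_zero, not_false_eq_true, zero_pow, mul_zero]
          positivity
      obtain ⟨g, hg, -⟩ := hc.exists_coef_eq hR (hsub (fun k => 0 < c k) (Classical.decPred _))
      obtain ⟨h, hh, -⟩ := hc.exists_coef_eq hR (hsub (fun k => ¬ 0 < c k) (Classical.decPred _))
      refine Submodule.mem_sup.mpr ⟨g, fun k hk => ?_, h, fun k hk => ?_, ?_⟩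
      · rw [hg, if_neg (by linarith)]
      · rw [hh, if_neg (by rw [not_not]; linarith)]
      · refine eq_of_coef_eq hR fun k => ?_
        rw [coef_coe_add, hg, hh]
        by_cases hk : 0 < c k <;> simp [hk]

end IsWeight

end Weighted

end

-- Indices and uniqueness for weighted spaces

section

variable {R : ℝ} {c : ℕ → ℝ}

/-- The dimension of a subspace on which a family of functionals, indexed by `F`, separates the
points and takes arbitrary finitely supported values. -/
lemma finiteDimensional_iff_of_coords {V : Type*} [AddCommGroup V] [Module ℂ V]
    {N : Submodule ℂ V} (φ : ℕ → V →ₗ[ℂ] ℂ) (F : Set ℕ)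
    (hinj : ∀ x ∈ N, (∀ k ∈ F, φ k x = 0) → x = 0)
    (hsurj : ∀ (y : ℕ → ℂ) (G : Set ℕ), G.Finite → G ⊆ F → (∀ k ∉ G, y k = 0) →
      ∃ x ∈ N, ∀ k, φ k x = y k) :
    (FiniteDimensional ℂ N → F.Finite) ∧
      (F.Finite → FiniteDimensional ℂ N ∧ Module.finrank ℂ N = F.ncard) := by
  classical
  constructor
  · intro h
    -- Elements dual to the coordinates in `F` are linearly independent, so `F` is finite if the
    -- subspace has finite dimension.
    choose m hmem hm using fun k : F => hsurj (Pi.single k 1) {(k : ℕ)} (Set.finite_singleton _)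
      (Set.singleton_subset_iff.mpr k.2) fun j hj => Pi.single_eq_of_ne hj 1
    have hli : LinearIndependent ℂ fun k : F => (⟨m k, hmem k⟩ : N) := by
      rw [linearIndependent_iff']
      intro s g hg i hi
      have h1 := congrArg (fun f : N => φ i f.1) hg
      simp only [Submodule.coe_sum, Submodule.coe_smul, map_sum, map_smul, Submodule.coe_zero,
        map_zero, hm] at h1
      rw [Finset.sum_eq_single i] at h1
      · simpa using h1
      · intro j _ hj
        rw [Pi.single_eq_of_ne fun h => hj (Subtype.ext h.symm), smul_zero]
      · exact fun h => absurd hi h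
    exact hli.finite
  · intro hF
    have := hF.fintype
    let Φ : N →ₗ[ℂ] (F → ℂ) := LinearMap.pi fun k => (φ k).comp N.subtype
    have hinj' : Function.Injective Φ := (injective_iff_map_eq_zero Φ).mpr fun f hf =>
      Subtype.ext (hinj f f.2 fun k hk => congrFun hf ⟨k, hk⟩)
    have hsurj' : Function.Surjective Φ := by
      intro y
      obtain ⟨f, hf, hfy⟩ := hsurj (fun k => if h : k ∈ F then y ⟨k, h⟩ else 0) F hF subset_rfl
        fun k hk => dif_neg hk
      refine ⟨⟨f, hf⟩, funext fun k => ?_⟩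
      exact (hfy k).trans (dif_pos k.2)
    let e := LinearEquiv.ofBijective Φ ⟨hinj', hsurj'⟩
    refine ⟨Module.Finite.equiv e.symm, ?_⟩
    rw [e.finrank_eq, Module.finrank_fintype_fun_eq_card, ← Nat.card_eq_fintype_card,
      Nat.card_coe_set_eq]

namespace IsWeight

lemma finiteDimensional_signPart (hc : IsWeight c R) (hR : 0 < R) :
    (FiniteDimensional ℂ (signPart c hR (-1)) → {k | c k < 0}.Finite) ∧
      ({k | c k < 0}.Finite → FiniteDimensional ℂ (signPart c hR (-1)) ∧
        Module.finrank ℂ (signPart c hR (-1)) = {k | c k < 0}.ncard) := by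
  refine finiteDimensional_iff_of_coords (coefMap c hR) {k | c k < 0} ?_ ?_
  · intro f hf h0
    refine eq_of_coef_eq hR fun k => ?_
    rw [show coef (0 : (weightedSpace c hR).carrier).1 k = 0 from coef_zero k]
    by_cases hk : c k < 0
    · exact h0 k hk
    · refine hf k ?_
      have := lt_of_le_of_ne (not_lt.mp hk) (hc.ne_zero k).symm
      linarith
  · intro y G hG hGF hy
    obtain ⟨f, hf, -⟩ := hc.exists_coef_eq hR (x := y)
      (summable_of_ne_finset_zero (s := hG.toFinset) fun k hk => by
        rw [hy k (by simpa using hk)]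
        simp)
    refine ⟨f, fun k hk => ?_, hf⟩
    rw [hf]
    refine hy k fun hkG => ?_
    have : c k < 0 := hGF hkG
    linarith

/-- The negative index of the weighted space. -/
theorem isPositivePontryagin_iff (hc : IsWeight c R) (hR : 0 < R) (κ : ℕ) :
    (weightedSpace c hR).IsPositivePontryagin κ ↔
      {k | c k < 0}.Finite ∧ {k | c k < 0}.ncard = κ := by
  have h := hc.isFundamentalDecomposition hR
  constructor
  · rintro ⟨P, N, h', hN, rfl⟩
    -- Sylvester's law of inertia: comparing the given decomposition with the one by signs, in both
    -- directions, shows that the negative parts have equal dimension.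
    obtain ⟨h1, h2⟩ := h'.finiteDimensional_neg h le_rfl (fun _ _ => rfl) hN
    have hF := (hc.finiteDimensional_signPart hR).1 h1
    obtain ⟨-, h4⟩ := (hc.finiteDimensional_signPart hR).2 hF
    obtain ⟨-, h5⟩ := h.finiteDimensional_neg h' le_rfl (fun _ _ => rfl) h1
    exact ⟨hF, by omega⟩
  · rintro ⟨hF, rfl⟩
    exact ⟨_, _, h, (hc.finiteDimensional_signPart hR).2 hF⟩

lemma opp_weightedSpace (c : ℕ → ℝ) (hR : 0 < R) :
    (weightedSpace c hR).opp = weightedSpace (-c) hR := by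
  have h : ∀ f : Metric.ball (0 : ℂ) R → ℂ,
      f ∈ (weightedSpace (-c) hR).carrier ↔ f ∈ (weightedSpace c hR).carrier := fun f => by
    simp only [mem_weightedSpace, Pi.neg_apply, abs_neg]
  refine FormSpace.eq_of_form_eq (fun f hf => (h f).mp hf) (fun f hf => (h f).mpr hf)
    fun f g => ?_
  have h1 := (hasSum_weightedSpace_form hR ⟨f.1, (h _).mp f.2⟩ ⟨g.1, (h _).mp g.2⟩).neg
  refine (hasSum_weightedSpace_form hR f g).unique ?_
  refine (congrArg (fun g => HasSum g _) (funext fun k => ?_)).mpr h1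
  rw [Pi.neg_apply, Complex.ofReal_neg]
  ring

/-- The positive index of the weighted space. -/
theorem isNegativePontryagin_iff (hc : IsWeight c R) (hR : 0 < R) (κ : ℕ) :
    (weightedSpace c hR).IsNegativePontryagin κ ↔
      {k | 0 < c k}.Finite ∧ {k | 0 < c k}.ncard = κ := by
  rw [← FormSpace.isPositivePontryagin_opp, opp_weightedSpace, hc.neg.isPositivePontryagin_iff]
  simp

/-- Positivity of `S` first embeds the weighted space in `S`. This makes the negative part of the
weighted space finite-dimensional, so the same argument yields the opposite inclusion. -/
theorem eq_weightedSpace_of_positive (hc : IsWeight c R) (hR : 0 < R)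
    {S : FormSpace (Metric.ball (0 : ℂ) R)} {κ : ℕ} (hS : S.IsPositivePontryagin κ)
    (hK : S.HasReproducingKernel fun z u => ∑' k, (z * conj u) ^ k / (c k : ℂ)) :
    S = weightedSpace c hR := by
  obtain ⟨P, N, h, hN, -⟩ := hS
  have h' := hc.isFundamentalDecomposition hR
  have hK' := hc.hasReproducingKernel hR
  obtain ⟨hle, hform⟩ := FormSpace.exists_form_eq_of_kernel h h' hK hK'
  have := (h.finiteDimensional_neg h' hle hform hN).1
  obtain ⟨hge, -⟩ := FormSpace.exists_form_eq_of_kernel h' h hK' hK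
  exact FormSpace.eq_of_form_eq hle hge hform

/-- The Pontryagin space with the given reproducing kernel is unique. -/
theorem eq_weightedSpace (hc : IsWeight c R) (hR : 0 < R)
    {S : FormSpace (Metric.ball (0 : ℂ) R)} (hS : S.IsPontryagin)
    (hK : S.HasReproducingKernel fun z u => ∑' k, (z * conj u) ^ k / (c k : ℂ)) :
    S = weightedSpace c hR := by
  obtain ⟨κ, h | h⟩ := hS
  · exact hc.eq_weightedSpace_of_positive hR h hK
  · have h1 := FormSpace.isPositivePontryagin_opp.mpr h
    have h2 : S.opp.HasReproducingKernel
        fun z u => ∑' k, (z * conj u) ^ k / (((-c) k : ℝ) : ℂ) := by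
      have := hK.opp
      simpa only [Pi.neg_apply, Complex.ofReal_neg, div_neg, tsum_neg] using this
    have h3 := hc.neg.eq_weightedSpace_of_positive hR h1 h2
    rw [← S.opp_opp, h3, opp_weightedSpace, neg_neg]

end IsWeight

end

section

/-! ### Signs of the weights -/

/-- The number of negative factors among `x, x + 1, x + 2, …`, if `x` is no negative integer. -/
def negSteps (x : ℝ) : ℕ := (-⌊x⌋).toNat

lemma lt_negSteps_iff {x : ℝ} {k : ℕ} : k < negSteps x ↔ x + k < 0 := by
  rw [negSteps, Int.lt_toNat, lt_neg, Int.floor_lt]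
  push_cast
  exact ⟨fun h => by linarith, fun h => by linarith⟩

/-- Exactly the first `negSteps x` factors `x + j` are negative, and none is zero. -/
lemma poch_sign {x : ℝ} (hx : ∀ n : ℕ, x ≠ -n) (k : ℕ) :
    0 < (-1) ^ min k (negSteps x) * poch x k := by
  induction k with
  | zero => simp [poch_zero]
  | succ k ih =>
    rw [poch_succ]
    by_cases hk : k < negSteps x
    · have h1 := lt_negSteps_iff.mp hk
      rw [min_eq_left hk, pow_succ]
      rw [min_eq_left hk.le] at ih
      nlinarith
    · have h1 : 0 < x + k := by
        refine lt_of_le_of_ne (not_lt.mp fun h => hk (lt_negSteps_iff.mpr h)) fun h => hx k ?_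
        linarith
      rw [not_lt] at hk
      rw [min_eq_right (hk.trans k.le_succ), ← mul_assoc]
      rw [min_eq_right hk] at ih
      positivity

variable {p q : ℕ}

/-- The sign of the `k`-th weight is `(-1)^(signExp a b k)`. -/
def signExp (a : Fin p → ℝ) (b : Fin q → ℝ) (k : ℕ) : ℕ :=
  ∑ i, min k (negSteps (a i)) + ∑ i, min k (negSteps (b i))

lemma prod_poch_sign {a : Fin p → ℝ} (ha : ∀ i, ∀ n : ℕ, a i ≠ -(n : ℝ)) (k : ℕ) :
    0 < (-1) ^ (∑ i, min k (negSteps (a i))) * ∏ i, poch (a i) k := by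
  rw [← Finset.prod_pow_eq_pow_sum, ← Finset.prod_mul_distrib]
  exact Finset.prod_pos fun i _ => poch_sign (ha i) k

lemma coeffWeight_sign {a : Fin p → ℝ} {b : Fin q → ℝ} {θ : ℝ} (hθ : 0 < θ)
    (ha : ∀ i, ∀ n : ℕ, a i ≠ -(n : ℝ)) (hb : ∀ i, ∀ n : ℕ, b i ≠ -(n : ℝ)) (k : ℕ) :
    0 < (-1) ^ signExp a b k * coeffWeight a b θ k := by
  have h1 := prod_poch_sign ha k
  have h2 := prod_poch_sign hb k
  have h3 : ((-1 : ℝ) ^ (∑ i, min k (negSteps (a i)))) ≠ 0 := by positivity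
  have h4 : (-1 : ℝ) ^ signExp a b k * coeffWeight a b θ k =
      ((-1) ^ (∑ i, min k (negSteps (b i))) * ∏ i, poch (b i) k) * (k.factorial * θ ^ k) /
        ((-1) ^ (∑ i, min k (negSteps (a i))) * ∏ i, poch (a i) k) := by
    have h5 : ((-1 : ℝ) ^ (∑ i, min k (negSteps (a i)))) ^ 2 = 1 := by
      rw [← pow_mul, mul_comm, pow_mul]
      norm_num
    have h6 : ∏ i, poch (a i) k ≠ 0 := fun h => by simp [h] at h1
    rw [signExp, coeffWeight, pow_add]
    field_simp
    linear_combination (∏ i, poch (b i) k) * h5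
  rw [h4]
  positivity

lemma coeffWeight_neg_iff {a : Fin p → ℝ} {b : Fin q → ℝ} {θ : ℝ} (hθ : 0 < θ)
    (ha : ∀ i, ∀ n : ℕ, a i ≠ -(n : ℝ)) (hb : ∀ i, ∀ n : ℕ, b i ≠ -(n : ℝ)) (k : ℕ) :
    coeffWeight a b θ k < 0 ↔ Odd (signExp a b k) := by
  have h := coeffWeight_sign hθ ha hb k
  rcases Nat.even_or_odd (signExp a b k) with he | ho
  · rw [he.neg_one_pow, one_mul] at h
    exact ⟨fun h' => absurd h h'.not_gt, fun h' => absurd he (Nat.not_even_iff_odd.mpr h')⟩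
  · rw [ho.neg_one_pow] at h
    exact ⟨fun _ => ho, fun _ => by linarith⟩

lemma coeffWeight_pos_iff {a : Fin p → ℝ} {b : Fin q → ℝ} {θ : ℝ} (hθ : 0 < θ)
    (ha : ∀ i, ∀ n : ℕ, a i ≠ -(n : ℝ)) (hb : ∀ i, ∀ n : ℕ, b i ≠ -(n : ℝ)) (k : ℕ) :
    0 < coeffWeight a b θ k ↔ Even (signExp a b k) := by
  have h := coeffWeight_sign hθ ha hb k
  rcases Nat.even_or_odd (signExp a b k) with he | ho
  · rw [he.neg_one_pow, one_mul] at h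
    exact ⟨fun _ => he, fun _ => h⟩
  · rw [ho.neg_one_pow] at h
    exact ⟨fun h' => absurd h' (by linarith), fun h' => absurd h' (Nat.not_even_iff_odd.mpr ho)⟩

/-! ### The index rules -/

variable (a : Fin p → ℝ) (b : Fin q → ℝ)

/-- `|[d_i]|`. -/
def absFloor (i : ℕ) : ℕ := (dFloor a b i).natAbs

lemma mem_negParams {x : ℝ} (hx : x ∈ negParams a b) : x < 0 := by
  rw [negParams, Multiset.mem_sort, Multiset.mem_filter] at hx
  exact hx.2

lemma negSteps_of_neg {x : ℝ} (hx : x < 0) : negSteps x = ⌊x⌋.natAbs := by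
  have h : ⌊x⌋ < 0 := Int.floor_lt.mpr (by exact_mod_cast hx)
  rw [negSteps]
  omega

lemma absFloor_succ {i : ℕ} (h : i < (negParams a b).length) :
    absFloor a b (i + 1) = negSteps ((negParams a b)[i]) := by
  rw [negSteps_of_neg (mem_negParams a b (List.getElem_mem h)), absFloor, dFloor,
    List.getD_eq_getElem _ _ h]

lemma dFloor_eq {i : ℕ} (hi : i ≤ numNegParams a b) : dFloor a b i = -(absFloor a b i : ℤ) := by
  cases i with
  | zero => rfl
  | succ i =>
    have h : i < (negParams a b).length := hi
    have h1 := mem_negParams a b (List.getElem_mem h)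
    have h2 : ⌊(negParams a b)[i]⌋ < 0 := Int.floor_lt.mpr (by exact_mod_cast h1)
    rw [absFloor, dFloor, List.getD_eq_getElem _ _ h]
    omega

lemma negSteps_anti {x y : ℝ} (h : x ≤ y) : negSteps y ≤ negSteps x := by
  have := Int.floor_le_floor h
  rw [negSteps, negSteps]
  omega

lemma absFloor_mono {i j : ℕ} (hij : i ≤ j) (hj : j ≤ numNegParams a b) :
    absFloor a b i ≤ absFloor a b j := by
  rcases Nat.eq_zero_or_pos i with rfl | hi
  · exact Nat.zero_le _
  obtain ⟨i, rfl⟩ := Nat.exists_eq_succ_of_ne_zero hi.ne'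
  obtain ⟨j, rfl⟩ := Nat.exists_eq_succ_of_ne_zero (hi.trans_le hij).ne'
  have hj' : j < (negParams a b).length := hj
  rw [Nat.succ_eq_add_one, Nat.succ_eq_add_one, absFloor_succ a b (by omega),
    absFloor_succ a b hj']
  refine negSteps_anti ?_
  rcases hij.eq_or_lt with h | h
  · simp only [Nat.succ.injEq] at h
    subst h
    exact le_rfl
  · have hs := (Multiset.pairwise_sort (Multiset.filter (fun x : ℝ => x < 0)
      (Finset.univ.val.map a + Finset.univ.val.map b)) (fun x y => y ≤ x))
    exact List.pairwise_iff_getElem.mp hs i j _ _ (by omega)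

lemma sum_map_eq_sum_range (l : List ℝ) (g : ℝ → ℕ) :
    (l.map g).sum = ∑ i ∈ Finset.range l.length, g (l.getD i 0) := by
  induction l with
  | nil => simp
  | cons x l ih =>
    rw [List.length_cons, Finset.sum_range_succ', List.map_cons, List.sum_cons, ih, add_comm]
    rfl

/-- A parameter `x ≥ 0` has no negative factors, so only the sorted negative parameters contribute,
the `j`-th of them `min(k, |[d_j]|)`. -/
lemma signExp_eq_sum (k : ℕ) :
    signExp a b k = ∑ j ∈ Finset.range (numNegParams a b), min k (absFloor a b (j + 1)) := by
  set M : Multiset ℝ := Finset.univ.val.map a + Finset.univ.val.map b with hM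
  set g : ℝ → ℕ := fun x => min k (negSteps x) with hg
  have h1 : signExp a b k = (M.map g).sum := by
    rw [hM, Multiset.map_add, Multiset.sum_add, Multiset.map_map, Multiset.map_map]
    rfl
  have h2 : (M.map g).sum = ((M.filter fun x => x < 0).map g).sum := by
    conv_lhs => rw [← Multiset.filter_add_not (fun x : ℝ => x < 0) M, Multiset.map_add,
      Multiset.sum_add]
    rw [Nat.add_eq_left]
    refine Multiset.sum_eq_zero fun y hy => ?_
    obtain ⟨x, hx, rfl⟩ := Multiset.mem_map.mp hy
    have h3 : 0 ≤ x := not_lt.mp (Multiset.mem_filter.mp hx).2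
    have h4 : 0 ≤ ⌊x⌋ := Int.floor_nonneg.mpr h3
    have h5 : negSteps x = 0 := by
      rw [negSteps]
      omega
    simp [hg, h5]
  have h3 : ((M.filter fun x => x < 0).map g).sum = ((negParams a b).map g).sum := by
    conv_lhs => rw [← Multiset.sort_eq (M.filter fun x => x < 0) (fun x y => y ≤ x)]
    rw [Multiset.map_coe, Multiset.sum_coe]
    rfl
  rw [h1, h2, h3, sum_map_eq_sum_range]
  refine Finset.sum_congr rfl fun i hi => ?_
  have h4 : i < (negParams a b).length := Finset.mem_range.mp hi
  rw [absFloor_succ a b h4, List.getD_eq_getElem _ _ h4]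

/-- For `|[d_i]| < k ≤ |[d_{i+1}]|` the first `i` negative parameters have used up their negative
factors, and each of the other `m - i` contributes `k`. The signs of the `[d_j]` do not matter
modulo `2`. -/
lemma parityTerm_eq {i k : ℕ} (hi : i < numNegParams a b) (hk : absFloor a b i < k)
    (hk' : k ≤ absFloor a b (i + 1)) : parityTerm a b i k = (signExp a b k : ℤ) % 2 := by
  have h1 : signExp a b k = ∑ j ∈ Finset.range i, absFloor a b (j + 1) +
      k * (numNegParams a b - i) := by
    rw [signExp_eq_sum, ← Finset.sum_range_add_sum_Ico _ hi.le]
    congr 1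
    · refine Finset.sum_congr rfl fun j hj => min_eq_right ?_
      have hj' := Finset.mem_range.mp hj
      exact (absFloor_mono a b (by omega : j + 1 ≤ i) hi.le).trans hk.le
    · rw [Finset.sum_congr rfl fun j hj => min_eq_left (hk'.trans (absFloor_mono a b
        (by have := (Finset.mem_Ico.mp hj).1; omega : i + 1 ≤ j + 1)
        (by have := (Finset.mem_Ico.mp hj).2; omega)))]
      simp [mul_comm]
  have h2 : ∑ j ∈ Finset.Icc 1 i, dFloor a b j =
      -((∑ j ∈ Finset.range i, absFloor a b (j + 1) : ℕ) : ℤ) := by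
    rw [Finset.range_eq_Ico, Finset.sum_Ico_add' (fun j => absFloor a b j) 0 i 1]
    push_cast
    rw [← Finset.sum_neg_distrib]
    refine Finset.sum_congr (by ext j; simp) fun j hj => dFloor_eq a b ?_
    have := (Finset.mem_Ico.mp hj).2
    omega
  rw [parityTerm, h2, h1]
  push_cast [Nat.cast_sub hi.le]
  generalize (∑ j ∈ Finset.range i, (absFloor a b (j + 1) : ℤ)) = s
  generalize (k : ℤ) * ((numNegParams a b : ℤ) - i) = t
  omega

/-- The intervals between consecutive `|[d_i]|` tile `[1, |[d_n]|]`; an interval is empty when two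
neighbours coincide. -/
lemma sum_blocks (f : ℕ → ℤ) {n : ℕ} (hn : n ≤ numNegParams a b) :
    ∑ i ∈ Finset.range n, ∑ k ∈ Finset.Icc (absFloor a b i + 1) (absFloor a b (i + 1)), f k =
      ∑ k ∈ Finset.Icc 1 (absFloor a b n), f k := by
  have hIcc : ∀ s t : ℕ, Finset.Icc (s + 1) t = Finset.Ioc s t := fun s t => by
    ext; simp
  induction n with
  | zero => rfl
  | succ n ih =>
    rw [Finset.sum_range_succ, ih (by omega), hIcc (absFloor a b n),
      show Finset.Icc 1 (absFloor a b n) = Finset.Ioc 0 _ from hIcc 0 _,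
      show Finset.Icc 1 (absFloor a b (n + 1)) = Finset.Ioc 0 _ from hIcc 0 _,
      Finset.sum_Ioc_consecutive f (Nat.zero_le _) (absFloor_mono a b n.le_succ hn)]

/-- The largest of the numbers `|[d_i]|`. -/
def maxFloor : ℕ := absFloor a b (numNegParams a b)

lemma negIndex_eq :
    negIndex a b = ∑ k ∈ Finset.Icc 1 (maxFloor a b), (signExp a b k : ℤ) % 2 := by
  rw [maxFloor, ← sum_blocks a b _ le_rfl, negIndex]
  refine Finset.sum_congr rfl fun i hi => Finset.sum_congr rfl fun k hk => ?_
  have hk' := Finset.mem_Icc.mp hk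
  exact parityTerm_eq a b (Finset.mem_range.mp hi) hk'.1 hk'.2

lemma posIndex_eq :
    posIndex a b = (∑ k ∈ Finset.Icc 1 (maxFloor a b), (1 - (signExp a b k : ℤ) % 2)) + 1 := by
  rw [maxFloor, ← sum_blocks a b _ le_rfl, posIndex]
  congr 1
  refine Finset.sum_congr rfl fun i hi => Finset.sum_congr rfl fun k hk => ?_
  have hk' := Finset.mem_Icc.mp hk
  rw [parityTerm_eq a b (Finset.mem_range.mp hi) hk'.1 hk'.2]

/-- From the largest `|[d_i]|` on every minimum in the exponent is saturated, so the sign of the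
weight is final and its parity is that of `ν`. -/
lemma nu_eq_neg_signExp {k : ℕ} (hk : maxFloor a b ≤ k) : nu a b = -(signExp a b k : ℤ) := by
  rw [signExp_eq_sum, nu, Finset.range_eq_Ico]
  rw [Finset.sum_Ico_add' (fun j => min k (absFloor a b j)) 0 (numNegParams a b) 1]
  push_cast
  rw [← Finset.sum_neg_distrib]
  refine Finset.sum_congr (by ext j; simp) fun j hj => ?_
  have hj' : j ≤ numNegParams a b := by
    have := (Finset.mem_Ico.mp hj).2
    omega
  rw [dFloor_eq a b hj', min_eq_right]
  exact_mod_cast (absFloor_mono a b hj' le_rfl).trans hk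

lemma even_nu_iff {k : ℕ} (hk : maxFloor a b ≤ k) : Even (nu a b) ↔ Even (signExp a b k) := by
  rw [nu_eq_neg_signExp a b hk, even_neg, Int.even_coe_nat]

lemma signExp_zero : signExp a b 0 = 0 := by simp [signExp]

/-- If `ν` is even, no odd exponent occurs beyond `maxFloor`, and none occurs at `k = 0`, so the
count is the sum of the residues over `1, …, maxFloor`. If `ν` is odd, all large `k` qualify. -/
lemma setOf_odd_signExp_index (κ : ℕ) :
    ({k | Odd (signExp a b k)}.Finite ∧ {k | Odd (signExp a b k)}.ncard = κ) ↔
      Even (nu a b) ∧ (κ : ℤ) = negIndex a b := by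
  by_cases hν : Even (nu a b)
  · have hset : {k | Odd (signExp a b k)} =
        ((Finset.Icc 1 (maxFloor a b)).filter fun k => Odd (signExp a b k) : Finset ℕ) := by
      ext k
      simp only [Set.mem_ofPred_eq, Finset.coe_filter, Finset.mem_Icc]
      refine ⟨fun h => ⟨⟨?_, ?_⟩, h⟩, fun h => h.2⟩
      · rw [Nat.one_le_iff_ne_zero]
        rintro rfl
        simp [signExp_zero] at h
      · by_contra hk
        exact Nat.not_even_iff_odd.mpr h ((even_nu_iff a b (not_le.mp hk).le).mp hν)
    have hcard : (((Finset.Icc 1 (maxFloor a b)).filter fun k => Odd (signExp a b k)).card : ℤ) =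
        negIndex a b := by
      rw [negIndex_eq, Finset.card_filter, Nat.cast_sum]
      refine Finset.sum_congr rfl fun k _ => ?_
      split_ifs with h
      · have := Nat.odd_iff.mp h
        push_cast
        omega
      · have := Nat.even_iff.mp (Nat.not_odd_iff_even.mp h)
        push_cast
        omega
    rw [hset, Set.ncard_coe_finset, ← hcard]
    simp only [Finset.finite_toSet, true_and, hν, Nat.cast_inj]
    exact eq_comm
  · refine ⟨fun h => absurd h.1 ?_, fun h => absurd h.1 hν⟩
    refine Set.Infinite.mono (s := Set.Ici (maxFloor a b)) (fun k hk => ?_) (Set.Ici_infinite _)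
    exact Nat.not_even_iff_odd.mp fun h => hν ((even_nu_iff a b hk).mpr h)

/-- Here `k = 0` always belongs to the set, since the exponent is zero there; this is the extra `1`
in the positive index. -/
lemma setOf_even_signExp_index (κ : ℕ) :
    ({k | Even (signExp a b k)}.Finite ∧ {k | Even (signExp a b k)}.ncard = κ) ↔
      Odd (nu a b) ∧ (κ : ℤ) = posIndex a b := by
  by_cases hν : Odd (nu a b)
  · have hset : {k | Even (signExp a b k)} = ((insert 0
        ((Finset.Icc 1 (maxFloor a b)).filter fun k => Even (signExp a b k)) : Finset ℕ) :
          Set ℕ) := by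
      ext k
      simp only [Set.mem_ofPred_eq, Finset.coe_insert, Finset.coe_filter, Finset.mem_Icc,
        Set.mem_insert_iff]
      constructor
      · intro h
        rcases Nat.eq_zero_or_pos k with hk | hk
        · exact Or.inl hk
        · refine Or.inr ⟨⟨hk, ?_⟩, h⟩
          by_contra hk'
          exact Int.not_even_iff_odd.mpr hν ((even_nu_iff a b (not_le.mp hk').le).mpr h)
      · rintro (rfl | h)
        · simp [signExp_zero]
        · exact h.2
    have hcard : ((insert 0 ((Finset.Icc 1 (maxFloor a b)).filter
        fun k => Even (signExp a b k)) : Finset ℕ).card : ℤ) = posIndex a b := by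
      rw [posIndex_eq, Finset.card_insert_of_notMem (by simp), Finset.card_filter, Nat.cast_succ,
        Nat.cast_sum]
      congr 1
      refine Finset.sum_congr rfl fun k _ => ?_
      split_ifs with h
      · have := Nat.even_iff.mp h
        push_cast
        omega
      · have := Nat.odd_iff.mp (Nat.not_even_iff_odd.mp h)
        push_cast
        omega
    rw [hset, Set.ncard_coe_finset, ← hcard]
    simp only [Finset.finite_toSet, true_and, hν, Nat.cast_inj]
    exact eq_comm
  · refine ⟨fun h => absurd h.1 ?_, fun h => absurd h.1 hν⟩
    refine Set.Infinite.mono (s := Set.Ici (maxFloor a b)) (fun k hk => ?_) (Set.Ici_infinite _)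
    exact (even_nu_iff a b hk).mp (Int.not_odd_iff_even.mp hν)

end

section

/-! ### The poles of the Gamma quotients -/

lemma poleCount_append (l l' : List ℝ) (s : ℂ) :
    poleCount (l ++ l') s = poleCount l s + poleCount l' s := by
  simp [poleCount, List.countP_append]

lemma poleCount_eq_zero {l : List ℝ} {x : ℝ} (h : ∀ y ∈ l, 0 < y + x) : poleCount l x = 0 := by
  rw [poleCount, List.countP_eq_zero]
  intro y hy
  simp only [decide_eq_true_eq, not_exists]
  intro n hn
  have h1 : y + x = -n := by exact_mod_cast hn
  have := h y hy
  have := n.cast_nonneg (α := ℝ)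
  linarith

open Classical in
lemma poleCount_ofFn {n : ℕ} (f : Fin n → ℝ) (x : ℝ) :
    poleCount (List.ofFn f) x =
      (Finset.univ.filter fun i => ∃ m : ℕ, f i + x = -m).card := by
  have h1 : ∀ y : ℝ, (∃ m : ℕ, (y : ℂ) + (x : ℂ) = -m) ↔ ∃ m : ℕ, y + x = -m := fun y =>
    exists_congr fun m => by
      rw [← Complex.ofReal_inj]
      push_cast
      rfl
  simp only [poleCount, h1]
  rw [List.ofFn_eq_map, List.countP_map, Finset.card_def, Finset.filter_val,
    ← Multiset.countP_eq_card_filter, Fin.univ_def]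
  simp only [Multiset.coe_countP]
  rfl

variable {p q : ℕ}

open Classical in
lemma poleCount_shift (f : Fin p → ℝ) (x y : ℝ) :
    poleCount (List.ofFn fun i => f i + y) x = poleCount (List.ofFn f) ((x + y : ℝ) : ℂ) := by
  rw [poleCount_ofFn, poleCount_ofFn]
  refine congrArg Finset.card (Finset.ext fun i => ?_)
  rw [Finset.mem_filter, Finset.mem_filter]
  refine and_congr_right fun _ => exists_congr fun m => ?_
  rw [add_assoc, add_comm y x]

/-- If a pole at `x` is not cancelled, then there is an uncancelled `b_i` with `-b_i ≥ x`. -/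
lemma exists_uncancelled {a : Fin p → ℝ} {b : Fin q → ℝ} {x : ℝ}
    (h : poleCount (List.ofFn a) x < poleCount (List.ofFn b) x) :
    ∃ i ∈ uncancelled a b, x ≤ -b i := by
  classical
  rw [poleCount_ofFn, poleCount_ofFn] at h
  set B := Finset.univ.filter fun i => ∃ m : ℕ, b i + x = -m with hB
  have hne : B.Nonempty := Finset.card_pos.mp (by omega)
  -- Take the largest `b_i` with a pole at `x`. Every `b_j` with a pole at `x` lies below it by a
  -- natural number, while every `a_j` with `b_i - a_j ∈ ℕ₀` also has a pole at `x`. The excess at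
  -- `x` is therefore inherited by the pole `-b_i`.
  obtain ⟨i, hi, hmax⟩ := B.exists_max_image b hne
  obtain ⟨m, hm⟩ := (Finset.mem_filter.mp hi).2
  refine ⟨i, ?_, by linarith [m.cast_nonneg (α := ℝ)]⟩
  rw [uncancelled, Finset.mem_filter]
  refine ⟨Finset.mem_univ _, lt_of_le_of_lt (Finset.card_le_card fun j hj => ?_)
    (h.trans_le (Finset.card_le_card fun j hj => ?_))⟩
  · obtain ⟨n, hn⟩ := (Finset.mem_filter.mp hj).2
    refine Finset.mem_filter.mpr ⟨Finset.mem_univ _, m + n, ?_⟩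
    push_cast
    linarith
  · obtain ⟨n, hn⟩ := (Finset.mem_filter.mp hj).2
    have h1 := hmax j hj
    have h2 : (m : ℝ) ≤ n := by linarith
    have h3 : m ≤ n := by exact_mod_cast h2
    refine Finset.mem_filter.mpr ⟨Finset.mem_univ _, n - m, ?_⟩
    rw [Nat.cast_sub h3]
    linarith

lemma neg_l₁_lt {a : Fin p → ℝ} {b : Fin q → ℝ} (hb : ∀ i, ∀ n : ℕ, b i ≠ -(n : ℝ)) {i : Fin q}
    (hi : i ∈ uncancelled a b) : -(l₁ a b : ℝ) < b i := by
  have h1 : (-⌊b i⌋).toNat ≤ l₁ a b :=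
    Finset.le_sup (f := fun i => (-⌊b i⌋).toNat) hi
  have h2 : -(l₁ a b : ℤ) ≤ ⌊b i⌋ := by omega
  have h3 : -(l₁ a b : ℝ) ≤ b i := by
    have := Int.le_floor.mp h2
    exact_mod_cast this
  exact lt_of_le_of_ne h3 (hb i _).symm

/-- To the right of some point to the left of `l₁` all poles are cancelled. -/
lemma exists_poleCount_le {a : Fin p → ℝ} {b : Fin q → ℝ} (hb : ∀ i, ∀ n : ℕ, b i ≠ -(n : ℝ)) :
    ∃ r : ℝ, r < l₁ a b ∧ ∀ x : ℝ, r < x →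
      poleCount (List.ofFn b) x ≤ poleCount (List.ofFn a) x := by
  -- The inequalities `-b_i < l₁` are strict because no `b_i` is a non-positive integer. They are
  -- finitely many, so there is room for an `r` below `l₁`.
  have h1 : ∀ᶠ r in 𝓝[<] (l₁ a b : ℝ), ∀ i ∈ uncancelled a b, -b i ≤ r :=
    (Finset.eventually_all _).mpr fun i hi => by
      have := neg_l₁_lt hb hi
      filter_upwards [Ioo_mem_nhdsLT (by linarith : -b i < l₁ a b)] with r hr
      exact hr.1.le
  obtain ⟨r, hr, hr'⟩ := (h1.and self_mem_nhdsWithin).exists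
  refine ⟨r, hr', fun x hx => ?_⟩
  by_contra hlt
  obtain ⟨i, hi, hxi⟩ := exists_uncancelled (not_le.mp hlt)
  linarith [hr i hi]

lemma l₂_spec (a : Fin p → ℝ) (b : Fin q → ℝ) {l : ℕ} (hl : l₂ a b ≤ l) :
    (∑ i, b i) + 1 < (∑ i, a i) + 2 * (l : ℝ) := by
  have hne : {k : ℕ | (∑ i, b i) + 1 < (∑ i, a i) + 2 * (k : ℝ)}.Nonempty := by
    obtain ⟨k, hk⟩ := exists_nat_gt (∑ i, b i + 1 - ∑ i, a i)
    refine ⟨k, ?_⟩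
    have := k.cast_nonneg (α := ℝ)
    change (∑ i, b i) + 1 < (∑ i, a i) + 2 * (k : ℝ)
    linarith
  have h1 : (∑ i, b i) + 1 < (∑ i, a i) + 2 * (l₂ a b : ℝ) := Nat.sInf_mem hne
  have h2 : (l₂ a b : ℝ) ≤ l := by exact_mod_cast hl
  linarith

/-! ### Values of the Gamma quotients -/

lemma gammaRatio_ofReal (as bs : List ℝ) (y : ℝ) :
    gammaRatio as bs (y : ℂ) =
      (((bs.map fun β => Real.Gamma (β + y)).prod / (as.map fun α => Real.Gamma (α + y)).prod :
        ℝ) : ℂ) := by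
  have h : ∀ l : List ℝ, (l.map fun β : ℝ => Complex.Gamma ((β : ℂ) + y)).prod =
      (((l.map fun β => Real.Gamma (β + y)).prod : ℝ) : ℂ) := by
    intro l
    induction l with
    | nil => simp
    | cons x l ih =>
      rw [List.map_cons, List.prod_cons, ih, List.map_cons, List.prod_cons, Complex.ofReal_mul,
        ← Complex.ofReal_add, Complex.Gamma_ofReal]
  rw [gammaRatio, h, h, Complex.ofReal_div, div_eq_mul_inv]

lemma gammaQuot_ne_zero {a : Fin p → ℝ} {b : Fin q → ℝ}
    (ha : ∀ i, ∀ n : ℕ, a i ≠ -(n : ℝ)) (hb : ∀ i, ∀ n : ℕ, b i ≠ -(n : ℝ)) :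
    gammaQuot a b ≠ 0 :=
  div_ne_zero (Finset.prod_ne_zero_iff.mpr fun i _ => Real.Gamma_ne_zero (ha i))
    (Finset.prod_ne_zero_iff.mpr fun i _ => Real.Gamma_ne_zero (hb i))

lemma prod_Gamma_add_nat {a : Fin p → ℝ} (ha : ∀ i, ∀ n : ℕ, a i ≠ -(n : ℝ)) (k : ℕ) :
    ∏ i, Real.Gamma (a i + k) = (∏ i, poch (a i) k) * ∏ i, Real.Gamma (a i) := by
  rw [← Finset.prod_mul_distrib]
  exact Finset.prod_congr rfl fun i _ => Gamma_add_nat (ha i) k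

/-- The quotient of the Gamma products at shifted parameters, in terms of the weights. -/
lemma prod_Gamma_div {a : Fin p → ℝ} {b : Fin q → ℝ} {θ : ℝ} (hθ : 0 < θ)
    (ha : ∀ i, ∀ n : ℕ, a i ≠ -(n : ℝ)) (hb : ∀ i, ∀ n : ℕ, b i ≠ -(n : ℝ)) (k : ℕ) :
    (∏ i, Real.Gamma (b i + k)) / ∏ i, Real.Gamma (a i + k) =
      coeffWeight a b θ k / (gammaQuot a b * k.factorial * θ ^ k) := by
  have h1 : ∏ i, poch (a i) k ≠ 0 := Finset.prod_ne_zero_iff.mpr fun i _ => poch_ne_zero (ha i) k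
  have h2 : ∏ i, Real.Gamma (a i) ≠ 0 :=
    Finset.prod_ne_zero_iff.mpr fun i _ => Real.Gamma_ne_zero (ha i)
  have h3 : ∏ i, Real.Gamma (b i) ≠ 0 :=
    Finset.prod_ne_zero_iff.mpr fun i _ => Real.Gamma_ne_zero (hb i)
  rw [prod_Gamma_add_nat ha, prod_Gamma_add_nat hb, coeffWeight, gammaQuot]
  field_simp

/-- At `1 + k` the shifted parameters give the weight of index `k + l`. The two zeros give `(k!)²`,
and the parameter `l` gives one `(k+l)!` in the denominator besides the one in the weight. This
cancels the square of the factor `(k+l)! / k!` from `l` differentiations. -/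
lemma gammaRatio_derivative {a : Fin p → ℝ} {b : Fin q → ℝ} {θ : ℝ} (hθ : 0 < θ)
    (ha : ∀ i, ∀ n : ℕ, a i ≠ -(n : ℝ)) (hb : ∀ i, ∀ n : ℕ, b i ≠ -(n : ℝ)) (l k : ℕ) :
    gammaRatio (List.ofFn (fun i => a i + (l : ℝ) - 1) ++ [(l : ℝ)])
        (List.ofFn (fun i => b i + (l : ℝ) - 1) ++ [0, 0]) (((1 : ℝ) + k : ℝ) : ℂ) =
      ((coeffWeight a b θ (k + l) * (k.factorial : ℝ) ^ 2 /
        (gammaQuot a b * ((k + l).factorial : ℝ) ^ 2 * θ ^ (k + l)) : ℝ) : ℂ) := by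
  rw [gammaRatio_ofReal]
  congr 1
  simp only [List.map_append, List.prod_append, List.map_ofFn, List.prod_ofFn, List.map_cons,
    List.map_nil, List.prod_cons, List.prod_nil, mul_one, zero_add, Function.comp_apply]
  have e1 : ∀ x : ℝ, x + (l : ℝ) - 1 + (1 + k) = x + ((k + l : ℕ) : ℝ) := fun x => by
    push_cast; ring
  have e2 : Real.Gamma (1 + (k : ℝ)) = k.factorial := by
    rw [add_comm, Real.Gamma_nat_eq_factorial]
  have e3 : Real.Gamma ((l : ℝ) + (1 + k)) = (k + l).factorial := by
    rw [← Real.Gamma_nat_eq_factorial]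
    congr 1
    push_cast
    ring
  simp only [e1, e2, e3]
  have h := prod_Gamma_div hθ ha hb (k + l)
  rw [mul_div_mul_comm, h]
  have hg := gammaQuot_ne_zero ha hb
  field_simp

/-- `Γ(1 + k) / Γ(2 + k) = 1 / (k + 1)`: the `2l` pairs compensate the factors `(k + 1)^l` of
`(Dz)^l` in both functions, and the remaining `1` supplies the `k!` of the weight. -/
lemma gammaRatio_Dz {a : Fin p → ℝ} {b : Fin q → ℝ} {θ : ℝ} (hθ : 0 < θ)
    (ha : ∀ i, ∀ n : ℕ, a i ≠ -(n : ℝ)) (hb : ∀ i, ∀ n : ℕ, b i ≠ -(n : ℝ)) (l k : ℕ) :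
    gammaRatio (List.ofFn a ++ List.replicate (2 * l) 2)
        (List.ofFn b ++ List.replicate (2 * l + 1) 1) (((0 : ℝ) + k : ℝ) : ℂ) =
      ((coeffWeight a b θ k / (gammaQuot a b * θ ^ k * ((k : ℝ) + 1) ^ (2 * l)) : ℝ) : ℂ) := by
  rw [gammaRatio_ofReal]
  congr 1
  simp only [List.map_append, List.prod_append, List.map_ofFn, List.prod_ofFn, List.map_replicate,
    List.prod_replicate, zero_add, Function.comp_apply]
  have e2 : Real.Gamma (1 + (k : ℝ)) = k.factorial := by
    rw [add_comm, Real.Gamma_nat_eq_factorial]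
  have e3 : Real.Gamma (2 + (k : ℝ)) = (k + 1) * k.factorial := by
    have := Real.Gamma_nat_eq_factorial (k + 1)
    rw [Nat.factorial_succ] at this
    push_cast at this
    rw [← this]
    congr 1
    ring
  rw [mul_div_mul_comm, prod_Gamma_div hθ ha hb k, e2, e3]
  have hg := gammaQuot_ne_zero ha hb
  have hk : (k.factorial : ℝ) ≠ 0 := by positivity
  rw [mul_pow, pow_succ]
  field_simp

lemma gammaRatio_plain {a : Fin p → ℝ} {b : Fin q → ℝ} {θ : ℝ} (hθ : 0 < θ)
    (ha : ∀ i, ∀ n : ℕ, a i ≠ -(n : ℝ)) (hb : ∀ i, ∀ n : ℕ, b i ≠ -(n : ℝ)) (k : ℕ) :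
    gammaRatio (List.ofFn (fun i => a i - 1)) (0 :: List.ofFn (fun i => b i - 1))
        (((1 : ℝ) + k : ℝ) : ℂ) =
      ((coeffWeight a b θ k / (gammaQuot a b * θ ^ k) : ℝ) : ℂ) := by
  rw [gammaRatio_ofReal]
  congr 1
  simp only [List.map_ofFn, List.prod_ofFn, List.map_cons, List.prod_cons, zero_add,
    Function.comp_apply]
  have e1 : ∀ x : ℝ, x - 1 + (1 + (k : ℝ)) = x + k := fun x => by ring
  have e2 : Real.Gamma (1 + (k : ℝ)) = k.factorial := by
    rw [add_comm, Real.Gamma_nat_eq_factorial]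
  simp only [e1, e2]
  rw [mul_div_assoc, prod_Gamma_div hθ ha hb k]
  have hg := gammaQuot_ne_zero ha hb
  field_simp

end

section

/-! ### Comparison of weights -/

namespace IsPowerLike

lemma rpow (e : ℝ) : IsPowerLike (fun k => ((k : ℝ) + 1) ^ e) e :=
  ⟨1, one_pos, fun k => by rw [abs_of_pos (rpow_succ_pos e k), one_mul]; exact ⟨le_rfl, le_rfl⟩⟩

/-- The ratio `(k + l + 1) / (k + 1)` stays between `1` and `l + 1`; the exponent `|e|` covers both
signs of `e`. -/
lemma shift_rpow (e : ℝ) (l : ℕ) : IsPowerLike (fun k => ((k : ℝ) + l + 1) ^ e) e := by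
  refine ⟨((l : ℝ) + 1) ^ |e|, by positivity, fun k => ?_⟩
  have h1 : (0 : ℝ) < (k : ℝ) + 1 := by positivity
  have h2 : (0 : ℝ) < (k : ℝ) + l + 1 := by positivity
  set r := ((k : ℝ) + l + 1) / (k + 1) with hr
  have hr1 : 1 ≤ r := by
    rw [hr, one_le_div h1]
    linarith [l.cast_nonneg (α := ℝ)]
  have hrl : r ≤ l + 1 := by
    rw [hr, div_le_iff₀ h1]
    nlinarith [l.cast_nonneg (α := ℝ), k.cast_nonneg (α := ℝ),
      mul_nonneg (l.cast_nonneg (α := ℝ)) (k.cast_nonneg (α := ℝ))]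
  have hr0 : 0 < r := by linarith
  have hle : ∀ s : ℝ, s ≤ |e| → r ^ s ≤ ((l : ℝ) + 1) ^ |e| := fun s hs =>
    (Real.rpow_le_rpow_of_exponent_le hr1 hs).trans
      (Real.rpow_le_rpow hr0.le hrl (abs_nonneg e))
  have e1 : ((k : ℝ) + l + 1) = r * (k + 1) := by
    rw [hr]
    field_simp
  beta_reduce
  rw [abs_of_pos (Real.rpow_pos_of_pos h2 e), e1, Real.mul_rpow hr0.le h1.le]
  constructor
  · have h3 := hle (-e) (neg_le_abs e)
    have h4 : r ^ (-e) * r ^ e = 1 := by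
      rw [← Real.rpow_add hr0, neg_add_cancel, Real.rpow_zero]
    calc ((k : ℝ) + 1) ^ e = r ^ (-e) * r ^ e * ((k : ℝ) + 1) ^ e := by rw [h4, one_mul]
      _ ≤ ((l : ℝ) + 1) ^ |e| * r ^ e * ((k : ℝ) + 1) ^ e := by gcongr
      _ = _ := by ring
  · gcongr
    exact hle e (le_abs_self e)

lemma shift {f : ℕ → ℝ} {e : ℝ} (hf : IsPowerLike f e) (l : ℕ) :
    IsPowerLike (fun k => f (k + l)) e := by
  obtain ⟨C, hC, hf⟩ := hf
  obtain ⟨C', hC', hg⟩ := shift_rpow e l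
  refine ⟨C * C', by positivity, fun k => ?_⟩
  have h1 := hf (k + l)
  have h2 := hg k
  beta_reduce at h2
  rw [abs_of_pos (by positivity)] at h2
  push_cast at h1
  constructor
  · calc _ ≤ C' * ((k : ℝ) + l + 1) ^ e := h2.1
      _ ≤ C' * (C * |f (k + l)|) := by
        gcongr
        exact h1.1
      _ = _ := by ring
  · calc _ ≤ C * ((k : ℝ) + l + 1) ^ e := h1.2
      _ ≤ C * (C' * ((k : ℝ) + 1) ^ e) := by
        gcongr
        exact h2.2
      _ = _ := by ring

lemma summable_of_summable {f g : ℕ → ℝ} {e : ℝ} (hf : IsPowerLike f e) (hg : IsPowerLike g e)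
    {y : ℕ → ℝ} (hy : ∀ k, 0 ≤ y k) (h : Summable fun k => |g k| * y k) :
    Summable fun k => |f k| * y k := by
  obtain ⟨C, hC, hf⟩ := hf
  obtain ⟨C', hC', hg⟩ := hg
  refine Summable.of_nonneg_of_le (fun k => mul_nonneg (abs_nonneg _) (hy k)) (fun k => ?_)
    (h.mul_left (C * C'))
  have := hy k
  calc |f k| * y k ≤ C * ((k : ℝ) + 1) ^ e * y k := by
        gcongr
        exact (hf k).2
    _ ≤ C * (C' * |g k|) * y k := by
        gcongr
        exact (hg k).1
    _ = _ := by ring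

end IsPowerLike

/-- The quotient equals `l! (l + 1)_k / k!`. -/
lemma isPowerLike_factorial_quot (l : ℕ) :
    IsPowerLike (fun k => ((k + l).factorial : ℝ) / k.factorial) l := by
  have h1 : ∀ n : ℕ, ((l : ℝ) + 1) ≠ -n := fun n h => by
    have := n.cast_nonneg (α := ℝ)
    have := l.cast_nonneg (α := ℝ)
    linarith
  have h2 := isPowerLike_poch h1
  have h3 : IsPowerLike (fun _ => (l.factorial : ℝ)) 0 :=
    IsPowerLike.of_tendsto (fun k => by positivity)
      (by positivity : (l.factorial : ℝ) ≠ 0) (by simp)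
  refine isPowerLike_of_eq (h3.mul h2) (funext fun k => ?_) (by ring)
  have h4 := Gamma_add_nat h1 k
  rw [Real.Gamma_nat_eq_factorial] at h4
  have h5 : Real.Gamma ((l : ℝ) + 1 + k) = (k + l).factorial := by
    rw [← Real.Gamma_nat_eq_factorial]
    congr 1
    push_cast
    ring
  rw [← h5, h4]
  ring

variable {p : ℕ}

section Weights

variable {a : Fin p → ℝ} {b : Fin (p - 1) → ℝ} {θ : ℝ}

theorem isWeight_coeffWeight (hp : 1 ≤ p) (hθ : 0 < θ)
    (ha : ∀ i, ∀ n : ℕ, a i ≠ -(n : ℝ)) (hb : ∀ i, ∀ n : ℕ, b i ≠ -(n : ℝ)) :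
    IsWeight (coeffWeight a b θ) (Real.sqrt θ) := by
  refine ⟨coeffWeight_ne_zero hθ ha hb, fun q hq hqθ => ?_⟩
  rw [Real.sq_sqrt hθ.le] at hqθ
  have h1 := (isPowerLike_coeffWeight hp hθ ha hb).inv
  have h2 := h1.summable_of_summable (IsPowerLike.rpow _) (y := fun k => (q / θ) ^ k)
    (fun k => by positivity) (by
      simp only [abs_of_pos (rpow_succ_pos _ _)]
      exact summable_rpow_mul_geometric _ (by positivity) ((div_lt_one hθ).mpr hqθ))
  refine h2.congr fun k => ?_
  have h3 : |coeffWeight a b θ k| ≠ 0 := abs_ne_zero.mpr (coeffWeight_ne_zero hθ ha hb k)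
  rw [abs_inv, abs_div, abs_of_pos (by positivity : 0 < θ ^ k), div_pow]
  field_simp

lemma pFq_eq (hθ : 0 < θ) (ha : ∀ i, ∀ n : ℕ, a i ≠ -(n : ℝ))
    (hb : ∀ i, ∀ n : ℕ, b i ≠ -(n : ℝ)) (w : ℂ) :
    pFq a b (w / (θ : ℂ)) = ∑' k : ℕ, w ^ k / (coeffWeight a b θ k : ℂ) := by
  refine tsum_congr fun k => ?_
  have h1 : ((∏ i, poch (a i) k : ℝ) : ℂ) ≠ 0 := by
    exact_mod_cast Finset.prod_ne_zero_iff.mpr fun i _ => poch_ne_zero (ha i) k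
  have h2 : ((∏ i, poch (b i) k : ℝ) : ℂ) ≠ 0 := by
    exact_mod_cast Finset.prod_ne_zero_iff.mpr fun i _ => poch_ne_zero (hb i) k
  have h3 : (k.factorial : ℂ) ≠ 0 := by exact_mod_cast k.factorial_ne_zero
  have h4 : (θ : ℂ) ≠ 0 := by exact_mod_cast hθ.ne'
  rw [coeffWeight, Complex.ofReal_div, Complex.ofReal_div, Complex.ofReal_mul, Complex.ofReal_mul,
    Complex.ofReal_pow, Complex.ofReal_natCast, div_pow]
  field_simp

/-- If `γ = ∑ a - ∑ b + 2 l - 1`, then the `l`-th derivatives of the elements of the weighted space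
have a finite norm with the weights `θ^k (k + 1)^(-γ)`. -/
lemma summable_derivative (hp : 1 ≤ p) (hθ : 0 < θ)
    (ha : ∀ i, ∀ n : ℕ, a i ≠ -(n : ℝ)) (hb : ∀ i, ∀ n : ℕ, b i ≠ -(n : ℝ)) {F : ℂ → ℂ}
    (hF : Summable fun k => |coeffWeight a b θ k| * ‖taylorCoeff F k‖ ^ 2) {l : ℕ} {γ : ℝ}
    (hγ : γ = (∑ i, a i) - (∑ i, b i) + 2 * l - 1) :
    Summable fun k : ℕ => ‖taylorCoeff (iteratedDeriv l F) k‖ ^ 2 * θ ^ k *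
      ((k : ℝ) + 1) ^ (-γ) := by
  have hf := ((isPowerLike_factorial_quot l).mul (isPowerLike_factorial_quot l)).mul
    (IsPowerLike.rpow (-γ))
  have hg := isPowerLike_of_eq ((isPowerLike_coeffWeight hp hθ ha hb).shift l) rfl
    (by rw [hγ]; ring : _ = (l : ℝ) + l + -γ)
  have h := hf.summable_of_summable hg (y := fun k => ‖taylorCoeff F (k + l)‖ ^ 2 * θ ^ k)
    (fun k => by positivity) (by
      refine (((summable_nat_add_iff l).mpr hF).mul_right ((θ ^ l)⁻¹)).congr fun k => ?_
      rw [abs_div, abs_of_pos (by positivity : 0 < θ ^ (k + l)), pow_add]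
      field_simp)
  refine h.congr fun k => ?_
  rw [taylorCoeff_iteratedDeriv, norm_mul, Complex.norm_real, mul_pow, Real.norm_eq_abs, sq_abs,
    abs_of_pos (by positivity)]
  ring

/-- `(Dz)^l` multiplies the `k`-th coefficient by `(k + 1)^l`, the same growth as for the `l`-th
derivative but without a shift of the index, so the same `γ` appears. -/
lemma summable_Dz (hp : 1 ≤ p) (hθ : 0 < θ)
    (ha : ∀ i, ∀ n : ℕ, a i ≠ -(n : ℝ)) (hb : ∀ i, ∀ n : ℕ, b i ≠ -(n : ℝ)) {F : ℂ → ℂ}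
    (hFd : DifferentiableOn ℂ F (Metric.ball 0 (Real.sqrt θ)))
    (hF : Summable fun k => |coeffWeight a b θ k| * ‖taylorCoeff F k‖ ^ 2) {l : ℕ} {γ : ℝ}
    (hγ : γ = (∑ i, a i) - (∑ i, b i) + 2 * l - 1) :
    Summable fun k : ℕ => ‖taylorCoeff (Dz^[l] F) k‖ ^ 2 * θ ^ k * ((k : ℝ) + 1) ^ (-γ) := by
  have hf := ((IsPowerLike.rpow l).mul (IsPowerLike.rpow l)).mul (IsPowerLike.rpow (-γ))
  have hg := isPowerLike_of_eq (isPowerLike_coeffWeight hp hθ ha hb) rfl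
    (by rw [hγ]; ring : _ = (l : ℝ) + l + -γ)
  have h := hf.summable_of_summable hg (y := fun k => ‖taylorCoeff F k‖ ^ 2 * θ ^ k)
    (fun k => by positivity) (by
      refine hF.congr fun k => ?_
      rw [abs_div, abs_of_pos (by positivity : 0 < θ ^ k)]
      field_simp)
  refine h.congr fun k => ?_
  have h1 : ‖((k : ℂ) + 1)‖ = (k : ℝ) + 1 := by
    rw [← Nat.cast_succ, Complex.norm_natCast, Nat.cast_succ]
  rw [taylorCoeff_iterate_Dz (Real.sqrt_pos.mpr hθ) hFd, norm_mul, norm_pow, h1, mul_pow,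
    abs_of_pos (by positivity), Real.rpow_natCast]
  ring

end Weights

end

section

/-! ### The area formulas -/

variable {p : ℕ} {a : Fin p → ℝ} {b : Fin (p - 1) → ℝ} {θ : ℝ}

/-- The area integral with derivatives of order `l`, for the elements of the weighted space. -/
theorem area_formula_derivative (hp : 1 ≤ p) (hθ : 0 < θ)
    (ha : ∀ i, ∀ n : ℕ, a i ≠ -(n : ℝ)) (hb : ∀ i, ∀ n : ℕ, b i ≠ -(n : ℝ)) {l : ℕ}
    (hl₁ : l₁ a b ≤ l) (hl₂ : l₂ a b ≤ l) {F H : ℂ → ℂ} {s : ℂ}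
    (hFd : DifferentiableOn ℂ F (Metric.ball 0 (Real.sqrt θ)))
    (hHd : DifferentiableOn ℂ H (Metric.ball 0 (Real.sqrt θ)))
    (hF : Summable fun k => |coeffWeight a b θ k| * ‖taylorCoeff F k‖ ^ 2)
    (hH : Summable fun k => |coeffWeight a b θ k| * ‖taylorCoeff H k‖ ^ 2)
    (hs : HasSum (fun k => (coeffWeight a b θ k : ℂ) * taylorCoeff F k * conj (taylorCoeff H k)) s) :
    IntegrableOn (fun z : ℂ => iteratedDeriv l F z * conj (iteratedDeriv l H z) *
        meijerG (List.ofFn (fun i => a i + (l : ℝ) - 1) ++ [(l : ℝ)])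
          (List.ofFn (fun i => b i + (l : ℝ) - 1) ++ [0, 0]) (‖z‖ ^ 2 / θ))
        (Metric.ball (0 : ℂ) (Real.sqrt θ)) ∧
      s = ((θ ^ ((l : ℤ) - 1) / Real.pi * gammaQuot a b : ℝ) : ℂ) *
          (∫ z in Metric.ball (0 : ℂ) (Real.sqrt θ), iteratedDeriv l F z *
            conj (iteratedDeriv l H z) *
            meijerG (List.ofFn (fun i => a i + (l : ℝ) - 1) ++ [(l : ℝ)])
              (List.ofFn (fun i => b i + (l : ℝ) - 1) ++ [0, 0]) (‖z‖ ^ 2 / θ)) +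
        ∑ k ∈ Finset.range l,
          (((∏ i, poch (b i) k) * θ ^ k / ((∏ i, poch (a i) k) * k.factorial) : ℝ) : ℂ) *
            iteratedDeriv k F 0 * conj (iteratedDeriv k H 0) := by
  obtain ⟨r₀, hr₀, hpole₀⟩ := exists_poleCount_le (a := a) hb
  have hl₁' : (l₁ a b : ℝ) ≤ l := by exact_mod_cast hl₁
  have hsumA : (List.ofFn (fun i => a i + (l : ℝ) - 1) ++ [(l : ℝ)]).sum =
      (∑ i, a i) + p * (l - 1) + l := by
    simp [List.sum_ofFn, add_sub_assoc, Finset.sum_add_distrib]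
    ring
  have hsumB : (List.ofFn (fun i => b i + (l : ℝ) - 1) ++ [0, 0]).sum =
      (∑ i, b i) + (p - 1) * (l - 1) := by
    simp [List.sum_ofFn, add_sub_assoc, Finset.sum_add_distrib, Nat.cast_sub hp]
    ring
  set as := List.ofFn (fun i => a i + (l : ℝ) - 1) ++ [(l : ℝ)] with has
  set bs := List.ofFn (fun i => b i + (l : ℝ) - 1) ++ [0, 0] with hbs
  have hγ : as.sum - bs.sum = (∑ i, a i) - (∑ i, b i) + 2 * l - 1 := by
    rw [hsumA, hsumB]
    ring
  have hlen : as.length = bs.length := by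
    simp only [has, hbs, List.length_append, List.length_ofFn, List.length_cons, List.length_nil]
    omega
  -- The shift by `l - 1` moves the uncancelled poles below `r₀ - l + 1 < 1`, since `r₀ < l₁ ≤ l`.
  -- The two zeros have their poles at `0, -1, …`. The first moment, at `w = 1`, is thus to the
  -- right of all of them.
  have hpole : ∀ x : ℝ, max (r₀ - l + 1) 0 < x → poleCount bs x ≤ poleCount as x := by
    intro x hx
    obtain ⟨hx1, hx0⟩ := max_lt_iff.mp hx
    rw [has, hbs, poleCount_append, poleCount_append]
    simp only [add_sub_assoc]
    rw [poleCount_shift, poleCount_shift, poleCount_eq_zero (l := [0, 0]) (by simpa using hx0)]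
    exact (hpole₀ _ (by linarith)).trans (Nat.le_add_right _ _)
  have hreg : ∀ k : ℕ, ∀ β ∈ bs, ∀ n : ℕ, β + ((1 : ℝ) + k) ≠ -n := by
    intro k β hβ n hn
    rw [hbs, List.mem_append, List.mem_ofFn'] at hβ
    rcases hβ with ⟨i, rfl⟩ | hβ
    · refine hb i (l + k + n) ?_
      push_cast
      linarith
    · have hβ0 : β = 0 := by simpa using hβ
      have := n.cast_nonneg (α := ℝ)
      have := k.cast_nonneg (α := ℝ)
      linarith
  obtain ⟨h1, h2⟩ := area_integral_meijerG hθ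
    (isPowerSeriesOn_taylorCoeff (differentiableOn_iteratedDeriv Metric.isOpen_ball hFd l))
    (isPowerSeriesOn_taylorCoeff (differentiableOn_iteratedDeriv Metric.isOpen_ball hHd l))
    hlen (by have := l₂_spec a b hl₂; linarith)
    (max_lt (by linarith) one_pos : max (r₀ - l + 1) 0 < 1)
    (max_lt (by linarith) one_pos : max (r₀ - l + 1) 0 < 1) hpole hreg
    (summable_derivative hp hθ ha hb hF hγ) (summable_derivative hp hθ ha hb hH hγ)
  simp only [sub_self, Real.rpow_zero, Complex.ofReal_one, one_mul] at h1 h2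
  refine ⟨h1, ?_⟩
  have hg := gammaQuot_ne_zero ha hb
  have hpoint : ∑ k ∈ Finset.range l,
      (((∏ i, poch (b i) k) * θ ^ k / ((∏ i, poch (a i) k) * k.factorial) : ℝ) : ℂ) *
        iteratedDeriv k F 0 * conj (iteratedDeriv k H 0) =
      ∑ k ∈ Finset.range l, (coeffWeight a b θ k : ℂ) * taylorCoeff F k *
        conj (taylorCoeff H k) := by
    refine Finset.sum_congr rfl fun k _ => ?_
    have h3 : ((∏ i, poch (a i) k : ℝ) : ℂ) ≠ 0 := by
      exact_mod_cast Finset.prod_ne_zero_iff.mpr fun i _ => poch_ne_zero (ha i) k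
    have h4 : (k.factorial : ℂ) ≠ 0 := by exact_mod_cast k.factorial_ne_zero
    rw [coeffWeight, taylorCoeff, taylorCoeff, map_div₀, Complex.conj_natCast, Complex.ofReal_div,
      Complex.ofReal_div, Complex.ofReal_mul, Complex.ofReal_mul, Complex.ofReal_mul,
      Complex.ofReal_mul, Complex.ofReal_natCast]
    field_simp
  -- The `l`-th derivatives do not see the first `l` coefficients; these are the point terms, and
  -- the integral is the tail of the series.
  rw [hpoint, ← sub_eq_iff_eq_add]
  refine ((hasSum_nat_add_iff' l).mpr hs).unique ?_
  refine (congrArg (fun g => HasSum g _) (funext fun k => ?_)).mpr (h2.mul_left _)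
  rw [has, hbs, gammaRatio_derivative hθ ha hb, taylorCoeff_iteratedDeriv,
    taylorCoeff_iteratedDeriv, map_mul, Complex.conj_ofReal]
  have h3 : ((k + l).factorial : ℂ) ≠ 0 := by exact_mod_cast (k + l).factorial_ne_zero
  have h4 : (k.factorial : ℂ) ≠ 0 := by exact_mod_cast k.factorial_ne_zero
  have h5 : (θ : ℂ) ≠ 0 := by exact_mod_cast hθ.ne'
  have h6 : (gammaQuot a b : ℂ) ≠ 0 := by exact_mod_cast hg
  have h7 : (Real.pi : ℂ) ≠ 0 := by exact_mod_cast Real.pi_ne_zero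
  push_cast
  rw [zpow_sub_one₀ h5, zpow_natCast, pow_add]
  field_simp

/-- The area integral with the operator `(Dz)^l`, for the elements of the weighted space. -/
theorem area_formula_Dz (hp : 1 ≤ p) (hθ : 0 < θ)
    (ha : ∀ i, ∀ n : ℕ, a i ≠ -(n : ℝ)) (hb : ∀ i, ∀ n : ℕ, b i ≠ -(n : ℝ)) {l : ℕ}
    (hl₁ : l₁ a b = 0) (hl₂ : l₂ a b ≤ l) {F H : ℂ → ℂ} {s : ℂ}
    (hFd : DifferentiableOn ℂ F (Metric.ball 0 (Real.sqrt θ)))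
    (hHd : DifferentiableOn ℂ H (Metric.ball 0 (Real.sqrt θ)))
    (hF : Summable fun k => |coeffWeight a b θ k| * ‖taylorCoeff F k‖ ^ 2)
    (hH : Summable fun k => |coeffWeight a b θ k| * ‖taylorCoeff H k‖ ^ 2)
    (hs : HasSum (fun k => (coeffWeight a b θ k : ℂ) * taylorCoeff F k * conj (taylorCoeff H k)) s) :
    IntegrableOn (fun z : ℂ => Dz^[l] F z * conj (Dz^[l] H z) * ((1 / ‖z‖ ^ 2 : ℝ) : ℂ) *
        meijerG (List.ofFn a ++ List.replicate (2 * l) 2)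
          (List.ofFn b ++ List.replicate (2 * l + 1) 1) (‖z‖ ^ 2 / θ))
        (Metric.ball (0 : ℂ) (Real.sqrt θ)) ∧
      s = ((1 / Real.pi * gammaQuot a b : ℝ) : ℂ) *
        ∫ z in Metric.ball (0 : ℂ) (Real.sqrt θ),
          Dz^[l] F z * conj (Dz^[l] H z) * ((1 / ‖z‖ ^ 2 : ℝ) : ℂ) *
          meijerG (List.ofFn a ++ List.replicate (2 * l) 2)
            (List.ofFn b ++ List.replicate (2 * l + 1) 1) (‖z‖ ^ 2 / θ) := by
  obtain ⟨r₀, hr₀, hpole₀⟩ := exists_poleCount_le (a := a) hb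
  rw [hl₁, Nat.cast_zero] at hr₀
  have hsumA : (List.ofFn a ++ List.replicate (2 * l) 2).sum = (∑ i, a i) + 4 * l := by
    simp [List.sum_ofFn]
    ring
  have hsumB : (List.ofFn b ++ List.replicate (2 * l + 1) 1).sum = (∑ i, b i) + 2 * l + 1 := by
    simp [List.sum_ofFn]
    ring
  set as := List.ofFn a ++ List.replicate (2 * l) 2 with has
  set bs := List.ofFn b ++ List.replicate (2 * l + 1) 1 with hbs
  have hγ : as.sum - bs.sum = (∑ i, a i) - (∑ i, b i) + 2 * l - 1 := by
    rw [hsumA, hsumB]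
    ring
  have hlen : as.length = bs.length := by
    simp only [has, hbs, List.length_append, List.length_ofFn, List.length_replicate]
    omega
  -- The factor `1/|z|²` means moments from `w = 0` on, so all uncancelled poles must be negative.
  -- This is where `l₁ = 0` enters; the added parameters `1` have their poles at `-1, -2, …`.
  have hpole : ∀ x : ℝ, max r₀ (-1) < x → poleCount bs x ≤ poleCount as x := by
    intro x hx
    obtain ⟨hx1, hx0⟩ := max_lt_iff.mp hx
    rw [has, hbs, poleCount_append, poleCount_append,
      poleCount_eq_zero (l := List.replicate (2 * l + 1) 1) fun y hy => by
        rw [List.eq_of_mem_replicate hy]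
        linarith]
    exact (hpole₀ _ hx1).trans (Nat.le_add_right _ _)
  have hreg : ∀ k : ℕ, ∀ β ∈ bs, ∀ n : ℕ, β + ((0 : ℝ) + k) ≠ -n := by
    intro k β hβ n hn
    rw [hbs, List.mem_append, List.mem_ofFn'] at hβ
    rcases hβ with ⟨i, rfl⟩ | hβ
    · refine hb i (k + n) ?_
      push_cast
      linarith
    · have hβ1 := List.eq_of_mem_replicate hβ
      have := n.cast_nonneg (α := ℝ)
      have := k.cast_nonneg (α := ℝ)
      linarith
  obtain ⟨h1, h2⟩ := area_integral_meijerG hθ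
    (isPowerSeriesOn_taylorCoeff (differentiableOn_iterate_Dz hFd l))
    (isPowerSeriesOn_taylorCoeff (differentiableOn_iterate_Dz hHd l))
    hlen (by have := l₂_spec a b hl₂; linarith)
    (max_lt (by linarith) (by norm_num) : max r₀ (-1) < 1)
    (max_lt hr₀ (by norm_num) : max r₀ (-1) < 0) hpole hreg
    (summable_Dz hp hθ ha hb hFd hF hγ) (summable_Dz hp hθ ha hb hHd hH hγ)
  have h5 : (θ : ℂ) ≠ 0 := by exact_mod_cast hθ.ne'
  have he : (fun z : ℂ => Dz^[l] F z * conj (Dz^[l] H z) * ((1 / ‖z‖ ^ 2 : ℝ) : ℂ) *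
      meijerG as bs (‖z‖ ^ 2 / θ)) = fun z : ℂ => (θ : ℂ)⁻¹ * (Dz^[l] F z * conj (Dz^[l] H z) *
        ((((‖z‖ ^ 2 / θ) ^ ((0 : ℝ) - 1) : ℝ) : ℂ) * meijerG as bs (‖z‖ ^ 2 / θ))) := by
    funext z
    rw [zero_sub, Real.rpow_neg_one, inv_div, Complex.ofReal_div, Complex.ofReal_div,
      Complex.ofReal_one]
    field_simp
  rw [he]
  refine ⟨h1.const_mul _, ?_⟩
  rw [integral_const_mul, ← mul_assoc]
  refine hs.unique ?_
  refine (congrArg (fun g => HasSum g _) (funext fun k => ?_)).mpr (h2.mul_left _)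
  have hR : 0 < Real.sqrt θ := Real.sqrt_pos.mpr hθ
  rw [has, hbs, gammaRatio_Dz hθ ha hb, taylorCoeff_iterate_Dz hR hFd,
    taylorCoeff_iterate_Dz hR hHd, map_mul, map_pow, map_add, Complex.conj_natCast, map_one]
  have h4 : ((k : ℂ) + 1) ≠ 0 := by exact_mod_cast k.succ_ne_zero
  have h6 : (gammaQuot a b : ℂ) ≠ 0 := by exact_mod_cast gammaQuot_ne_zero ha hb
  have h7 : (Real.pi : ℂ) ≠ 0 := by exact_mod_cast Real.pi_ne_zero
  push_cast
  rw [two_mul, pow_add]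
  field_simp

/-- The area integral without derivatives, for the elements of the weighted space. -/
theorem area_formula_plain (hp : 1 ≤ p) (hθ : 0 < θ)
    (ha : ∀ i, ∀ n : ℕ, a i ≠ -(n : ℝ)) (hb : ∀ i, ∀ n : ℕ, b i ≠ -(n : ℝ))
    (hl₁ : l₁ a b = 0) (hl₂ : l₂ a b = 0) {F H : ℂ → ℂ} {s : ℂ}
    (hFd : DifferentiableOn ℂ F (Metric.ball 0 (Real.sqrt θ)))
    (hHd : DifferentiableOn ℂ H (Metric.ball 0 (Real.sqrt θ)))
    (hF : Summable fun k => |coeffWeight a b θ k| * ‖taylorCoeff F k‖ ^ 2)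
    (hH : Summable fun k => |coeffWeight a b θ k| * ‖taylorCoeff H k‖ ^ 2)
    (hs : HasSum (fun k => (coeffWeight a b θ k : ℂ) * taylorCoeff F k * conj (taylorCoeff H k)) s) :
    IntegrableOn (fun z : ℂ => F z * conj (H z) *
        meijerG (List.ofFn (fun i => a i - 1)) (0 :: List.ofFn (fun i => b i - 1)) (‖z‖ ^ 2 / θ))
        (Metric.ball (0 : ℂ) (Real.sqrt θ)) ∧
      s = ((1 / (θ * Real.pi) * gammaQuot a b : ℝ) : ℂ) *
        ∫ z in Metric.ball (0 : ℂ) (Real.sqrt θ), F z * conj (H z) *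
          meijerG (List.ofFn (fun i => a i - 1)) (0 :: List.ofFn (fun i => b i - 1))
            (‖z‖ ^ 2 / θ) := by
  obtain ⟨r₀, hr₀, hpole₀⟩ := exists_poleCount_le (a := a) hb
  rw [hl₁, Nat.cast_zero] at hr₀
  have hsumA : (List.ofFn (fun i => a i - 1)).sum = (∑ i, a i) - p := by
    simp [List.sum_ofFn]
  have hsumB : (0 :: List.ofFn (fun i => b i - 1)).sum = (∑ i, b i) - (p - 1) := by
    simp [List.sum_ofFn, Nat.cast_sub hp]
  set as := List.ofFn (fun i => a i - 1) with has
  set bs := 0 :: List.ofFn (fun i => b i - 1) with hbs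
  -- The value of `γ` is that of the derivative formula for `l = 0`. There the lists contain one
  -- more common parameter `0`, whose Gamma factors cancel.
  have hγ : as.sum - bs.sum = (∑ i, a i) - (∑ i, b i) + 2 * (0 : ℕ) - 1 := by
    rw [hsumA, hsumB]
    push_cast
    ring
  have hlen : as.length = bs.length := by
    simp only [has, hbs, List.length_ofFn, List.length_cons]
    omega
  have hpole : ∀ x : ℝ, max (r₀ + 1) 0 < x → poleCount bs x ≤ poleCount as x := by
    intro x hx
    obtain ⟨hx1, hx0⟩ := max_lt_iff.mp hx
    rw [has, hbs, ← List.singleton_append, poleCount_append]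
    simp only [sub_eq_add_neg]
    rw [poleCount_shift, poleCount_shift, poleCount_eq_zero (l := [0]) (by simpa using hx0),
      zero_add]
    exact hpole₀ _ (by linarith)
  have hreg : ∀ k : ℕ, ∀ β ∈ bs, ∀ n : ℕ, β + ((1 : ℝ) + k) ≠ -n := by
    intro k β hβ n hn
    rw [hbs, List.mem_cons, List.mem_ofFn'] at hβ
    rcases hβ with hβ | ⟨i, rfl⟩
    · have := n.cast_nonneg (α := ℝ)
      have := k.cast_nonneg (α := ℝ)
      linarith
    · refine hb i (k + n) ?_
      push_cast
      linarith
  have hsum : ∀ {F : ℂ → ℂ}, Summable (fun k => |coeffWeight a b θ k| * ‖taylorCoeff F k‖ ^ 2) →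
      Summable fun k : ℕ => ‖taylorCoeff F k‖ ^ 2 * θ ^ k *
        ((k : ℝ) + 1) ^ (-(as.sum - bs.sum)) := fun hF => by
    simpa only [iteratedDeriv_zero] using summable_derivative hp hθ ha hb hF hγ
  obtain ⟨h1, h2⟩ := area_integral_meijerG hθ (isPowerSeriesOn_taylorCoeff hFd)
    (isPowerSeriesOn_taylorCoeff hHd)
    hlen (by have := l₂_spec a b hl₂.le; linarith)
    (max_lt (by linarith) one_pos : max (r₀ + 1) 0 < 1)
    (max_lt (by linarith) one_pos : max (r₀ + 1) 0 < 1) hpole hreg (hsum hF) (hsum hH)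
  simp only [sub_self, Real.rpow_zero, Complex.ofReal_one, one_mul] at h1 h2
  refine ⟨h1, hs.unique ?_⟩
  refine (congrArg (fun g => HasSum g _) (funext fun k => ?_)).mpr (h2.mul_left _)
  rw [has, hbs, gammaRatio_plain hθ ha hb]
  have h5 : (θ : ℂ) ≠ 0 := by exact_mod_cast hθ.ne'
  have h6 : (gammaQuot a b : ℂ) ≠ 0 := by exact_mod_cast gammaQuot_ne_zero ha hb
  have h7 : (Real.pi : ℂ) ≠ 0 := by exact_mod_cast Real.pi_ne_zero
  push_cast
  field_simp

end

-- Existence and the signs of the hypergeometric weights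

section

section Existence

variable {p : ℕ} {a : Fin p → ℝ} {b : Fin (p - 1) → ℝ} {θ : ℝ}

lemma setOf_coeffWeight_neg (hθ : 0 < θ)
    (ha : ∀ i, ∀ n : ℕ, a i ≠ -(n : ℝ)) (hb : ∀ i, ∀ n : ℕ, b i ≠ -(n : ℝ)) :
    {k | coeffWeight a b θ k < 0} = {k | Odd (signExp a b k)} :=
  Set.ext fun k => coeffWeight_neg_iff hθ ha hb k

lemma setOf_coeffWeight_pos (hθ : 0 < θ)
    (ha : ∀ i, ∀ n : ℕ, a i ≠ -(n : ℝ)) (hb : ∀ i, ∀ n : ℕ, b i ≠ -(n : ℝ)) :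
    {k | 0 < coeffWeight a b θ k} = {k | Even (signExp a b k)} :=
  Set.ext fun k => coeffWeight_pos_iff hθ ha hb k

lemma isPositivePontryagin_weightedSpace_iff (hp : 1 ≤ p) (hθ : 0 < θ)
    (ha : ∀ i, ∀ n : ℕ, a i ≠ -(n : ℝ)) (hb : ∀ i, ∀ n : ℕ, b i ≠ -(n : ℝ)) (κ : ℕ) :
    (weightedSpace (coeffWeight a b θ) (Real.sqrt_pos.mpr hθ)).IsPositivePontryagin κ ↔
      Even (nu a b) ∧ (κ : ℤ) = negIndex a b := by
  rw [(isWeight_coeffWeight hp hθ ha hb).isPositivePontryagin_iff,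
    setOf_coeffWeight_neg hθ ha hb, setOf_odd_signExp_index]

lemma isNegativePontryagin_weightedSpace_iff (hp : 1 ≤ p) (hθ : 0 < θ)
    (ha : ∀ i, ∀ n : ℕ, a i ≠ -(n : ℝ)) (hb : ∀ i, ∀ n : ℕ, b i ≠ -(n : ℝ)) (κ : ℕ) :
    (weightedSpace (coeffWeight a b θ) (Real.sqrt_pos.mpr hθ)).IsNegativePontryagin κ ↔
      Odd (nu a b) ∧ (κ : ℤ) = posIndex a b := by
  rw [(isWeight_coeffWeight hp hθ ha hb).isNegativePontryagin_iff,
    setOf_coeffWeight_pos hθ ha hb, setOf_even_signExp_index]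

lemma isPontryagin_weightedSpace (hp : 1 ≤ p) (hθ : 0 < θ)
    (ha : ∀ i, ∀ n : ℕ, a i ≠ -(n : ℝ)) (hb : ∀ i, ∀ n : ℕ, b i ≠ -(n : ℝ)) :
    (weightedSpace (coeffWeight a b θ) (Real.sqrt_pos.mpr hθ)).IsPontryagin := by
  rcases Int.even_or_odd (nu a b) with h | h
  · have h0 : 0 ≤ negIndex a b := by
      rw [negIndex_eq]
      exact Finset.sum_nonneg fun k _ => by omega
    exact ⟨(negIndex a b).toNat, Or.inl ((isPositivePontryagin_weightedSpace_iff hp hθ ha hb _).mpr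
      ⟨h, Int.toNat_of_nonneg h0⟩)⟩
  · have h0 : 0 ≤ posIndex a b := by
      rw [posIndex_eq]
      exact add_nonneg (Finset.sum_nonneg fun k _ => by omega) zero_le_one
    exact ⟨(posIndex a b).toNat, Or.inr ((isNegativePontryagin_weightedSpace_iff hp hθ ha hb _).mpr
      ⟨h, Int.toNat_of_nonneg h0⟩)⟩

end Existence

end

end HypergeometricKernel

end

-- The main theorem

open HypergeometricKernel in
theorem theorem3 (p : ℕ) (hp : 1 ≤ p) (a : Fin p → ℝ) (b : Fin (p - 1) → ℝ) (θ : ℝ) (hθ : 0 < θ)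
    (ha : ∀ i, ∀ n : ℕ, a i ≠ -(n : ℝ)) (hb : ∀ i, ∀ n : ℕ, b i ≠ -(n : ℝ)) :
    -- the space induced by the kernel exists
    (∃ S : FormSpace (Metric.ball (0 : ℂ) (Real.sqrt θ)), S.IsPontryagin ∧
      S.HasReproducingKernel (fun z u => pFq a b (z * conj u / (θ : ℂ)))) ∧
    -- and every Pontryagin space with this kernel is the one described here
    ∀ S : FormSpace (Metric.ball (0 : ℂ) (Real.sqrt θ)), S.IsPontryagin →
      S.HasReproducingKernel (fun z u => pFq a b (z * conj u / (θ : ℂ))) →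
      -- its elements
      (∀ f : Metric.ball (0 : ℂ) (Real.sqrt θ) → ℂ, f ∈ S.carrier ↔
        DifferentiableOn ℂ (ext f) (Metric.ball (0 : ℂ) (Real.sqrt θ)) ∧
        Summable fun k : ℕ => |coeffWeight a b θ k| * ‖taylorCoeff (ext f) k‖ ^ 2) ∧
      -- its inner product
      (∀ f g : S.carrier, HasSum
        (fun k : ℕ => (coeffWeight a b θ k : ℂ) * taylorCoeff (ext f.1) k *
          conj (taylorCoeff (ext g.1) k)) (S.form f g)) ∧
      -- its sign and index
      (∀ κ : ℕ, S.IsPositivePontryagin κ ↔ Even (nu a b) ∧ (κ : ℤ) = negIndex a b) ∧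
      (∀ κ : ℕ, S.IsNegativePontryagin κ ↔ Odd (nu a b) ∧ (κ : ℤ) = posIndex a b) ∧
      -- the area integral with derivatives of order `l` and point terms
      (∀ f g : S.carrier,
        IntegrableOn (fun z : ℂ => iteratedDeriv (lMax a b) (ext f.1) z *
            conj (iteratedDeriv (lMax a b) (ext g.1) z) *
            meijerG (List.ofFn (fun i => a i + (lMax a b : ℝ) - 1) ++ [(lMax a b : ℝ)])
              (List.ofFn (fun i => b i + (lMax a b : ℝ) - 1) ++ [0, 0]) (‖z‖ ^ 2 / θ))
          (Metric.ball (0 : ℂ) (Real.sqrt θ)) ∧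
        S.form f g =
          ((θ ^ ((lMax a b : ℤ) - 1) / Real.pi * gammaQuot a b : ℝ) : ℂ) *
            (∫ z in Metric.ball (0 : ℂ) (Real.sqrt θ), iteratedDeriv (lMax a b) (ext f.1) z *
              conj (iteratedDeriv (lMax a b) (ext g.1) z) *
              meijerG (List.ofFn (fun i => a i + (lMax a b : ℝ) - 1) ++ [(lMax a b : ℝ)])
                (List.ofFn (fun i => b i + (lMax a b : ℝ) - 1) ++ [0, 0]) (‖z‖ ^ 2 / θ)) +
          ∑ k ∈ Finset.range (lMax a b),
            (((∏ i, poch (b i) k) * θ ^ k / ((∏ i, poch (a i) k) * k.factorial) : ℝ) : ℂ) *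
              iteratedDeriv k (ext f.1) 0 * conj (iteratedDeriv k (ext g.1) 0)) ∧
      -- the area integral with the operator `(Dz)^l`
      (l₁ a b = 0 → ∀ f g : S.carrier,
        IntegrableOn (fun z : ℂ => Dz^[lMax a b] (ext f.1) z * conj (Dz^[lMax a b] (ext g.1) z) *
            ((1 / ‖z‖ ^ 2 : ℝ) : ℂ) *
            meijerG (List.ofFn a ++ List.replicate (2 * lMax a b) 2)
              (List.ofFn b ++ List.replicate (2 * lMax a b + 1) 1) (‖z‖ ^ 2 / θ))
          (Metric.ball (0 : ℂ) (Real.sqrt θ)) ∧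
        S.form f g =
          ((1 / Real.pi * gammaQuot a b : ℝ) : ℂ) *
            ∫ z in Metric.ball (0 : ℂ) (Real.sqrt θ),
              Dz^[lMax a b] (ext f.1) z * conj (Dz^[lMax a b] (ext g.1) z) *
              ((1 / ‖z‖ ^ 2 : ℝ) : ℂ) *
              meijerG (List.ofFn a ++ List.replicate (2 * lMax a b) 2)
                (List.ofFn b ++ List.replicate (2 * lMax a b + 1) 1) (‖z‖ ^ 2 / θ)) ∧
      -- the area integral without derivatives
      (l₁ a b = 0 → l₂ a b = 0 → ∀ f g : S.carrier,
        IntegrableOn (fun z : ℂ => ext f.1 z * conj (ext g.1 z) *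
            meijerG (List.ofFn (fun i => a i - 1)) (0 :: List.ofFn (fun i => b i - 1))
              (‖z‖ ^ 2 / θ))
          (Metric.ball (0 : ℂ) (Real.sqrt θ)) ∧
        S.form f g =
          ((1 / (θ * Real.pi) * gammaQuot a b : ℝ) : ℂ) *
            ∫ z in Metric.ball (0 : ℂ) (Real.sqrt θ), ext f.1 z * conj (ext g.1 z) *
              meijerG (List.ofFn (fun i => a i - 1)) (0 :: List.ofFn (fun i => b i - 1))
                (‖z‖ ^ 2 / θ)) := by
  have hR := Real.sqrt_pos.mpr hθ
  have hw := isWeight_coeffWeight hp hθ ha hb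
  have hker : (fun z u : ℂ => pFq a b (z * conj u / (θ : ℂ))) =
      fun z u : ℂ => ∑' k, (z * conj u) ^ k / (coeffWeight a b θ k : ℂ) :=
    funext fun z => funext fun u => pFq_eq hθ ha hb (z * conj u)
  rw [hker]
  refine ⟨⟨weightedSpace _ hR, isPontryagin_weightedSpace hp hθ ha hb,
    hw.hasReproducingKernel hR⟩, fun S hS hK => ?_⟩
  -- By uniqueness every Pontryagin space with this kernel is literally the weighted space, so the
  -- remaining claims need only be checked there.
  obtain rfl := hw.eq_weightedSpace hR hS hK
  refine ⟨fun f => mem_weightedSpace hR, hasSum_weightedSpace_form hR,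
    isPositivePontryagin_weightedSpace_iff hp hθ ha hb,
    isNegativePontryagin_weightedSpace_iff hp hθ ha hb, fun f g => ?_, fun h₁ f g => ?_,
    fun h₁ h₂ f g => ?_⟩
  · exact area_formula_derivative hp hθ ha hb (le_max_left _ _) (le_max_right _ _) f.2.1 g.2.1
      f.2.2 g.2.2 (hasSum_weightedSpace_form hR f g)
  · exact area_formula_Dz hp hθ ha hb h₁ (le_max_right _ _) f.2.1 g.2.1
      f.2.2 g.2.2 (hasSum_weightedSpace_form hR f g)
  · exact area_formula_plain hp hθ ha hb h₁ h₂ f.2.1 g.2.1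
      f.2.2 g.2.2 (hasSum_weightedSpace_form hR f g)
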